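/- Let $K$ be a number field with ring of integers $\mathcal O_K$, $r_2$ complex places, discriminant $\Delta_K$ and adele ring $\mathbb A$, let $r\ge 1$ be an integer, and let $p:[0,r]\to\mathbb R$ be a polygon, i.e. a continuous function that is affine on each interval of a finite subdivision of $[0,r]$ (for example a convex polygon). **Lattices.** An $\mathcal O_K$-lattice $\Lambda$ is a finitely generated projective $\mathcal O_K$-module $P$ with an inner product over $K_\sigma$ (Euclidean or Hermitian) on $V_\sigma=P\otimes_{\mathcal O_K}K_\sigma$ for each archimedean place $\sigma$. Submodules of $P$ carry the restricted inner products. A submodule $N$ with $P/N$ projective defines a sublattice, and $P/N$ then carries the quotient inner products via $(P/N)\otimes K_\sigma\cong (N\otimes K_\sigma)^\perp$. $\mathrm{Vol}(\Lambda)$ is $2^{r_2\,\mathrm{rk}P}$ times the covolume of $P$ in $P\otimes_{\mathbb Z}\mathbb R=\prod_\sigma V_\sigma$ for the inner product $\sum_\sigma\mathrm{Re}\langle\cdot,\cdot\rangle_\sigma$, and $\deg\Lambda=-\log\mathrm{Vol}(\Lambda)+\frac{\mathrm{rk}P}{2}\log|\Delta_K|$. $\Lambda$ is semi-stable if $\mathrm{Vol}(\Lambda_1)^{\mathrm{rk}\Lambda}\ge\mathrm{Vol}(\Lambda)^{\mathrm{rk}\Lambda_1}$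 for all proper sublattices $\Lambda_1$. The canonical filtration of $\Lambda$ is the filtration $0=\Lambda_0\subset\Lambda_1\subset\dots\subset\Lambda_s=\Lambda$ by sublattices with all $\Lambda_i/\Lambda_{i-1}$ semi-stable and $\mathrm{Vol}(\Lambda_{j+1}/\Lambda_j)^{\mathrm{rk}(\Lambda_j/\Lambda_{j-1})}>\mathrm{Vol}(\Lambda_j/\Lambda_{j-1})^{\mathrm{rk}(\Lambda_{j+1}/\Lambda_j)}$ for $0<j<s$. The polygon of any filtration of $\Lambda$ with strictly increasing ranks from $0$ to $r=\mathrm{rk}\Lambda$ is the function on $[0,r]$ that is affine between consecutive ranks and equals $\deg\Lambda_i-\mathrm{rk}\Lambda_i\cdot\frac{\deg\Lambda}{r}$ at $\mathrm{rk}\Lambda_i$; the canonical polygon $\overline p_\Lambda$ is that of the canonical filtration. For a projective module $P$ of rank $r$, let $\widetilde{\mathbf\Lambda}(P)$ be the space of lattices with underlying module $P$, topologized as an open subset of a product of finite-dimensional real vector spaces of forms. Let $\mathbf\Lambda(P)$ be its topological quotient by isometry (the action of $GL(P)=\mathrm{Aut}_{\mathcal O_K}(P)$) and scaling (multiplying all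 inner products by $T^2$, $T>0$). **Adelic version.** For $g\in GL_r(\mathbb A)$ let $E_g=\{x\in K^r: x\in g_v\mathcal O_v^r\text{ for all finite }v\}$, with the metric $\rho_g$ that at each archimedean $\sigma$ is the inner product on $K_\sigma^r$ for which $g_\sigma$ is an isometry from the standard one. Put $\deg g=\deg(E_g,\rho_g)$. A parabolic subgroup $Q\subset GL_r$ over $K$ is the stabilizer of a flag $0=V_0\subset\dots\subset V_s=K^r$ of subspaces; let $p_Q^g$ be the polygon of the filtration $(E_g\cap V_i)_i$ of $(E_g,\rho_g)$. Let $\overline p_P^g$ be the maximum of $p_Q^g$ over all parabolic subgroups $Q\subset P$, and $\overline p^g=\overline p^g_{GL_r}$. The standard parabolic subgroups are those of block upper triangular matrices; they are indexed by the compositions of $r$. **Theorem.** 1. For every projective $\mathcal O_K$-module $P$ of rank $r$, the set $\{[\Lambda]\in\mathbf\Lambda(P):\overline p_\Lambda\le p\}$ is compact. 2. For every $d\in\mathbb R$, the set $\{g\in GL_r(K)\backslash GL_r(\mathbb A):\deg g=d,\ \overline p^g\le p\}$ is compact. 3. For every $d\in\mathbb R$ and every standard parabolic subgroup $P$ of $GL_r$,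 the set $\{g\in P(K)\backslash GL_r(\mathbb A):\deg g=d,\ \overline p^g_P\le p,\ p^g_P\ge -p\}$ is compact. -/

import Mathlib

open NumberField NumberField.InfinitePlace IsDedekindDomain TensorProduct Module

set_option linter.unusedSectionVars false

noncomputable section

namespace ArakelovLattice

/-! ### The archimedean completions as real or complex fields -/

section Completion

variable {K : Type*} [Field K] (v : InfinitePlace K)

/-- The embedding of `K_v` in `ℂ` is an isomorphism onto `ℝ` for real `v`, onto `ℂ` otherwise. -/
theorem exists_extensionEmbedding_eq {z : ℂ} (hz : v.IsReal → z.im = 0) :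
    ∃ x : v.Completion, Completion.extensionEmbedding v x = z := by
  rcases v.isReal_or_isComplex with hv | hv
  · obtain ⟨x, hx⟩ := Completion.surjective_extensionEmbeddingOfIsReal hv z.re
    refine ⟨x, ?_⟩
    rw [← Completion.extensionEmbeddingOfIsReal_apply hv, hx]
    exact Complex.ext rfl (by simpa using (hz hv).symm)
  · exact Completion.surjective_extensionEmbedding_of_isComplex hv z

theorem im_extensionEmbedding (hv : v.IsReal) (x : v.Completion) :
    (Completion.extensionEmbedding v x).im = 0 := by
  rw [← Completion.extensionEmbeddingOfIsReal_apply hv]; exact Complex.ofReal_im _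

theorem norm_extensionEmbedding (x : v.Completion) :
    ‖Completion.extensionEmbedding v x‖ = ‖x‖ :=
  (Completion.isometry_extensionEmbedding v).norm_map_of_map_zero (map_zero _) x

theorem extensionEmbedding_injective : Function.Injective (Completion.extensionEmbedding v) :=
  (Completion.extensionEmbedding v).injective

/-- The element of `K_v` with a prescribed image in `ℂ`. -/
def ofComplex (z : ℂ) (hz : v.IsReal → z.im = 0) : v.Completion :=
  (exists_extensionEmbedding_eq v hz).choose

@[simp] theorem extensionEmbedding_ofComplex (z : ℂ) (hz : v.IsReal → z.im = 0) :
    Completion.extensionEmbedding v (ofComplex v z hz) = z :=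
  (exists_extensionEmbedding_eq v hz).choose_spec

/-- The inclusion of `ℝ` in `K_v`. -/
def realHom : ℝ →+* v.Completion where
  toFun t := ofComplex v t (fun _ => Complex.ofReal_im t)
  map_one' := extensionEmbedding_injective v (by simp)
  map_mul' x y := extensionEmbedding_injective v (by simp)
  map_zero' := extensionEmbedding_injective v (by simp)
  map_add' x y := extensionEmbedding_injective v (by simp)

@[simp] theorem extensionEmbedding_realHom (t : ℝ) :
    Completion.extensionEmbedding v (realHom v t) = t :=
  extensionEmbedding_ofComplex v _ (fun _ => Complex.ofReal_im t)

/-- Complex conjugation on `K_v` (trivial for real `v`). -/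
def conjHom (x : v.Completion) : v.Completion :=
  ofComplex v ((starRingEnd ℂ) (Completion.extensionEmbedding v x))
    (fun hv => by simp [im_extensionEmbedding v hv])

@[simp] theorem extensionEmbedding_conjHom (x : v.Completion) :
    Completion.extensionEmbedding v (conjHom v x) =
      (starRingEnd ℂ) (Completion.extensionEmbedding v x) :=
  extensionEmbedding_ofComplex v _ _

open Classical in
/-- The imaginary unit of `K_v`: `0` for real `v`, the preimage of `i` for complex `v`. -/
def imagUnit : v.Completion :=
  ofComplex v (if v.IsReal then 0 else Complex.I) (fun hv => by simp [hv])

theorem imagUnit_of_isReal (hv : v.IsReal) : imagUnit v = 0 :=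
  extensionEmbedding_injective v (by simp [imagUnit, hv])

theorem extensionEmbedding_imagUnit (hv : ¬ v.IsReal) :
    Completion.extensionEmbedding v (imagUnit v) = Complex.I := by
  simp [imagUnit, hv]

theorem norm_realHom_mul_le (t : ℝ) (x : v.Completion) : ‖realHom v t * x‖ ≤ ‖t‖ * ‖x‖ := by
  rw [norm_mul, ← norm_extensionEmbedding v (realHom v t)]
  simp

open scoped ComplexOrder in
/-- `K_v` with the real and complex structure transported from its embedding in `ℂ`. -/
@[reducible] def completionRCLike : RCLike v.Completion where
  lt_norm_lt x y hx hxy := by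
    obtain ⟨t, h1, h2⟩ := exists_between hxy
    refine ⟨realHom v t, ?_⟩
    rw [← norm_extensionEmbedding, extensionEmbedding_realHom, Complex.norm_real,
      Real.norm_of_nonneg (hx.trans h1.le)]
    exact ⟨h1, h2⟩
  star := conjHom v
  star_involutive x := extensionEmbedding_injective v (by simp)
  star_mul x y := extensionEmbedding_injective v (by simp [mul_comm])
  star_add x y := extensionEmbedding_injective v (by simp)
  toAlgebra := (realHom v).toAlgebra
  norm_smul_le := norm_realHom_mul_le v
  re := Complex.reAddGroupHom.comp (Completion.extensionEmbedding v).toAddMonoidHom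
  im := Complex.imAddGroupHom.comp (Completion.extensionEmbedding v).toAddMonoidHom
  I := imagUnit v
  I_re_ax := by
    by_cases hv : v.IsReal
    · simp [imagUnit_of_isReal v hv]
    · simp [extensionEmbedding_imagUnit v hv]
  I_mul_I_ax := by
    by_cases hv : v.IsReal
    · exact Or.inl (imagUnit_of_isReal v hv)
    · exact Or.inr (extensionEmbedding_injective v (by simp [extensionEmbedding_imagUnit v hv]))
  re_add_im_ax z := by
    apply extensionEmbedding_injective v
    change Completion.extensionEmbedding v
      (realHom v (Completion.extensionEmbedding v z).re +
        realHom v (Completion.extensionEmbedding v z).im * imagUnit v) = _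
    by_cases hv : v.IsReal
    · apply Complex.ext <;> simp [imagUnit_of_isReal v hv, im_extensionEmbedding v hv]
    · simp [extensionEmbedding_imagUnit v hv, Complex.re_add_im]
  ofReal_re_ax t := by
    change (Completion.extensionEmbedding v (realHom v t)).re = t
    simp
  ofReal_im_ax t := by
    change (Completion.extensionEmbedding v (realHom v t)).im = 0
    simp
  mul_re_ax z w := by simp
  mul_im_ax z w := by simp
  conj_re_ax z := by
    change (Completion.extensionEmbedding v (conjHom v z)).re = _
    simp
  conj_im_ax z := by
    change (Completion.extensionEmbedding v (conjHom v z)).im = _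
    simp
  conj_I_ax := by
    change conjHom v (imagUnit v) = _
    apply extensionEmbedding_injective v
    by_cases hv : v.IsReal
    · simp [imagUnit_of_isReal v hv]
    · simp [extensionEmbedding_imagUnit v hv]
  norm_sq_eq_def_ax z := by
    rw [← norm_extensionEmbedding, Complex.sq_norm, Complex.normSq_apply]; rfl
  mul_im_I_ax z := by
    by_cases hv : v.IsReal
    · simp [im_extensionEmbedding v hv]
    · simp [extensionEmbedding_imagUnit v hv]
  toPartialOrder := PartialOrder.lift (Completion.extensionEmbedding v)
    (extensionEmbedding_injective v)
  le_iff_re_im {z w} := by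
    change Completion.extensionEmbedding v z ≤ Completion.extensionEmbedding v w ↔ _
    exact Complex.le_def
  toDecidableEq := Classical.decEq _

end Completion

/-! ### Inner products on vector spaces over `ℝ` or `ℂ` -/

section Core

variable {𝕜 E F : Type*} [RCLike 𝕜] [AddCommGroup E] [Module 𝕜 E] [AddCommGroup F] [Module 𝕜 F]

theorem core_ext {c c' : InnerProductSpace.Core 𝕜 E} (h : ∀ u w, c.inner u w = c'.inner u w) :
    c = c' := by
  obtain ⟨⟨⟨i⟩, _, _, _, _⟩, _⟩ := c
  obtain ⟨⟨⟨i'⟩, _, _, _, _⟩, _⟩ := c'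
  obtain rfl : i = i' := funext fun u => funext fun w => h u w
  rfl

/-- The inner product `⟨f u, f w⟩` obtained by pulling back along an injective linear map `f`. -/
@[reducible] def coreComap (c : InnerProductSpace.Core 𝕜 F) (f : E →ₗ[𝕜] F) (hf : Function.Injective f) :
    InnerProductSpace.Core 𝕜 E where
  inner u w := c.inner (f u) (f w)
  conj_inner_symm u w := c.conj_inner_symm _ _
  re_inner_nonneg u := c.re_inner_nonneg _
  add_left u w z := by rw [map_add]; exact c.add_left _ _ _
  smul_left u w a := by rw [map_smul]; exact c.smul_left _ _ _
  definite u hu := hf (by rw [map_zero]; exact c.definite _ hu)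

/-- The inner product `T ^ 2 * ⟨u, w⟩`. -/
@[reducible] def coreScale (c : InnerProductSpace.Core 𝕜 E) (T : ℝ) (hT : 0 < T) :
    InnerProductSpace.Core 𝕜 E where
  inner u w := ((T ^ 2 : ℝ) : 𝕜) * c.inner u w
  conj_inner_symm u w := by rw [map_mul, RCLike.conj_ofReal, c.conj_inner_symm]
  re_inner_nonneg u := by
    rw [RCLike.re_ofReal_mul]
    exact mul_nonneg (sq_nonneg T) (c.re_inner_nonneg u)
  add_left u w z := by rw [c.add_left, mul_add]
  smul_left u w a := by rw [c.smul_left, mul_left_comm]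
  definite u hu := by
    have h : ((T ^ 2 : ℝ) : 𝕜) ≠ 0 := RCLike.ofReal_ne_zero.2 (pow_pos hT 2).ne'
    exact c.definite u ((mul_eq_zero.1 hu).resolve_left h)

/-- The orthogonal complement of a subspace. -/
def coreOrthogonal (c : InnerProductSpace.Core 𝕜 E) (W : Submodule 𝕜 E) : Submodule 𝕜 E :=
  letI : NormedAddCommGroup E := c.toNormedAddCommGroup
  letI : InnerProductSpace 𝕜 E := InnerProductSpace.ofCore c.toCore
  Wᗮ

theorem mem_coreOrthogonal (c : InnerProductSpace.Core 𝕜 E) (W : Submodule 𝕜 E) (u : E) :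
    u ∈ coreOrthogonal c W ↔ ∀ w ∈ W, c.inner w u = 0 :=
  Iff.rfl

theorem isCompl_coreOrthogonal [Module.Finite 𝕜 E] (c : InnerProductSpace.Core 𝕜 E)
    (W : Submodule 𝕜 E) : IsCompl W (coreOrthogonal c W) := by
  let : NormedAddCommGroup E := c.toNormedAddCommGroup
  let : InnerProductSpace 𝕜 E := InnerProductSpace.ofCore c.toCore
  exact Submodule.isCompl_orthogonal W

/-- For a surjection `f : E → F`, the isomorphism from `F` to the orthogonal complement of the
kernel of `f`, viewed as a map to `E`. -/
def orthogonalLift [Module.Finite 𝕜 E] (c : InnerProductSpace.Core 𝕜 E) (f : E →ₗ[𝕜] F)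
    (hf : Function.Surjective f) : F →ₗ[𝕜] E :=
  (coreOrthogonal c (LinearMap.ker f)).subtype ∘ₗ
    ((f.quotKerEquivOfSurjective hf).symm.trans
      (Submodule.quotientEquivOfIsCompl _ _ (isCompl_coreOrthogonal c (LinearMap.ker f)))).toLinearMap

theorem orthogonalLift_mem [Module.Finite 𝕜 E] (c : InnerProductSpace.Core 𝕜 E) (f : E →ₗ[𝕜] F)
    (hf : Function.Surjective f) (x : F) :
    orthogonalLift c f hf x ∈ coreOrthogonal c (LinearMap.ker f) :=
  Submodule.coe_mem _

theorem apply_orthogonalLift [Module.Finite 𝕜 E] (c : InnerProductSpace.Core 𝕜 E) (f : E →ₗ[𝕜] F)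
    (hf : Function.Surjective f) (x : F) : f (orthogonalLift c f hf x) = x := by
  set q := (f.quotKerEquivOfSurjective hf).symm x with hq
  have hx : x = f.quotKerEquivOfSurjective hf q := by simp [hq]
  have h : (Submodule.Quotient.mk (orthogonalLift c f hf x) : E ⧸ LinearMap.ker f) = q :=
    Submodule.mk_quotientEquivOfIsCompl_apply (isCompl_coreOrthogonal c (LinearMap.ker f)) q
  calc f (orthogonalLift c f hf x)
      = f.quotKerEquivOfSurjective hf (Submodule.Quotient.mk (orthogonalLift c f hf x)) := rfl
    _ = x := by rw [h, ← hx]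

theorem orthogonalLift_injective [Module.Finite 𝕜 E] (c : InnerProductSpace.Core 𝕜 E)
    (f : E →ₗ[𝕜] F) (hf : Function.Surjective f) :
    Function.Injective (orthogonalLift c f hf) :=
  Function.LeftInverse.injective (apply_orthogonalLift c f hf)

end Core

/-! ### `𝓞 K`-lattices -/

section Lattice

variable (K : Type*) [Field K] [NumberField K] (P : Type*) [AddCommGroup P] [Module (𝓞 K) P]

/-- The space `V_v = K_v ⊗ P` at the archimedean place `v`. -/
abbrev LocalSpace (v : InfinitePlace K) : Type _ := v.Completion ⊗[𝓞 K] P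

/-- An `𝓞 K`-lattice with underlying module `P`: an inner product on `V_v` over `K_v` for each
archimedean place `v`. -/
def OKLattice : Type _ :=
  ∀ v : InfinitePlace K,
    letI := completionRCLike v
    InnerProductSpace.Core v.Completion (LocalSpace K P v)

namespace OKLattice

variable {K P}

/-- The inner product of the lattice at the place `v`. -/
def innerAt (Λ : OKLattice K P) (v : InfinitePlace K) (u w : LocalSpace K P v) : v.Completion :=
  letI := completionRCLike v
  (Λ v).inner u w

/-- The topology of pointwise convergence of the inner products. As all `V_v` are finite
dimensional, this is the topology of an open subset of a product of finite-dimensional real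
vector spaces of symmetric or Hermitian forms. -/
instance : TopologicalSpace (OKLattice K P) :=
  TopologicalSpace.induced
    (fun Λ (v : InfinitePlace K) (u w : LocalSpace K P v) => Λ.innerAt v u w) inferInstance

/-- The lattice `Λ[T]`, with all inner products multiplied by `T ^ 2`. -/
def scale (Λ : OKLattice K P) (T : ℝ) (hT : 0 < T) : OKLattice K P :=
  fun v =>
    letI := completionRCLike v
    coreScale (Λ v) T hT

/-- The lattice `A · Λ` with `⟨u, w⟩_{A · Λ} = ⟨A⁻¹ u, A⁻¹ w⟩_Λ`. -/
def act (A : P ≃ₗ[𝓞 K] P) (Λ : OKLattice K P) : OKLattice K P :=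
  fun v =>
    letI := completionRCLike v
    coreComap (Λ v) (A.symm.baseChange (𝓞 K) v.Completion P P).toLinearMap
    (LinearEquiv.injective _)

/-- The lattice with underlying module a submodule `N`, with the restricted inner products. -/
def restrict (Λ : OKLattice K P) (N : Submodule (𝓞 K) P) : OKLattice K N :=
  fun v =>
    letI := completionRCLike v
    coreComap (Λ v) (N.subtype.baseChange v.Completion)
    (Module.Flat.lTensor_preserves_injective_linearMap N.subtype N.injective_subtype)

theorem ker_baseChange_mkQ (N : Submodule (𝓞 K) P) (v : InfinitePlace K) :
    LinearMap.ker (N.mkQ.baseChange v.Completion) =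
      LinearMap.range (N.subtype.baseChange v.Completion) := by
  have h : Function.Exact N.subtype N.mkQ := by
    rw [LinearMap.exact_iff]; simp
  ext x
  exact lTensor_exact v.Completion h N.mkQ_surjective x

/-- The quotient lattice on `P / N`: the space `K_v ⊗ (P / N)` is identified with the orthogonal
complement in `V_v` of the kernel `K_v ⊗ N` of the projection. -/
def quotient [Module.Finite (𝓞 K) P] (Λ : OKLattice K P) (N : Submodule (𝓞 K) P) :
    OKLattice K (P ⧸ N) :=
  fun v =>
    letI := completionRCLike v
    coreComap (Λ v)
      (orthogonalLift (Λ v) (N.mkQ.baseChange v.Completion)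
        (LinearMap.lTensor_surjective _ N.mkQ_surjective))
      (orthogonalLift_injective _ _ _)

/-- The lattice `B / A` for submodules `A ⊆ B` of `P`. -/
def subquotient [Module.Finite (𝓞 K) P] (Λ : OKLattice K P) (A B : Submodule (𝓞 K) P) :
    OKLattice K (B ⧸ A.submoduleOf B) :=
  (Λ.restrict B).quotient (A.submoduleOf B)

/-- The inner product `⟨x, y⟩_∞` on `P ⊗_ℤ ℝ`, evaluated at elements of `P`. -/
def innerInfty (Λ : OKLattice K P) (x y : P) : ℝ :=
  ∑ v : InfinitePlace K, (Completion.extensionEmbedding v (Λ.innerAt v (1 ⊗ₜ x) (1 ⊗ₜ y))).re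

open Classical in
/-- The Lebesgue volume: the covolume of the `ℤ`-lattice `P` in `P ⊗_ℤ ℝ` with the inner product
`⟨ , ⟩_∞`, that is, the square root of the Gram determinant of a `ℤ`-basis of `P`. -/
def volLeb (Λ : OKLattice K P) : ℝ :=
  if h : Nonempty (Basis (Fin (finrank ℤ P)) ℤ P) then
    √(Matrix.of fun i j => Λ.innerInfty (h.some i) (h.some j)).det
  else 0

/-- The canonical volume. -/
def vol (Λ : OKLattice K P) : ℝ :=
  2 ^ (nrComplexPlaces K * finrank (𝓞 K) P) * Λ.volLeb

/-- The Arakelov degree. -/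
def deg (Λ : OKLattice K P) : ℝ :=
  -Real.log Λ.vol + (finrank (𝓞 K) P : ℝ) / 2 * Real.log |(discr K : ℝ)|

/-- Semi-stability: `Vol(Λ₁) ^ rk Λ ≥ Vol(Λ) ^ rk Λ₁` for every proper sublattice, a sublattice
being given by a submodule with projective quotient. -/
def IsSemistable (Λ : OKLattice K P) : Prop :=
  ∀ N : Submodule (𝓞 K) P, Module.Projective (𝓞 K) (P ⧸ N) → N ≠ ⊤ →
    Λ.vol ^ finrank (𝓞 K) N ≤ (Λ.restrict N).vol ^ finrank (𝓞 K) P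

/-- The canonical filtration `0 = Λ₀ ⊂ Λ₁ ⊂ ⋯ ⊂ Λ_n = Λ`. -/
structure IsCanonicalFiltration [Module.Finite (𝓞 K) P] (Λ : OKLattice K P) {n : ℕ}
    (F : Fin (n + 1) → Submodule (𝓞 K) P) : Prop where
  zero : F 0 = ⊥
  last : F (Fin.last n) = ⊤
  strictMono : StrictMono F
  projective : ∀ i, Module.Projective (𝓞 K) (P ⧸ F i)
  semistable : ∀ i : Fin n, (Λ.subquotient (F i.castSucc) (F i.succ)).IsSemistable
  vol_lt : ∀ i j : Fin n, (i : ℕ) + 1 = j →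
    (Λ.subquotient (F i.castSucc) (F i.succ)).vol ^
        finrank (𝓞 K) (F j.succ ⧸ (F j.castSucc).submoduleOf (F j.succ)) <
      (Λ.subquotient (F j.castSucc) (F j.succ)).vol ^
        finrank (𝓞 K) (F i.succ ⧸ (F i.castSucc).submoduleOf (F i.succ))

end OKLattice

end Lattice

/-! ### Polygons -/

/-- A polygon `p : [0, r] → ℝ`: a continuous function that is affine on each interval of a finite
subdivision of `[0, r]`. -/
def IsPolygon (r : ℕ) (p : ℝ → ℝ) : Prop :=
  ∃ (n : ℕ) (t : Fin (n + 1) → ℝ), StrictMono t ∧ t 0 = 0 ∧ t (Fin.last n) = r ∧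
    ∀ i : Fin n, ∃ a b : ℝ, ∀ s ∈ Set.Icc (t i.castSucc) (t i.succ), p s = a * s + b

/-- The function on `[x 0, x n]` with value `y i` at `x i`, affine on each `[x i, x (i + 1)]`. -/
def interpolate {n : ℕ} (x y : Fin (n + 1) → ℝ) (s : ℝ) : ℝ :=
  y 0 + ∑ i : Fin n, (y i.succ - y i.castSucc) / (x i.succ - x i.castSucc) *
    (min s (x i.succ) - min s (x i.castSucc))

theorem interpolate_castSucc_add {n : ℕ} (x y : Fin (n + 2) → ℝ) (s : ℝ) :
    interpolate x y s = interpolate (fun i : Fin (n + 1) => x i.castSucc)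
        (fun i : Fin (n + 1) => y i.castSucc) s +
      (y (Fin.last (n + 1)) - y (Fin.last n).castSucc) /
        (x (Fin.last (n + 1)) - x (Fin.last n).castSucc) *
      (min s (x (Fin.last (n + 1))) - min s (x (Fin.last n).castSucc)) := by
  rw [interpolate, Fin.sum_univ_castSucc, ← add_assoc]
  rfl

theorem interpolate_of_last_le {n : ℕ} {x : Fin (n + 1) → ℝ} (hx : StrictMono x)
    (y : Fin (n + 1) → ℝ) {s : ℝ} (hs : x (Fin.last n) ≤ s) :
    interpolate x y s = y (Fin.last n) := by
  induction n with
  | zero => simp [interpolate]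
  | succ n ih =>
    have hlt : x (Fin.last n).castSucc < x (Fin.last (n + 1)) := hx (Fin.castSucc_lt_last _)
    rw [interpolate_castSucc_add, ih (fun i j h => hx (Fin.castSucc_lt_castSucc_iff.2 h)) _
      (hlt.le.trans hs), min_eq_right hs, min_eq_right (hlt.le.trans hs),
      div_mul_cancel₀ _ (sub_pos.2 hlt).ne']
    ring

theorem interpolate_of_mem {n : ℕ} {x : Fin (n + 1) → ℝ} (hx : StrictMono x)
    (y : Fin (n + 1) → ℝ) (k : Fin n) {s : ℝ} (hs : s ∈ Set.Icc (x k.castSucc) (x k.succ)) :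
    interpolate x y s = y k.castSucc +
      (y k.succ - y k.castSucc) / (x k.succ - x k.castSucc) * (s - x k.castSucc) := by
  induction n with
  | zero => exact k.elim0
  | succ n ih =>
    have hx' : StrictMono fun i : Fin (n + 1) => x i.castSucc :=
      fun i j h => hx (Fin.castSucc_lt_castSucc_iff.2 h)
    have hlt : x (Fin.last n).castSucc < x (Fin.last (n + 1)) := hx (Fin.castSucc_lt_last _)
    rw [interpolate_castSucc_add]
    induction k using Fin.lastCases with
    | last =>
      rw [interpolate_of_last_le hx' _ hs.1, Fin.succ_last, min_eq_right hs.1,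
        min_eq_left (by rw [← Fin.succ_last]; exact hs.2)]
    | cast k =>
      have h1 : s ≤ x (Fin.last n).castSucc :=
        hs.2.trans (hx.monotone (by rw [Fin.succ_castSucc]; exact Fin.castSucc_le_castSucc_iff.2 (Fin.le_last _)))
      rw [ih hx' _ k hs, min_eq_left h1,
        min_eq_left (h1.trans hlt.le), Fin.succ_castSucc]
      ring

/-- The polygon of a filtration `0 = Λ₀ ⊂ ⋯ ⊂ Λ_n = Λ`: it is affine on each
`[rk Λ_i, rk Λ_{i+1}]`, with value `deg Λ_i - rk Λ_i * deg Λ / rk Λ` at `rk Λ_i`. -/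
def OKLattice.polygon {K : Type*} [Field K] [NumberField K] {P : Type*} [AddCommGroup P]
    [Module (𝓞 K) P] (Λ : OKLattice K P) {n : ℕ} (F : Fin (n + 1) → Submodule (𝓞 K) P) : ℝ → ℝ :=
  interpolate (fun i => (finrank (𝓞 K) (F i) : ℝ))
    (fun i => (Λ.restrict (F i)).deg - finrank (𝓞 K) (F i) * (Λ.deg / finrank (𝓞 K) P))

/-! ### Scaling classes of isometry classes -/

section Moduli

variable (K : Type*) [Field K] [NumberField K] (P : Type*) [AddCommGroup P] [Module (𝓞 K) P]

theorem OKLattice.ext {K : Type*} [Field K] [NumberField K] {P : Type*} [AddCommGroup P] [Module (𝓞 K) P]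
    {Λ Λ' : OKLattice K P} (h : ∀ v u w, Λ.innerAt v u w = Λ'.innerAt v u w) : Λ = Λ' :=
  funext fun v =>
    letI := completionRCLike v
    core_ext (h v)

@[simp] theorem OKLattice.innerAt_scale (Λ : OKLattice K P) (T : ℝ) (hT : 0 < T)
    (v : InfinitePlace K) (u w : LocalSpace K P v) :
    (Λ.scale T hT).innerAt v u w = realHom v (T ^ 2) * Λ.innerAt v u w := rfl

@[simp] theorem OKLattice.innerAt_act (A : P ≃ₗ[𝓞 K] P) (Λ : OKLattice K P)
    (v : InfinitePlace K) (u w : LocalSpace K P v) :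
    (Λ.act A).innerAt v u w =
      Λ.innerAt v (A.symm.toLinearMap.baseChange v.Completion u)
        (A.symm.toLinearMap.baseChange v.Completion w) := rfl

/-- Two lattices with underlying module `P` are identified if they are isometric up to scaling:
`Λ ~ (A · Λ)[T]` for `A ∈ GL(P)` and `T > 0`. -/
def latticeSetoid : Setoid (OKLattice K P) where
  r Λ Λ' := ∃ (A : P ≃ₗ[𝓞 K] P) (T : ℝ) (hT : 0 < T), Λ' = (Λ.act A).scale T hT
  iseqv := by
    refine ⟨fun Λ => ⟨LinearEquiv.refl _ _, 1, one_pos, ?_⟩, ?_, ?_⟩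
    · refine OKLattice.ext fun v u w => ?_
      simp
    · rintro Λ Λ' ⟨A, T, hT, rfl⟩
      refine ⟨A.symm, T⁻¹, inv_pos.2 hT, OKLattice.ext fun v u w => ?_⟩
      have h (x : LocalSpace K P v) : A.symm.toLinearMap.baseChange v.Completion
          (A.symm.symm.toLinearMap.baseChange v.Completion x) = x := by
        rw [← LinearMap.comp_apply, ← LinearMap.baseChange_comp]
        simp
      have h2 : realHom v (T⁻¹ ^ 2) * realHom v (T ^ 2) = 1 := by
        rw [← map_mul, ← mul_pow, inv_mul_cancel₀ hT.ne', one_pow, map_one]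
      rw [OKLattice.innerAt_scale, OKLattice.innerAt_act, OKLattice.innerAt_scale,
        OKLattice.innerAt_act, h, h, ← mul_assoc, h2, one_mul]
    · rintro Λ Λ' Λ'' ⟨A, T, hT, rfl⟩ ⟨B, S, hS, rfl⟩
      refine ⟨A.trans B, S * T, mul_pos hS hT, OKLattice.ext fun v u w => ?_⟩
      have h (x : LocalSpace K P v) : (A.trans B).symm.toLinearMap.baseChange v.Completion x =
          A.symm.toLinearMap.baseChange v.Completion
            (B.symm.toLinearMap.baseChange v.Completion x) := by
        rw [← LinearMap.comp_apply, ← LinearMap.baseChange_comp]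
        rfl
      rw [OKLattice.innerAt_scale, OKLattice.innerAt_act, OKLattice.innerAt_scale,
        OKLattice.innerAt_act, OKLattice.innerAt_scale, OKLattice.innerAt_act, h, h, mul_pow,
        map_mul, mul_assoc]

/-- The space of scaling classes of isometry classes of lattices with underlying module `P`, with
the quotient topology. -/
def LatticeSpace : Type _ := Quotient (latticeSetoid K P)

instance : TopologicalSpace (LatticeSpace K P) :=
  inferInstanceAs (TopologicalSpace (Quotient (latticeSetoid K P)))

variable {K P}

/-- The class of a lattice. -/
def OKLattice.toSpace (Λ : OKLattice K P) : LatticeSpace K P := Quotient.mk (latticeSetoid K P) Λ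

end Moduli

/-! ### Lattices from adelic matrices -/

section Adelic

variable {K : Type*} [Field K] [NumberField K] {r : ℕ}

/-- The component of an adele at an archimedean place. -/
def infiniteComponent (v : InfinitePlace K) : AdeleRing (𝓞 K) K →+* v.Completion where
  toFun a := a.1 v
  map_one' := rfl
  map_mul' _ _ := rfl
  map_zero' := rfl
  map_add' _ _ := rfl

/-- The component of an adele at a finite place. -/
def finiteComponent (v : HeightOneSpectrum (𝓞 K)) : AdeleRing (𝓞 K) K →+* v.adicCompletion K where
  toFun a := a.2 v
  map_one' := rfl
  map_mul' _ _ := rfl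
  map_zero' := rfl
  map_add' _ _ := rfl

/-- The module `E_g` of all `x ∈ K ^ r` with `x ∈ g_v (𝓞_v ^ r)` for all finite places `v`. -/
def adelicModule (g : GL (Fin r) (AdeleRing (𝓞 K) K)) : Submodule (𝓞 K) (Fin r → K) where
  carrier := {x | ∀ (v : HeightOneSpectrum (𝓞 K)) (i : Fin r),
    ((Matrix.GeneralLinearGroup.map (finiteComponent v) g⁻¹).val.mulVec
      fun j => algebraMap K (v.adicCompletion K) (x j)) i ∈ v.adicCompletionIntegers K}
  zero_mem' v i := by
    have : (fun j : Fin r => algebraMap K (v.adicCompletion K) ((0 : Fin r → K) j)) = 0 := by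
      ext; simp
    rw [this, Matrix.mulVec_zero]
    exact zero_mem _
  add_mem' {x y} hx hy v i := by
    have : (fun j : Fin r => algebraMap K (v.adicCompletion K) ((x + y) j)) =
        (fun j => algebraMap K (v.adicCompletion K) (x j)) +
          fun j => algebraMap K (v.adicCompletion K) (y j) := by
      ext; simp
    rw [this, Matrix.mulVec_add]
    exact add_mem (hx v i) (hy v i)
  smul_mem' a x hx v i := by
    have : (fun j : Fin r => algebraMap K (v.adicCompletion K) ((a • x) j)) =
        (algebraMap K (v.adicCompletion K) (algebraMap (𝓞 K) K a)) •
          fun j => algebraMap K (v.adicCompletion K) (x j) := by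
      ext; simp [Algebra.smul_def]
    rw [this, Matrix.mulVec_smul]
    exact mul_mem (HeightOneSpectrum.coe_algebraMap_mem _ _ v a) (hx v i)

/-- The `K_v`-linear extension `K_v ⊗ N → K_v ^ r` of the inclusion of a submodule `N ⊆ K ^ r`. -/
def localEmbedding (N : Submodule (𝓞 K) (Fin r → K)) (v : InfinitePlace K) :
    LocalSpace K N v →ₗ[v.Completion] (Fin r → v.Completion) :=
  LinearMap.liftBaseChange v.Completion
    (((Algebra.linearMap K v.Completion).restrictScalars (𝓞 K)).compLeft (Fin r) ∘ₗ N.subtype)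

theorem localEmbedding_tmul (N : Submodule (𝓞 K) (Fin r → K)) (v : InfinitePlace K)
    (a : v.Completion) (x : N) (i : Fin r) :
    localEmbedding N v (a ⊗ₜ x) i = a * algebraMap K v.Completion (x.1 i) := by
  simp [localEmbedding]

theorem localEmbedding_injective (N : Submodule (𝓞 K) (Fin r → K)) (v : InfinitePlace K) :
    Function.Injective (localEmbedding N v) := by
  set l : v.Completion ⊗[𝓞 K] (Fin r → K) →ₗ[v.Completion] (Fin r → v.Completion) :=
    LinearMap.liftBaseChange v.Completion
      (((Algebra.linearMap K v.Completion).restrictScalars (𝓞 K)).compLeft (Fin r)) with hl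
  have hl_tmul (a : v.Completion) (x : Fin r → K) (i : Fin r) :
      l (a ⊗ₜ x) i = a * algebraMap K v.Completion (x i) := by simp [hl]
  have hcomp (x : LocalSpace K N v) :
      localEmbedding N v x = l (LinearMap.lTensor v.Completion N.subtype x) := by
    induction x using TensorProduct.induction_on with
    | zero => simp
    | tmul a x => ext i; rw [localEmbedding_tmul, LinearMap.lTensor_tmul, hl_tmul]; rfl
    | add x y hx hy => rw [map_add, map_add, map_add, hx, hy]
  have hcs : CompatibleSMul (𝓞 K) K v.Completion (Fin r → K) :=
    IsLocalization.tensorProduct_compatibleSMul (nonZeroDivisors (𝓞 K)) K v.Completion _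
  have hsum (x : v.Completion ⊗[𝓞 K] (Fin r → K)) :
      ∑ i, (l x i) ⊗ₜ[𝓞 K] (Pi.single i (1 : K) : Fin r → K) = x := by
    induction x with
    | zero => simp
    | tmul a x =>
      have h (i : Fin r) : (a * algebraMap K v.Completion (x i)) ⊗ₜ[𝓞 K]
          (Pi.single i (1 : K) : Fin r → K) = a ⊗ₜ (x i • Pi.single i (1 : K)) := by
        rw [← TensorProduct.smul_tmul, Algebra.smul_def, mul_comm]
      simp_rw [hl_tmul, h, ← TensorProduct.tmul_sum]
      congr 1
      exact (pi_eq_sum_univ' x).symm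
    | add x y hx hy =>
      simp only [map_add, Pi.add_apply, TensorProduct.add_tmul, Finset.sum_add_distrib, hx, hy]
  have hinj : Function.Injective l := fun x y hxy => by rw [← hsum x, ← hsum y, hxy]
  intro x y hxy
  rw [hcomp, hcomp] at hxy
  exact Module.Flat.lTensor_preserves_injective_linearMap N.subtype N.injective_subtype (hinj hxy)

/-- The standard inner product on `𝕜 ^ r`. -/
@[reducible] def stdCore (𝕜 : Type*) [RCLike 𝕜] (r : ℕ) : InnerProductSpace.Core 𝕜 (Fin r → 𝕜) where
  inner u w := ∑ i, (starRingEnd 𝕜) (u i) * w i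
  conj_inner_symm u w := by simp [mul_comm]
  re_inner_nonneg u := by
    rw [map_sum]
    exact Finset.sum_nonneg fun i _ => by rw [RCLike.conj_mul]; norm_cast; positivity
  add_left u w z := by simp [add_mul, Finset.sum_add_distrib]
  smul_left u w a := by simp [Finset.mul_sum, mul_assoc]
  definite u hu := by
    have h : ∑ i, ‖u i‖ ^ 2 = 0 := by
      have h' : ((∑ i, ‖u i‖ ^ 2 : ℝ) : 𝕜) = 0 := by
        rw [← hu]
        push_cast
        exact Finset.sum_congr rfl fun i _ => (RCLike.conj_mul (u i)).symm
      exact_mod_cast h'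
    ext i
    have := (Finset.sum_eq_zero_iff_of_nonneg fun i _ => sq_nonneg ‖u i‖).1 h i (Finset.mem_univ i)
    simpa using this

/-- The lattice `(E_g, ρ_g)`: at each archimedean place the inner product on `K_v ^ r` is the one
for which `g_v` is an isometry from the standard inner product. -/
def adelicLattice (g : GL (Fin r) (AdeleRing (𝓞 K) K)) : OKLattice K (adelicModule g) :=
  fun v =>
    letI := completionRCLike v
    coreComap (stdCore v.Completion r)
      ((Matrix.GeneralLinearGroup.map (infiniteComponent v) g⁻¹).val.mulVecLin ∘ₗ
        localEmbedding (adelicModule g) v)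
      ((Function.LeftInverse.injective
        (g := (Matrix.GeneralLinearGroup.map (infiniteComponent v) g).val.mulVecLin)
          (f := (Matrix.GeneralLinearGroup.map (infiniteComponent v) g⁻¹).val.mulVecLin) fun x => by
          rw [Matrix.mulVecLin_apply, Matrix.mulVecLin_apply, Matrix.mulVec_mulVec, map_inv,
            ← Units.val_mul, mul_inv_cancel, Units.val_one, Matrix.one_mulVec]).comp
        (localEmbedding_injective _ v))

/-- The degree `deg g = deg (E_g, ρ_g)`. -/
def adelicDeg (g : GL (Fin r) (AdeleRing (𝓞 K) K)) : ℝ := (adelicLattice g).deg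

variable (K r) in
/-- A flag `0 = V₀ ⊂ V₁ ⊂ ⋯ ⊂ V_n = K ^ r` of subspaces. -/
structure SubspaceFlag where
  length : ℕ
  space : Fin (length + 1) → Submodule K (Fin r → K)
  zero : space 0 = ⊥
  last : space (Fin.last length) = ⊤
  strictMono : StrictMono space

/-- The parabolic subgroup of `GL_r(K)` stabilizing a flag. -/
def SubspaceFlag.parabolic (V : SubspaceFlag K r) : Subgroup (GL (Fin r) K) where
  carrier := {γ | ∀ i x, γ.val.mulVec x ∈ V.space i ↔ x ∈ V.space i}
  one_mem' i x := by simp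
  mul_mem' {γ δ} hγ hδ i x := by
    rw [Units.val_mul, ← Matrix.mulVec_mulVec, hγ i, hδ i]
  inv_mem' {γ} hγ i x := by
    rw [← hγ i, Matrix.mulVec_mulVec, ← Units.val_mul, mul_inv_cancel, Units.val_one,
      Matrix.one_mulVec]

/-- The filtration of `E_g` by the submodules `E_g ∩ V_i`. -/
def SubspaceFlag.filtration (V : SubspaceFlag K r) (g : GL (Fin r) (AdeleRing (𝓞 K) K))
    (i : Fin (V.length + 1)) : Submodule (𝓞 K) (adelicModule g) :=
  ((V.space i).restrictScalars (𝓞 K)).submoduleOf (adelicModule g)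

/-- The polygon `p_Q^g`, where `Q` is the parabolic subgroup stabilizing the flag `V`. -/
def flagPolygon (V : SubspaceFlag K r) (g : GL (Fin r) (AdeleRing (𝓞 K) K)) : ℝ → ℝ :=
  (adelicLattice g).polygon (V.filtration g)

/-- The maximum of the polygons `p_Q^g` over all parabolic subgroups `Q` contained in `P`. -/
def maxPolygon (P : Subgroup (GL (Fin r) K)) (g : GL (Fin r) (AdeleRing (𝓞 K) K)) (s : ℝ) : ℝ :=
  ⨆ V : {V : SubspaceFlag K r // V.parabolic ≤ P}, flagPolygon V.1 g s

variable (K) in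
/-- The standard flag with jumps `d₁, …, d_n` for a composition `I = (d₁, …, d_n)` of `r`: its
members are spanned by the first `d₁ + ⋯ + d_j` standard basis vectors. -/
def standardFlag (I : Composition r) : SubspaceFlag K r where
  length := I.length
  space j :=
    { carrier := {x | ∀ i : Fin r, I.sizeUpTo j ≤ i → x i = 0}
      zero_mem' := fun _ _ => rfl
      add_mem' := fun hx hy i hi => by simp [hx i hi, hy i hi]
      smul_mem' := fun a x hx i hi => by simp [hx i hi] }
  zero := by
    ext x
    simp [funext_iff]
  last := by
    ext x
    simp
  strictMono := by
    refine Fin.strictMono_iff_lt_succ.2 fun j => ?_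
    have hlt : I.sizeUpTo j < I.sizeUpTo (j + 1) := I.sizeUpTo_strict_mono j.2
    refine lt_of_le_of_ne (fun x hx i hi => hx i (hlt.le.trans hi)) fun heq => ?_
    have hr : I.sizeUpTo j < r := hlt.trans_le (I.sizeUpTo_le _)
    have hmem : Pi.single (⟨I.sizeUpTo j, hr⟩ : Fin r) (1 : K) ∈
        {x : Fin r → K | ∀ i : Fin r, I.sizeUpTo (j + 1) ≤ i → x i = 0} := by
      intro i hi
      refine Pi.single_eq_of_ne (fun h => ?_) _
      rw [h] at hi
      exact absurd hi (by simpa using hlt)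
    have h2 := (SetLike.ext_iff.1 heq (Pi.single (⟨I.sizeUpTo j, hr⟩ : Fin r) (1 : K))).2 hmem
      ⟨I.sizeUpTo j, hr⟩ le_rfl
    simp at h2

/-- The stabilizer of the standard flag is the group of block upper triangular matrices. -/
theorem mem_parabolic_standardFlag (I : Composition r) (γ : GL (Fin r) K) :
    γ ∈ (standardFlag K I).parabolic ↔ Matrix.BlockTriangular γ.val I.index := by
  constructor
  · intro h i j hij
    have h1 := (h (I.index j).succ (Pi.single j 1)).2 fun i' hi' => by
      refine Pi.single_eq_of_ne (fun he => ?_) _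
      subst he
      exact absurd (I.lt_sizeUpTo_index_succ i') (not_lt.2 hi')
    have h2 := h1 i (le_trans (I.monotone_sizeUpTo (by simpa using hij)) (I.sizeUpTo_index_le i))
    simpa using h2
  · have key (M : Matrix (Fin r) (Fin r) K) (hM : M.BlockTriangular I.index)
        (k : Fin (I.length + 1)) (x : Fin r → K) (hx : x ∈ (standardFlag K I).space k) :
        M.mulVec x ∈ (standardFlag K I).space k := by
      intro i hi
      rw [Matrix.mulVec_eq_sum, Finset.sum_apply]
      refine Finset.sum_eq_zero fun j _ => ?_
      rw [Pi.smul_apply, op_smul_eq_smul, smul_eq_mul, Matrix.transpose_apply]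
      by_cases hj : I.sizeUpTo k ≤ j
      · rw [hx j hj, zero_mul]
      · rw [hM, mul_zero]
        by_contra hle
        have hjk : (I.index j : ℕ) < k := by
          by_contra hk
          exact hj ((I.monotone_sizeUpTo (not_lt.1 hk)).trans (I.sizeUpTo_index_le j))
        have hik : (I.index i : ℕ) + 1 ≤ k :=
          Nat.succ_le_of_lt (lt_of_le_of_lt (Fin.le_def.1 (not_lt.1 hle)) hjk)
        exact absurd (I.lt_sizeUpTo_index_succ i)
          (not_lt.2 ((I.monotone_sizeUpTo hik).trans hi))
    intro h k x
    refine ⟨fun hx => ?_, key _ h k x⟩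
    have : Invertible γ.val := γ.invertible
    have := key _ (Matrix.blockTriangular_inv_of_blockTriangular h) k _ hx
    rwa [Matrix.mulVec_mulVec, Matrix.inv_mul_of_invertible, Matrix.one_mulVec] at this

/-- The quotient `H \ GL_r(𝔸)` for a subgroup `H` of `GL_r(K)`. -/
def AdelicQuotient (H : Subgroup (GL (Fin r) K)) : Type _ :=
  Quotient (QuotientGroup.rightRel
    (H.map (Matrix.GeneralLinearGroup.map (algebraMap K (AdeleRing (𝓞 K) K)))))

instance (H : Subgroup (GL (Fin r) K)) : TopologicalSpace (AdelicQuotient H) :=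
  inferInstanceAs (TopologicalSpace (Quotient _))

/-- The class of `g` in `H \ GL_r(𝔸)`. -/
def AdelicQuotient.mk (H : Subgroup (GL (Fin r) K)) (g : GL (Fin r) (AdeleRing (𝓞 K) K)) :
    AdelicQuotient H :=
  Quotient.mk _ g

end Adelic

end ArakelovLattice
end

open ArakelovLattice

noncomputable section
namespace ArakelovLattice

/-! ### Gram determinants -/

section Gram

variable {E : Type*} [NormedAddCommGroup E] [InnerProductSpace ℝ E]
variable {ι κ : Type*} [Fintype ι] [DecidableEq ι] [Fintype κ] [DecidableEq κ]

/-! The theorem is reduction theory in the manner of Minkowski, with polygons supplying the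
inequalities. Covolumes are square roots of Gram determinants of `ℤ`-bases inside the Euclidean
space `Ambient` of a lattice, and degrees are, up to a multiple of the rank, minus their logarithms.
An upper bound for a polygon thus bounds the covolumes of sublattices from below.

Part 1 first replaces the canonical polygon by a condition visibly closed in the lattice. The
parallelogram inequality `covol_sup_mul_covol_inf_le` makes the degree supermodular. Adjoining
repeatedly the largest sublattice of maximal slope gives a canonical filtration
(`exists_isCanonicalFiltration`), and supermodularity together with semi-stability puts every
sublattice below all lines that extend the segments of its degree polygon (`degAt_le_tangent`).
Hence the canonical polygon lies below `p` exactly when the polygons of all saturated filtrations do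
(`exists_canonical_polygon_le_iff`), and each of these depends continuously on the lattice.

Compactness rests on `exists_short_vector`: if `W ⊂ V` are sublattices, `W` carries a full family of
short independent vectors and `covol V / covol W` is bounded, then Minkowski's theorem in the
orthogonal complement of `W`, followed by rounding the component along `W`, gives a short vector of
`V` outside `W`. Iteration (`exists_adapted_family`) yields `r` short independent vectors once the
degrees of intermediate sublattices are controlled. Fixing the degree bounds the index of their
span. Up to `GL(P)` there are only finitely many independent families of bounded index
(`exists_finite_representatives`), so after scaling and an isometry the lattice has short vectors at
a family from a fixed finite list. For one fixed family, these lattices form a compact set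
(`isCompact_setOf_norm_le`): bounded lengths bound the forms from above, while fixed degree keeps
them away from degenerate ones.

In part 3 the same construction is carried out along the standard flag. A subspace `W` lying between
two consecutive members, and different from the upper one `V'`, occurs in a flag refining the
standard one, so `p` bounds its degree from above; the lower bound `-p` for the polygon of the
standard flag bounds the degree of `V'` from below. This is the estimate that the iteration needs
(`sub_le_of_mem_boundedSet`). The resulting basis is adapted to the flag, so moving it to the
standard basis is effected by an element of `P(K)`. A matrix `h` of given degree for which the
standard basis vectors lie in `E_h` and are short belongs to a fixed compact set: integrality and
shortness control the entries of `h⁻¹`, while the fixed covolume controls those of `h`, at finite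
places through the index of the standard lattice and at infinite places through the coordinates of
the columns (`exists_isCompact_of_norm_single_le`). Degrees are continuous since `E_g` is locally
constant in `g`, so the bounded set is closed.

Part 2 is the case of the composition with one block. The polygon of the trivial flag is zero, so
the condition `≤ p` already forces `p ≥ 0` and makes the lower bound automatic. -/

theorem gram_sum_smul (M : Matrix κ ι ℝ) (b : ι → E) :
    Matrix.gram ℝ (fun k => ∑ i, M k i • b i) = M * Matrix.gram ℝ b * M.transpose := by
  ext k l
  simp only [Matrix.gram_apply, Matrix.mul_apply, Matrix.transpose_apply, sum_inner, inner_sum,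
    inner_smul_left, inner_smul_right, Finset.sum_mul]
  rw [Finset.sum_congr rfl fun i _ => Finset.mul_sum _ _ _, Finset.sum_comm]
  rw [Finset.sum_comm]
  refine Finset.sum_congr rfl fun i _ => Finset.sum_congr rfl fun j _ => ?_
  rw [real_inner_comm]
  simp; ring

theorem det_gram_sum_smul (M : Matrix ι ι ℝ) (b : ι → E) :
    (Matrix.gram ℝ (fun k => ∑ i, M k i • b i)).det = M.det ^ 2 * (Matrix.gram ℝ b).det := by
  rw [gram_sum_smul, Matrix.det_mul, Matrix.det_mul, Matrix.det_transpose]; ring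

theorem det_gram_pos {b : ι → E} (hb : LinearIndependent ℝ b) : 0 < (Matrix.gram ℝ b).det :=
  (Matrix.posDef_gram_of_linearIndependent hb).det_pos

theorem det_gram_nonneg (b : ι → E) : 0 ≤ (Matrix.gram ℝ b).det :=
  (Matrix.posSemidef_gram ℝ b).det_nonneg

theorem det_gram_sumElim_of_orthogonal (a : ι → E) (y : κ → E)
    (h : ∀ i k, inner ℝ (a i) (y k) = 0) :
    (Matrix.gram ℝ (Sum.elim a y)).det = (Matrix.gram ℝ a).det * (Matrix.gram ℝ y).det := by
  have : Matrix.gram ℝ (Sum.elim a y) =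
      Matrix.fromBlocks (Matrix.gram ℝ a) 0 0 (Matrix.gram ℝ y) := by
    ext (i | i) (j | j)
    · simp [Matrix.gram_apply]
    · simp [Matrix.gram_apply, h]
    · simp [Matrix.gram_apply, real_inner_comm, h]
    · simp [Matrix.gram_apply]
  rw [this, Matrix.det_fromBlocks_zero₁₂]

/-- The two families differ by a unipotent block triangular matrix, which has determinant one. -/
theorem det_gram_sumElim_of_sub_mem_span (a : ι → E) (x y : κ → E)
    (h : ∀ k, x k - y k ∈ Submodule.span ℝ (Set.range a)) :
    (Matrix.gram ℝ (Sum.elim a x)).det = (Matrix.gram ℝ (Sum.elim a y)).det := by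
  have h' : ∀ k, ∃ c : ι → ℝ, ∑ i, c i • a i = x k - y k := fun k =>
    (Submodule.mem_span_range_iff_exists_fun ℝ).1 (h k)
  choose c hc using h'
  have key := det_gram_sum_smul (Matrix.fromBlocks 1 0 (Matrix.of c) 1) (Sum.elim a y)
  rw [Matrix.det_fromBlocks_zero₁₂] at key
  have he : (fun k => ∑ i, (Matrix.fromBlocks (1 : Matrix ι ι ℝ) 0 (Matrix.of c)
      (1 : Matrix κ κ ℝ)) k i • (Sum.elim a y) i) = Sum.elim a x := by
    funext k
    rcases k with k | k
    · simp [Matrix.one_apply]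
    · simp [Matrix.one_apply, hc]
  rw [he] at key
  simpa using key

/-! ### Monotonicity and bounds for determinants of Gram matrices -/

theorem one_le_det_one_add {P : Matrix ι ι ℝ} (hP : P.PosSemidef) : 1 ≤ (1 + P).det := by
  have hH : (1 + P).IsHermitian := Matrix.isHermitian_one.add hP.1
  rw [hH.det_eq_prod_eigenvalues]
  have h (i : ι) : 1 ≤ hH.eigenvalues i := by
    rw [hH.eigenvalues_eq, Matrix.add_mulVec, Matrix.one_mulVec, dotProduct_add]
    have h1 : star (hH.eigenvectorBasis i).ofLp ⬝ᵥ (hH.eigenvectorBasis i).ofLp = 1 := by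
      have := hH.eigenvectorBasis.orthonormal.1 i
      rw [dotProduct_comm]
      have h2 := EuclideanSpace.inner_eq_star_dotProduct (hH.eigenvectorBasis i)
        (hH.eigenvectorBasis i)
      rw [← h2, real_inner_self_eq_norm_sq, this, one_pow]
    have h2 := hP.dotProduct_mulVec_nonneg (hH.eigenvectorBasis i).ofLp
    rw [h1]
    simpa using h2
  calc (1 : ℝ) = ∏ _i : ι, 1 := by simp
    _ ≤ ∏ i, hH.eigenvalues i := Finset.prod_le_prod (fun _ _ => zero_le_one) fun i _ => h i

-- For invertible `A`, writing `A = Cᴴ C` turns `A + B` into `Cᴴ (1 + P) C` with `P` positive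
-- semidefinite, and all eigenvalues of `1 + P` are at least one.
open scoped MatrixOrder Matrix in
theorem det_le_det_add {A B : Matrix ι ι ℝ} (hA : A.PosSemidef) (hB : B.PosSemidef) :
    A.det ≤ (A + B).det := by
  rcases hA.det_nonneg.eq_or_lt with h0 | h0
  · rw [← h0]; exact (hA.add hB).det_nonneg
  obtain ⟨C, rfl⟩ := CStarAlgebra.nonneg_iff_eq_star_mul_self.mp hA.nonneg
  rw [Matrix.star_eq_conjTranspose] at *
  have hC : IsUnit C.det := by
    rw [Matrix.det_mul] at h0
    exact (right_ne_zero_of_mul h0.ne').isUnit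
  have h1 : Cᴴ * C + B = Cᴴ * (1 + C⁻¹ᴴ * B * C⁻¹) * C := by
    have h2 : Cᴴ * C⁻¹ᴴ = 1 := by
      rw [← Matrix.conjTranspose_mul, Matrix.nonsing_inv_mul _ hC, Matrix.conjTranspose_one]
    calc Cᴴ * C + B = Cᴴ * C + (Cᴴ * C⁻¹ᴴ) * B * (C⁻¹ * C) := by
          rw [h2, Matrix.nonsing_inv_mul _ hC, one_mul, mul_one]
      _ = _ := by noncomm_ring
  have h3 : (C⁻¹ᴴ * B * C⁻¹).PosSemidef := hB.conjTranspose_mul_mul_same _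
  rw [h1, Matrix.det_mul (_ * _) C, Matrix.det_mul Cᴴ (1 + _), mul_right_comm, ← Matrix.det_mul]
  exact le_mul_of_one_le_right h0.le (one_le_det_one_add h3)

/-- Orthogonal projection does not increase Gram determinants: orthogonality makes the Gram matrix
of `x` the sum of those of `y` and `z`. -/
theorem det_gram_le_of_eq_add (x y z : ι → E) (hx : ∀ i, x i = y i + z i)
    (h : ∀ i j, inner ℝ (y i) (z j) = 0) :
    (Matrix.gram ℝ y).det ≤ (Matrix.gram ℝ x).det := by
  have : Matrix.gram ℝ x = Matrix.gram ℝ y + Matrix.gram ℝ z := by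
    ext i j
    have h2 : inner ℝ (z i) (y j) = 0 := by rw [real_inner_comm]; exact h j i
    simp [Matrix.gram_apply, hx, inner_add_left, inner_add_right, h, h2]
  rw [this]
  exact det_le_det_add (Matrix.posSemidef_gram ℝ y) (Matrix.posSemidef_gram ℝ z)

theorem det_gram_le_of_norm_le {b : ι → E} {B : ℝ} (hb : ∀ i, ‖b i‖ ≤ B) :
    (Matrix.gram ℝ b).det ≤ (Fintype.card ι).factorial * (B ^ 2) ^ Fintype.card ι := by
  have h := Matrix.det_le (A := Matrix.gram ℝ b) (abv := AbsoluteValue.abs) (x := B ^ 2)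
    fun i j => by
      have hB : 0 ≤ B := (norm_nonneg _).trans (hb i)
      refine (abs_real_inner_le_norm _ _).trans ?_
      rw [sq]
      exact mul_le_mul (hb i) (hb j) (norm_nonneg _) hB
  simp only [nsmul_eq_mul] at h
  exact (le_abs_self _).trans h

variable (ι) in
/-- A vector in the span of a bounded family of large Gram determinant has coordinates bounded
by its norm. -/
theorem exists_abs_coeff_le (B δ : ℝ) (hδ : 0 < δ) : ∃ C : ℝ, 0 < C ∧
    ∀ {E : Type*} [NormedAddCommGroup E] [InnerProductSpace ℝ E] (b : ι → E),
      (∀ i, ‖b i‖ ≤ B) → δ ≤ (Matrix.gram ℝ b).det →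
        ∀ (t : ι → ℝ) (i : ι), |t i| ≤ C * ‖∑ j, t j • b j‖ := by
  set n := Fintype.card ι
  set D : ℝ := n.factorial * (max 1 (B ^ 2)) ^ n with hD
  have hD0 : 0 < D := by positivity
  -- The constant comes from Cramer's rule, `D` bounding the entries of the adjugate; the summand
  -- `1` only makes it positive. It is chosen before the space `E`, so it serves all lattices at
  -- once.
  refine ⟨δ⁻¹ * (n * (D * max 1 B)) + 1, by positivity, fun {E} _ _ b hb hdet t i => ?_⟩
  set u := ∑ j, t j • b j with hu
  set G := Matrix.gram ℝ b with hG
  have hGt : G.mulVec t = fun j => inner ℝ (b j) u := by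
    funext j
    simp [hG, Matrix.mulVec, dotProduct, Matrix.gram_apply, hu, inner_sum, inner_smul_right,
      mul_comm]
  have h1 : G.det * t i = ∑ j, G.adjugate i j * inner ℝ (b j) u := by
    have h2 : G.adjugate.mulVec (G.mulVec t) = G.det • t := by
      rw [Matrix.mulVec_mulVec, Matrix.adjugate_mul, Matrix.smul_mulVec, Matrix.one_mulVec]
    rw [hGt] at h2
    have := congrFun h2 i
    simp only [Pi.smul_apply, smul_eq_mul] at this
    rw [← this]; rfl
  have hadj (j : ι) : |G.adjugate i j| ≤ D := by
    rw [Matrix.adjugate_apply]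
    have h := Matrix.det_le (A := G.updateRow j (Pi.single i 1)) (abv := AbsoluteValue.abs)
      (x := max 1 (B ^ 2)) fun k l => by
        -- An entry of the adjugate is the determinant of the Gram matrix with one row replaced by a
        -- unit vector, hence the maximum with `1`.
        by_cases hk : k = j
        · subst hk
          rw [Matrix.updateRow_self]
          refine le_max_of_le_left ?_
          by_cases hl : l = i
          · subst hl; simp
          · simp [hl]
        · rw [Matrix.updateRow_ne hk]
          refine le_max_of_le_right ((abs_real_inner_le_norm _ _).trans ?_)
          rw [sq]
          exact mul_le_mul (hb k) (hb l) (norm_nonneg _) ((norm_nonneg _).trans (hb k))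
    simpa [nsmul_eq_mul] using h
  have h3 : G.det * |t i| ≤ n * (D * (max 1 B * ‖u‖)) := by
    rw [← abs_of_pos (hδ.trans_le hdet), ← abs_mul, h1]
    refine (Finset.abs_sum_le_sum_abs _ _).trans ?_
    refine (Finset.sum_le_card_nsmul _ _ (D * (max 1 B * ‖u‖)) fun j _ => ?_).trans ?_
    · rw [abs_mul]
      refine mul_le_mul (hadj j) ((abs_real_inner_le_norm _ _).trans ?_) (abs_nonneg _) hD0.le
      exact mul_le_mul_of_nonneg_right ((hb j).trans (le_max_right _ _)) (norm_nonneg _)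
    · simp [n]
  have h4 : |t i| ≤ δ⁻¹ * (n * (D * (max 1 B * ‖u‖))) := by
    rw [le_inv_mul_iff₀ hδ]
    exact (mul_le_mul_of_nonneg_right hdet (abs_nonneg _)).trans h3
  refine h4.trans ?_
  have : 0 ≤ ‖u‖ := norm_nonneg _
  nlinarith

open MeasureTheory in
/-- Minkowski's first theorem in terms of Gram determinants. -/
theorem exists_int_norm_sq_le {y : ι → E} (hy : LinearIndependent ℝ y) {A : ℝ} (hA : 0 < A)
    (h : (Matrix.gram ℝ y).det < A ^ Fintype.card ι) :
    ∃ z : ι → ℤ, z ≠ 0 ∧ ‖∑ i, (z i : ℝ) • y i‖ ^ 2 ≤ Fintype.card ι * A := by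
  set F := Submodule.span ℝ (Set.range y)
  have : FiniteDimensional ℝ F := .span_of_finite ℝ (Set.finite_range y)
  have hcard : finrank ℝ F = Fintype.card ι := finrank_span_eq_card hy
  let e : OrthonormalBasis ι ℝ F := (stdOrthonormalBasis ℝ F).reindex
    (Fintype.equivOfCardEq (by simp [hcard]))
  let y' : ι → F := fun i => ⟨y i, Submodule.subset_span ⟨i, rfl⟩⟩
  let M : Matrix ι ι ℝ := Matrix.of fun i j => e.repr (y' j) i
  have hM : (Matrix.gram ℝ y).det = M.det ^ 2 := by
    have : Matrix.gram ℝ y = Matrix.gram ℝ y' := rfl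
    rw [this, Matrix.gram_eq_conjTranspose_mul e, Matrix.det_mul, Matrix.det_conjTranspose, sq]
    rfl
  have hM0 : M.det ≠ 0 := fun h0 => by
    have := det_gram_pos hy
    rw [hM, h0] at this; simp at this
  -- In orthonormal coordinates the lattice spanned by `y` is the image of `ℤ ^ n` under `M`, and
  -- `M.det ^ 2` is the Gram determinant.
  have hnorm (t : ι → ℝ) : ‖∑ i, t i • y i‖ ^ 2 = ∑ i, (M.mulVec t i) ^ 2 := by
    have h1 : ∑ i, t i • y i = ((∑ i, t i • y' i : F) : E) := by simp [y']
    rw [h1, ← Submodule.coe_norm, ← e.sum_sq_norm_inner_right]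
    refine Finset.sum_congr rfl fun i _ => ?_
    rw [inner_sum, Real.norm_eq_abs, sq_abs]
    congr 1
    refine Finset.sum_congr rfl fun j _ => ?_
    rw [inner_smul_right, mul_comm]
    simp [M, e.repr_apply_apply]
  set a := √A
  have ha : 0 < a := Real.sqrt_pos.2 hA
  set f := Matrix.toLin' M
  have hdet : LinearMap.det f ≠ 0 := by rwa [LinearMap.det_toLin']
  have : Countable (Submodule.span ℤ (Set.range (Pi.basisFun ℝ ι))).toAddSubgroup :=
    inferInstanceAs (Countable (Submodule.span ℤ (Set.range (Pi.basisFun ℝ ι))))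
  -- The convex body is the preimage under `M` of the sup-norm ball of radius `√A`, of volume `(2
  -- √A) ^ n / |det M|`; the hypothesis says exactly that this exceeds `2 ^ n`.
  obtain ⟨⟨x, hx⟩, hx0, hxs⟩ := exists_ne_zero_mem_lattice_of_measure_mul_two_pow_lt_measure
    (μ := (volume : Measure (ι → ℝ)))
    (L := (Submodule.span ℤ (Set.range (Pi.basisFun ℝ ι))).toAddSubgroup)
    (ZSpan.isAddFundamentalDomain (Pi.basisFun ℝ ι) volume) (s := f ⁻¹' Metric.ball 0 a)
    (fun x hx => by simpa using hx)
    ((convex_ball 0 a).linear_preimage f) (by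
      have hb : (Matrix.of (Pi.basisFun ℝ ι)).det = 1 := by
        convert Matrix.det_one (n := ι) (R := ℝ)
        ext i j
        simp [Matrix.one_apply, Pi.single_apply, eq_comm]
      rw [Measure.addHaar_preimage_linearMap _ hdet, Real.volume_pi_ball _ ha,
        ZSpan.volume_fundamentalDomain, hb, abs_one, ENNReal.ofReal_one, one_mul,
        Module.finrank_fintype_fun_eq_card, ← ENNReal.ofReal_mul (abs_nonneg _)]
      have h2 : (2 : ENNReal) ^ Fintype.card ι = ENNReal.ofReal (2 ^ Fintype.card ι) := by
        rw [ENNReal.ofReal_pow (by norm_num)]; simp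
      rw [h2, ENNReal.ofReal_lt_ofReal_iff_of_nonneg (by positivity), LinearMap.det_toLin',
        abs_inv, mul_pow, lt_inv_mul_iff₀ (abs_pos.2 hM0), mul_comm]
      refine mul_lt_mul_of_pos_left ?_ (by positivity)
      refine lt_of_pow_lt_pow_left₀ 2 (by positivity) ?_
      rw [sq_abs, ← hM, ← pow_mul, mul_comm _ 2, pow_mul, Real.sq_sqrt hA.le]
      exact h)
  have hx' := (Submodule.mem_span_range_iff_exists_fun ℤ).1 hx
  obtain ⟨z, hz⟩ := hx'
  have hxz : x = fun i => (z i : ℝ) := by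
    rw [← hz]; ext i
    simp [Finset.sum_apply, Pi.single_apply]
  refine ⟨z, fun h0 => hx0 (Subtype.ext ?_), ?_⟩
  · simp [hxz, h0]; rfl
  · rw [hnorm (fun i => (z i : ℝ)), ← hxz]
    refine (Finset.sum_le_card_nsmul _ _ A fun i _ => ?_).trans (by simp)
    have h1 : ‖f x‖ < a := by simpa using hxs
    have h2 : |M.mulVec x i| ≤ a := ((norm_le_pi_norm (f x) i).trans h1.le)
    calc M.mulVec x i ^ 2 = |M.mulVec x i| ^ 2 := (sq_abs _).symm
      _ ≤ a ^ 2 := by gcongr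
      _ = A := Real.sq_sqrt hA.le

end Gram
end ArakelovLattice
end

noncomputable section
namespace ArakelovLattice

/-! ### The real structure of `∏ v, K_v` -/

section RealCoefficients

variable {K : Type*} [Field K] [NumberField K]

theorem extensionEmbedding_algebraMap (v : InfinitePlace K) (x : K) :
    Completion.extensionEmbedding v (algebraMap K v.Completion x) = v.embedding x :=
  Completion.extensionEmbedding_coe v _

theorem extensionEmbedding_sum_realHom (v : InfinitePlace K)
    (t : Free.ChooseBasisIndex ℤ (𝓞 K) → ℝ) :
    Completion.extensionEmbedding v
        (∑ i, realHom v (t i) * algebraMap (𝓞 K) v.Completion (RingOfIntegers.basis K i)) =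
      ∑ i, (t i : ℂ) * v.embedding (RingOfIntegers.basis K i) := by
  rw [map_sum]
  refine Finset.sum_congr rfl fun i _ => ?_
  rw [map_mul, extensionEmbedding_realHom]
  exact congrArg _ (extensionEmbedding_algebraMap v _)

theorem sum_latticeBasis_fst (t : Free.ChooseBasisIndex ℤ (𝓞 K) → ℝ)
    (w : {w : InfinitePlace K // w.IsReal}) :
    (((∑ i, t i • mixedEmbedding.latticeBasis K i).1 w : ℝ) : ℂ) =
      ∑ i, (t i : ℂ) * w.1.embedding (RingOfIntegers.basis K i) := by
  simp [Prod.fst_sum, Finset.sum_apply, integralBasis_apply]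

theorem sum_latticeBasis_snd (t : Free.ChooseBasisIndex ℤ (𝓞 K) → ℝ)
    (w : {w : InfinitePlace K // w.IsComplex}) :
    (∑ i, t i • mixedEmbedding.latticeBasis K i).2 w =
      ∑ i, (t i : ℂ) * w.1.embedding (RingOfIntegers.basis K i) := by
  simp [Prod.snd_sum, Finset.sum_apply, integralBasis_apply]

/-- An integral basis of `K` spans `∏ v, K_v` over `ℝ`. -/
theorem exists_real_coeff (z : ∀ v : InfinitePlace K, v.Completion) :
    ∃ t : Free.ChooseBasisIndex ℤ (𝓞 K) → ℝ, ∀ v, z v =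
      ∑ i, realHom v (t i) * algebraMap (𝓞 K) v.Completion (RingOfIntegers.basis K i) := by
  let m : mixedEmbedding.mixedSpace K :=
    (fun w => (Completion.extensionEmbedding w.1 (z w.1)).re,
      fun w => Completion.extensionEmbedding w.1 (z w.1))
  refine ⟨fun i => (mixedEmbedding.latticeBasis K).repr m i, fun v => ?_⟩
  have hm := (mixedEmbedding.latticeBasis K).sum_repr m
  apply extensionEmbedding_injective v
  rw [extensionEmbedding_sum_realHom]
  rcases v.isReal_or_isComplex with hv | hv
  · rw [← sum_latticeBasis_fst _ ⟨v, hv⟩, hm]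
    exact Complex.ext (by simp [m]) (by simp [im_extensionEmbedding v hv])
  · rw [← sum_latticeBasis_snd _ ⟨v, hv⟩, hm]

/-- An integral basis of `K` is linearly independent over `ℝ` in `∏ v, K_v`. -/
theorem eq_zero_of_sum_realHom_eq_zero (t : Free.ChooseBasisIndex ℤ (𝓞 K) → ℝ)
    (h : ∀ v : InfinitePlace K,
      ∑ i, realHom v (t i) * algebraMap (𝓞 K) v.Completion (RingOfIntegers.basis K i) = 0) :
    t = 0 := by
  have hm : ∑ i, t i • mixedEmbedding.latticeBasis K i = 0 := by
    refine Prod.ext (funext fun w => ?_) (funext fun w => ?_)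
    · have := sum_latticeBasis_fst t w
      rw [← extensionEmbedding_sum_realHom, h, map_zero] at this
      exact_mod_cast this
    · rw [sum_latticeBasis_snd, ← extensionEmbedding_sum_realHom, h, map_zero]
      rfl
  exact funext (Fintype.linearIndependent_iff.1
    (mixedEmbedding.latticeBasis K).linearIndependent t hm)

end RealCoefficients

/-! ### Modules over the ring of integers -/

section Modules

variable {K : Type*} [Field K] [NumberField K] {P : Type*} [AddCommGroup P] [Module (𝓞 K) P]

theorem exists_int_dvd {a : 𝓞 K} (ha : a ≠ 0) : ∃ m : ℤ, m ≠ 0 ∧ a ∣ (m : 𝓞 K) := by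
  refine ⟨Ideal.absNorm (Ideal.span {a}), ?_, ?_⟩
  · rw [Nat.cast_ne_zero, Ne, Ideal.absNorm_eq_zero_iff, Ideal.span_singleton_eq_bot]
    exact ha
  · have := Ideal.absNorm_mem (Ideal.span {a})
    rw [Ideal.mem_span_singleton] at this
    exact_mod_cast this

-- Every nonzero algebraic integer divides a nonzero rational integer, namely the norm of the ideal
-- it generates.
variable (K) in
theorem isTorsion_int (h : Module.IsTorsion (𝓞 K) P) : Module.IsTorsion ℤ P := by
  intro x
  obtain ⟨⟨a, ha⟩, hx⟩ := @h x
  obtain ⟨m, hm, c, hc⟩ := exists_int_dvd (nonZeroDivisors.ne_zero ha)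
  refine ⟨⟨m, mem_nonZeroDivisors_of_ne_zero hm⟩, ?_⟩
  change m • x = 0
  have h1 : m • x = ((m : 𝓞 K)) • x := (Int.cast_smul_eq_zsmul (𝓞 K) m x).symm
  have h2 : a • x = 0 := hx
  rw [h1, hc, mul_comm, mul_smul, h2, smul_zero]

variable (K P) in
theorem finite_int [Module.Finite (𝓞 K) P] : Module.Finite ℤ P := Module.Finite.trans (𝓞 K) P

variable (K P) in
theorem isTorsionFree_int [Module.IsTorsionFree (𝓞 K) P] : Module.IsTorsionFree ℤ P :=
  Module.IsTorsionFree.trans (𝓞 K)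

variable (K P) in
theorem free_int [Module.Finite (𝓞 K) P] [Module.IsTorsionFree (𝓞 K) P] : Module.Free ℤ P :=
  have := finite_int K P
  have := isTorsionFree_int K P
  inferInstance

/-- A submodule is saturated if the quotient by it is torsion-free. -/
def IsSaturated (N : Submodule (𝓞 K) P) : Prop :=
  ∀ (a : 𝓞 K) (x : P), a ≠ 0 → a • x ∈ N → x ∈ N

theorem isTorsionFree_quotient_iff {N : Submodule (𝓞 K) P} :
    Module.IsTorsionFree (𝓞 K) (P ⧸ N) ↔ IsSaturated N := by
  rw [Module.isTorsionFree_iff_smul_eq_zero]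
  constructor
  · intro h a x ha hx
    have h1 : a • (Submodule.Quotient.mk x : P ⧸ N) = 0 := by
      rwa [← Submodule.Quotient.mk_smul, Submodule.Quotient.mk_eq_zero]
    exact (Submodule.Quotient.mk_eq_zero N).1 ((h _ _ h1).resolve_left ha)
  · intro h a x hx
    induction x using Submodule.Quotient.induction_on with
    | H x =>
      rw [← Submodule.Quotient.mk_smul, Submodule.Quotient.mk_eq_zero] at hx
      by_cases ha : a = 0
      · exact Or.inl ha
      · exact Or.inr ((Submodule.Quotient.mk_eq_zero N).2 (h a x ha hx))

/-- Torsion-free modules over a Dedekind domain are flat, and finitely presented flat modules are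
projective. Thus the sublattices of the theorem can be handled as saturated submodules. -/
theorem projective_of_isTorsionFree [Module.Finite (𝓞 K) P] [Module.IsTorsionFree (𝓞 K) P] :
    Module.Projective (𝓞 K) P :=
  have : Module.FinitePresentation (𝓞 K) P := Module.finitePresentation_of_finite _ _
  Module.Flat.projective_of_finitePresentation

theorem projective_quotient_iff [Module.Finite (𝓞 K) P] {N : Submodule (𝓞 K) P} :
    Module.Projective (𝓞 K) (P ⧸ N) ↔ IsSaturated N := by
  rw [← isTorsionFree_quotient_iff]
  exact ⟨fun _ => inferInstance, fun _ => projective_of_isTorsionFree⟩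

/-- The saturation of a submodule. -/
def saturation (N : Submodule (𝓞 K) P) : Submodule (𝓞 K) P where
  carrier := {x | ∃ a : 𝓞 K, a ≠ 0 ∧ a • x ∈ N}
  zero_mem' := ⟨1, one_ne_zero, by simp⟩
  add_mem' := by
    rintro x y ⟨a, ha, hx⟩ ⟨b, hb, hy⟩
    refine ⟨a * b, mul_ne_zero ha hb, ?_⟩
    rw [smul_add]
    refine N.add_mem ?_ ?_
    · rw [mul_comm, mul_smul]; exact N.smul_mem _ hx
    · rw [mul_smul]; exact N.smul_mem _ hy
  smul_mem' := by
    rintro c x ⟨a, ha, hx⟩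
    exact ⟨a, ha, by rw [smul_comm]; exact N.smul_mem _ hx⟩

theorem le_saturation (N : Submodule (𝓞 K) P) : N ≤ saturation N :=
  fun x hx => ⟨1, one_ne_zero, by simpa using hx⟩

theorem isSaturated_saturation (N : Submodule (𝓞 K) P) : IsSaturated (saturation N) := by
  rintro a x ha ⟨b, hb, h⟩
  exact ⟨b * a, mul_ne_zero hb ha, by rwa [mul_smul]⟩

theorem saturation_le {N M : Submodule (𝓞 K) P} (hM : IsSaturated M) (h : N ≤ M) :
    saturation N ≤ M := by
  rintro x ⟨a, ha, hx⟩
  exact hM a x ha (h hx)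

theorem IsSaturated.inf {N M : Submodule (𝓞 K) P} (hN : IsSaturated N) (hM : IsSaturated M) :
    IsSaturated (N ⊓ M) :=
  fun a x ha hx => ⟨hN a x ha hx.1, hM a x ha hx.2⟩

theorem isSaturated_bot [Module.IsTorsionFree (𝓞 K) P] :
    IsSaturated (⊥ : Submodule (𝓞 K) P) := by
  intro a x ha hx
  rw [Submodule.mem_bot] at hx ⊢
  exact (smul_eq_zero.1 hx).resolve_left ha

theorem isSaturated_top : IsSaturated (⊤ : Submodule (𝓞 K) P) := fun _ _ _ _ => trivial

variable [Module.Finite (𝓞 K) P]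

theorem finrank_quotient_eq_zero_iff {N : Submodule (𝓞 K) P} :
    finrank (𝓞 K) (P ⧸ N) = 0 ↔ saturation N = ⊤ := by
  rw [Module.finrank_eq_zero_iff_isTorsion, eq_top_iff]
  constructor
  · intro h x _
    obtain ⟨⟨a, ha⟩, hx⟩ := @h (Submodule.Quotient.mk x)
    exact ⟨a, nonZeroDivisors.ne_zero ha, (Submodule.Quotient.mk_eq_zero N).1 hx⟩
  · intro h x
    induction x using Submodule.Quotient.induction_on with
    | H x =>
      obtain ⟨a, ha, hx⟩ := h (Submodule.mem_top (x := x))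
      exact ⟨⟨a, mem_nonZeroDivisors_of_ne_zero ha⟩, (Submodule.Quotient.mk_eq_zero N).2 hx⟩

theorem saturation_eq_top_of_finrank_eq {N : Submodule (𝓞 K) P}
    (h : finrank (𝓞 K) N = finrank (𝓞 K) P) : saturation N = ⊤ := by
  rw [← finrank_quotient_eq_zero_iff]
  have := N.finrank_quotient_add_finrank
  omega

theorem finrank_eq_of_saturation_eq_top {N : Submodule (𝓞 K) P} (h : saturation N = ⊤) :
    finrank (𝓞 K) N = finrank (𝓞 K) P := by
  rw [← finrank_quotient_eq_zero_iff] at h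
  have := N.finrank_quotient_add_finrank
  omega

/-- The quotient is torsion over `𝓞 K`, hence over `ℤ`, so it has `ℤ`-rank zero. -/
theorem finrank_int_eq_of_saturation_eq_top {N : Submodule (𝓞 K) P} (h : saturation N = ⊤) :
    finrank ℤ N = finrank ℤ P := by
  rw [← finrank_quotient_eq_zero_iff, Module.finrank_eq_zero_iff_isTorsion] at h
  have h1 := isTorsion_int K h
  have := finite_int K P
  have := finite_int K (P ⧸ N)
  rw [← Module.finrank_eq_zero_iff_isTorsion] at h1
  have h2 := (N.restrictScalars ℤ).finrank_quotient_add_finrank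
  have h3 : finrank ℤ (P ⧸ N.restrictScalars ℤ) = finrank ℤ (P ⧸ N) :=
    LinearEquiv.finrank_eq (Submodule.Quotient.restrictScalarsEquiv ℤ N)
  have h4 : finrank ℤ (N.restrictScalars ℤ) = finrank ℤ N := rfl
  omega

theorem submoduleOf_saturation_eq_top {A B : Submodule (𝓞 K) P} (hAB : A ≤ B)
    (h : finrank (𝓞 K) A = finrank (𝓞 K) B) : saturation (A.submoduleOf B) = ⊤ := by
  apply saturation_eq_top_of_finrank_eq
  rw [← h]
  exact LinearEquiv.finrank_eq (Submodule.submoduleOfEquivOfLe hAB)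

theorem eq_of_le_of_finrank_eq {A B : Submodule (𝓞 K) P} (hA : IsSaturated A) (hAB : A ≤ B)
    (h : finrank (𝓞 K) A = finrank (𝓞 K) B) : A = B := by
  refine le_antisymm hAB fun x hx => ?_
  have h1 : (⟨x, hx⟩ : B) ∈ saturation (A.submoduleOf B) := by
    rw [submoduleOf_saturation_eq_top hAB h]; trivial
  obtain ⟨a, ha, h2⟩ := h1
  exact hA a x ha h2

theorem finrank_lt_finrank {A B : Submodule (𝓞 K) P} (hA : IsSaturated A) (hAB : A < B) :
    finrank (𝓞 K) A < finrank (𝓞 K) B :=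
  lt_of_le_of_ne (Submodule.finrank_mono hAB.le) fun h =>
    hAB.ne (eq_of_le_of_finrank_eq hA hAB.le h)

theorem finrank_saturation (N : Submodule (𝓞 K) P) :
    finrank (𝓞 K) (saturation N) = finrank (𝓞 K) N := by
  have h : saturation (N.submoduleOf (saturation N)) = ⊤ := by
    rw [eq_top_iff]
    rintro ⟨x, a, ha, hx⟩ -
    exact ⟨a, ha, hx⟩
  rw [← finrank_eq_of_saturation_eq_top h]
  exact LinearEquiv.finrank_eq (Submodule.submoduleOfEquivOfLe (le_saturation N))

/-- Ranks are additive in short exact sequences, and `A / (A ⊓ B)` is isomorphic to `(A ⊔ B) / B`.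
-/
theorem finrank_sup_add_finrank_inf (A B : Submodule (𝓞 K) P) :
    finrank (𝓞 K) ↥(A ⊔ B) + finrank (𝓞 K) ↥(A ⊓ B) = finrank (𝓞 K) A + finrank (𝓞 K) B := by
  have h1 := (Submodule.comap A.subtype A ⊓ Submodule.comap A.subtype B).finrank_quotient_add_finrank
  have h2 := (Submodule.comap (A ⊔ B).subtype B).finrank_quotient_add_finrank
  have h3 := LinearEquiv.finrank_eq (LinearMap.quotientInfEquivSupQuotient A B)
  have h4 : finrank (𝓞 K) ↥(Submodule.comap A.subtype A ⊓ Submodule.comap A.subtype B) =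
      finrank (𝓞 K) ↥(A ⊓ B) := by
    rw [← Submodule.comap_inf]
    exact LinearEquiv.finrank_eq (Submodule.comapSubtypeEquivOfLe inf_le_left)
  have h5 : finrank (𝓞 K) (Submodule.comap (A ⊔ B).subtype B) = finrank (𝓞 K) B :=
    LinearEquiv.finrank_eq (Submodule.comapSubtypeEquivOfLe le_sup_right)
  omega

end Modules

end ArakelovLattice
end

noncomputable section
namespace ArakelovLattice

/-! ### The Euclidean space of a lattice -/

section InnerAt

variable {K : Type*} [Field K] [NumberField K] {P : Type*} [AddCommGroup P] [Module (𝓞 K) P]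
  (Λ : OKLattice K P) (v : InfinitePlace K)

namespace OKLattice

theorem conj_innerAt (u w : LocalSpace K P v) :
    conjHom v (Λ.innerAt v w u) = Λ.innerAt v u w :=
  letI := completionRCLike v
  (Λ v).conj_inner_symm u w

theorem innerAt_add_left (u w z : LocalSpace K P v) :
    Λ.innerAt v (u + w) z = Λ.innerAt v u z + Λ.innerAt v w z :=
  letI := completionRCLike v
  (Λ v).add_left u w z

theorem innerAt_smul_left (c : v.Completion) (u w : LocalSpace K P v) :
    Λ.innerAt v (c • u) w = conjHom v c * Λ.innerAt v u w :=
  letI := completionRCLike v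
  (Λ v).smul_left u w c

theorem re_innerAt_self_nonneg (u : LocalSpace K P v) :
    0 ≤ (Completion.extensionEmbedding v (Λ.innerAt v u u)).re :=
  letI := completionRCLike v
  (Λ v).re_inner_nonneg u

theorem im_innerAt_self (u : LocalSpace K P v) :
    (Completion.extensionEmbedding v (Λ.innerAt v u u)).im = 0 := by
  have h := congrArg (Completion.extensionEmbedding v) (Λ.conj_innerAt v u u)
  rw [extensionEmbedding_conjHom] at h
  exact Complex.conj_eq_iff_im.1 h

theorem eq_zero_of_re_innerAt_self (u : LocalSpace K P v)
    (h : (Completion.extensionEmbedding v (Λ.innerAt v u u)).re = 0) : u = 0 := by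
  let := completionRCLike v
  refine (Λ v).definite u (extensionEmbedding_injective v ?_)
  rw [map_zero]
  exact Complex.ext h (Λ.im_innerAt_self v u)

theorem re_innerAt_comm (u w : LocalSpace K P v) :
    (Completion.extensionEmbedding v (Λ.innerAt v u w)).re =
      (Completion.extensionEmbedding v (Λ.innerAt v w u)).re := by
  rw [← conj_innerAt]; simp

theorem innerAt_add_right (u w z : LocalSpace K P v) :
    Λ.innerAt v u (w + z) = Λ.innerAt v u w + Λ.innerAt v u z := by
  apply extensionEmbedding_injective v
  rw [← conj_innerAt, innerAt_add_left, ← Λ.conj_innerAt v u w, ← Λ.conj_innerAt v u z]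
  simp

theorem innerAt_smul_right (c : v.Completion) (u w : LocalSpace K P v) :
    Λ.innerAt v u (c • w) = c * Λ.innerAt v u w := by
  apply extensionEmbedding_injective v
  rw [← conj_innerAt, innerAt_smul_left, ← Λ.conj_innerAt v u w]
  simp

/-- The real vector space `∏ v, V_v = P ⊗ ℝ`, with the inner product `∑ v, Re ⟨ , ⟩_v`. -/
def Ambient (_Λ : OKLattice K P) : Type _ := ∀ v : InfinitePlace K, LocalSpace K P v

instance : AddCommGroup Λ.Ambient :=
  inferInstanceAs (AddCommGroup (∀ v : InfinitePlace K, LocalSpace K P v))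

instance : Module ℝ Λ.Ambient where
  smul t u := fun v => realHom v t • u v
  one_smul u := funext fun v => by
    change realHom v 1 • u v = u v
    rw [map_one, one_smul]
  mul_smul s t u := funext fun v => by
    change realHom v (s * t) • u v = realHom v s • realHom v t • u v
    rw [map_mul, mul_smul]
  smul_zero t := funext fun v => by
    change realHom v t • (0 : LocalSpace K P v) = 0
    exact smul_zero _
  smul_add t u w := funext fun v => by
    change realHom v t • (u v + w v) = realHom v t • u v + realHom v t • w v
    exact smul_add _ _ _
  add_smul s t u := funext fun v => by
    change realHom v (s + t) • u v = realHom v s • u v + realHom v t • u v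
    rw [map_add, add_smul]
  zero_smul u := funext fun v => by
    change realHom v 0 • u v = 0
    rw [map_zero, zero_smul]

theorem Ambient.smul_apply (t : ℝ) (u : Λ.Ambient) : (t • u) v = realHom v t • u v := rfl

theorem Ambient.add_apply (u w : Λ.Ambient) : (u + w) v = u v + w v := rfl

theorem Ambient.sum_apply {ι : Type*} (s : Finset ι) (u : ι → Λ.Ambient) :
    (∑ i ∈ s, u i) v = ∑ i ∈ s, u i v := Finset.sum_apply v s u

theorem conjHom_realHom (t : ℝ) : conjHom v (realHom v t) = realHom v t :=
  extensionEmbedding_injective v (by simp)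

/-- The inner product of `Λ.Ambient`. -/
@[reducible] def ambientCore : InnerProductSpace.Core ℝ Λ.Ambient where
  inner u w := ∑ v, (Completion.extensionEmbedding v (Λ.innerAt v (u v) (w v))).re
  conj_inner_symm u w := by
    simp only [conj_trivial]
    exact Finset.sum_congr rfl fun _ _ => Λ.re_innerAt_comm _ _ _
  re_inner_nonneg u := Finset.sum_nonneg fun _ _ => Λ.re_innerAt_self_nonneg _ _
  add_left u w z := by
    rw [← Finset.sum_add_distrib]
    refine Finset.sum_congr rfl fun v _ => ?_
    rw [Ambient.add_apply, innerAt_add_left, map_add, Complex.add_re]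
  smul_left u w t := by
    rw [Finset.mul_sum]
    refine Finset.sum_congr rfl fun v _ => ?_
    rw [Ambient.smul_apply, innerAt_smul_left, conjHom_realHom]
    simp
  definite u hu := by
    funext v
    exact Λ.eq_zero_of_re_innerAt_self v _ ((Finset.sum_eq_zero_iff_of_nonneg
      fun _ _ => Λ.re_innerAt_self_nonneg _ _).1 hu v (Finset.mem_univ v))

instance : NormedAddCommGroup Λ.Ambient := Λ.ambientCore.toNormedAddCommGroup

instance : InnerProductSpace ℝ Λ.Ambient := InnerProductSpace.ofCore Λ.ambientCore.toCore

theorem ambient_inner (u w : Λ.Ambient) :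
    inner ℝ u w = ∑ v, (Completion.extensionEmbedding v (Λ.innerAt v (u v) (w v))).re := rfl

/-- The map `P → P ⊗ ℝ`. -/
def toAmbient : P →+ Λ.Ambient where
  toFun x := fun _ => 1 ⊗ₜ x
  map_zero' := funext fun _ => TensorProduct.tmul_zero _ _
  map_add' _ _ := funext fun _ => TensorProduct.tmul_add _ _ _

theorem toAmbient_apply (x : P) : Λ.toAmbient x v = 1 ⊗ₜ x := rfl

theorem inner_toAmbient (x y : P) : inner ℝ (Λ.toAmbient x) (Λ.toAmbient y) = Λ.innerInfty x y :=
  rfl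

theorem smul_toAmbient_smul_apply (t : ℝ) (a : 𝓞 K) (x : P) :
    (t • Λ.toAmbient (a • x)) v = (realHom v t * algebraMap (𝓞 K) v.Completion a) ⊗ₜ x := by
  rw [Ambient.smul_apply, toAmbient_apply, TensorProduct.smul_tmul', ← TensorProduct.smul_tmul,
    smul_eq_mul, mul_comm, ← smul_eq_mul, smul_comm, Algebra.smul_def, Algebra.smul_def]
  simp [mul_comm]

-- An integral basis of `K` spans `∏ v, K_v` over `ℝ`, so a pure tensor `c ⊗ x` supported at one
-- place is a real combination of the vectors `1 ⊗ ω_i x`.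
open Classical in
theorem span_range_toAmbient : Submodule.span ℝ (Set.range Λ.toAmbient) = ⊤ := by
  rw [eq_top_iff]
  rintro u -
  let single (v : InfinitePlace K) : LocalSpace K P v →+ Λ.Ambient :=
    AddMonoidHom.single (fun v : InfinitePlace K => LocalSpace K P v) v
  have hu : u = ∑ v, single v (u v) :=
    (Finset.univ_sum_single (M := fun v : InfinitePlace K => LocalSpace K P v) u).symm
  rw [hu]
  refine Submodule.sum_mem _ fun v _ => ?_
  induction u v using TensorProduct.induction_on with
  | zero => rw [map_zero]; exact Submodule.zero_mem _
  | add x y hx hy => rw [map_add]; exact Submodule.add_mem _ hx hy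
  | tmul c x =>
    obtain ⟨t, ht⟩ := exists_real_coeff (Pi.single v c : ∀ v : InfinitePlace K, v.Completion)
    have : single v (c ⊗ₜ[𝓞 K] x) =
        ∑ i, t i • Λ.toAmbient (RingOfIntegers.basis K i • x) := by
      funext w
      rw [Ambient.sum_apply]
      simp_rw [smul_toAmbient_smul_apply, ← TensorProduct.sum_tmul]
      rw [← ht w]
      change (Pi.single v (c ⊗ₜ[𝓞 K] x) : ∀ v : InfinitePlace K, LocalSpace K P v) w = _
      by_cases hw : w = v
      · subst hw; simp
      · simp [hw]
    rw [this]
    exact Submodule.sum_mem _ fun i _ => Submodule.smul_mem _ _ (Submodule.subset_span ⟨_, rfl⟩)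

/-- `K_v`-coordinates with respect to an independent family are unique. -/
theorem eq_zero_of_sum_tmul_eq_zero {n : ℕ} {x : Fin n → P} (hx : LinearIndependent (𝓞 K) x)
    (c : Fin n → v.Completion) (h : ∑ j, c j ⊗ₜ[𝓞 K] x j = 0) : c = 0 := by
  set f := Fintype.linearCombination (𝓞 K) x
  have hf : Function.Injective f := linearIndependent_iff_injective_fintypeLinearCombination.1 hx
  -- `K_v` is flat over `𝓞 K`, so the injection of the free module on the family stays injective
  -- after tensoring.
  have hf' := Module.Flat.lTensor_preserves_injective_linearMap (M := v.Completion) f hf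
  have h1 : LinearMap.lTensor v.Completion f
      (∑ j, c j ⊗ₜ[𝓞 K] (Pi.single j 1 : Fin n → 𝓞 K)) = 0 := by
    rw [map_sum, ← h]
    refine Finset.sum_congr rfl fun j _ => ?_
    rw [LinearMap.lTensor_tmul]
    simp [f]
  have h2 := hf' (h1.trans (map_zero _).symm)
  have h3 := congrArg (TensorProduct.piScalarRight (𝓞 K) (𝓞 K) v.Completion (Fin n)) h2
  funext j
  have h4 := congrFun h3 j
  simpa [Finset.sum_apply, Pi.single_apply] using h4

/-- At each place the `K_v`-coefficients of the `x j` must vanish; as this holds at all places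
together, the independence of the integral basis over `ℝ` applies to each `j`. -/
theorem linearIndependent_toAmbient_smul {n : ℕ} {x : Fin n → P}
    (hx : LinearIndependent (𝓞 K) x) :
    LinearIndependent ℝ fun q : Free.ChooseBasisIndex ℤ (𝓞 K) × Fin n =>
      Λ.toAmbient (RingOfIntegers.basis K q.1 • x q.2) := by
  rw [Fintype.linearIndependent_iff]
  intro t ht q
  have h (v : InfinitePlace K) : (fun j => ∑ i, realHom v (t (i, j)) *
      algebraMap (𝓞 K) v.Completion (RingOfIntegers.basis K i)) = 0 := by
    apply eq_zero_of_sum_tmul_eq_zero v hx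
    have h1 := congrFun ht v
    rw [Ambient.sum_apply] at h1
    simp_rw [smul_toAmbient_smul_apply] at h1
    rw [Fintype.sum_prod_type, Finset.sum_comm] at h1
    simp_rw [TensorProduct.sum_tmul]
    exact h1
  exact congrFun (eq_zero_of_sum_realHom_eq_zero (fun i => t (i, q.2))
    fun v => congrFun (h v) q.2) q.1

end OKLattice

end InnerAt

/-! ### Covolumes of sublattices -/

section Covolume

variable {K : Type*} [Field K] [NumberField K] {P : Type*} [AddCommGroup P] [Module (𝓞 K) P]

theorem exists_linearIndependent_fin [Module.Finite (𝓞 K) P] :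
    ∃ x : Fin (finrank (𝓞 K) P) → P, LinearIndependent (𝓞 K) x := by
  obtain ⟨s, hs, h⟩ := exists_finset_linearIndependent_of_le_finrank (le_refl (finrank (𝓞 K) P))
  exact ⟨fun i => (s.equivFinOfCardEq hs).symm i, h.comp _ (Equiv.injective _)⟩

theorem saturation_span_eq_top [Module.Finite (𝓞 K) P] {n : ℕ} (hn : finrank (𝓞 K) P = n)
    {x : Fin n → P} (hx : LinearIndependent (𝓞 K) x) :
    saturation (Submodule.span (𝓞 K) (Set.range x)) = ⊤ :=
  saturation_eq_top_of_finrank_eq (by rw [finrank_span_eq_card hx, hn, Fintype.card_fin])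

-- A maximal independent family spans a free submodule with torsion quotient, for which the formula
-- is clear.
variable (K P) in
theorem finrank_int_eq [Module.Finite (𝓞 K) P] :
    finrank ℤ P = finrank ℚ K * finrank (𝓞 K) P := by
  obtain ⟨x, hx⟩ := exists_linearIndependent_fin (K := K) (P := P)
  rw [← finrank_int_eq_of_saturation_eq_top (saturation_span_eq_top rfl hx)]
  have e := (Basis.span hx).equivFun
  rw [LinearEquiv.finrank_eq (e.restrictScalars ℤ), Module.finrank_pi_fintype]
  simp [RingOfIntegers.rank, mul_comm]

namespace OKLattice

variable (Λ : OKLattice K P)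

theorem span_range_toAmbient_basis {ι : Type*} (b : Basis ι ℤ P) :
    Submodule.span ℝ (Set.range fun i => Λ.toAmbient (b i)) = ⊤ := by
  rw [eq_top_iff, ← span_range_toAmbient, Submodule.span_le]
  rintro _ ⟨x, rfl⟩
  have hx : x ∈ Submodule.span ℤ (Set.range b) := by rw [b.span_eq]; trivial
  induction hx using Submodule.span_induction with
  | mem x hx => obtain ⟨i, rfl⟩ := hx; exact Submodule.subset_span ⟨i, rfl⟩
  | zero => rw [map_zero]; exact Submodule.zero_mem _
  | add x y _ _ hx hy => rw [map_add]; exact Submodule.add_mem _ hx hy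
  | smul m x _ hx =>
    rw [map_zsmul, ← Int.cast_smul_eq_zsmul ℝ]
    exact Submodule.smul_mem _ _ hx

variable [Module.Finite (𝓞 K) P] [Module.IsTorsionFree (𝓞 K) P]

instance : FiniteDimensional ℝ Λ.Ambient := by
  have := finite_int K P
  have := free_int K P
  refine Module.finite_def.2 ?_
  rw [← Λ.span_range_toAmbient_basis (Module.finBasis ℤ P)]
  exact Submodule.fg_span (Set.finite_range _)

/-- A count: the vectors span the real space, and their number `[K : ℚ] * rk P` is also the number
of independent vectors `ω_i x_j` that this space contains. -/
theorem linearIndependent_toAmbient {ι : Type*} (b : Basis ι ℤ P) :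
    LinearIndependent ℝ fun i => Λ.toAmbient (b i) := by
  have := finite_int K P
  have := Module.Finite.finite_basis b
  have := Fintype.ofFinite ι
  obtain ⟨x, hx⟩ := exists_linearIndependent_fin (K := K) (P := P)
  refine linearIndependent_of_top_le_span_of_card_le_finrank
    (Λ.span_range_toAmbient_basis b).ge ?_
  have h := (Λ.linearIndependent_toAmbient_smul hx).fintype_card_le_finrank
  rw [← Module.finrank_eq_card_basis b, finrank_int_eq K P]
  rwa [Fintype.card_prod, Fintype.card_fin, ← Module.finrank_eq_card_chooseBasisIndex,
    RingOfIntegers.rank] at h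

/-- Frees the volume from the chosen basis in its definition: a change of `ℤ`-basis has determinant
`±1`, and the Gram determinant scales with its square. -/
theorem volLeb_sq {ι : Type*} [Fintype ι] [DecidableEq ι] (b : Basis ι ℤ P) :
    Λ.volLeb ^ 2 = (Matrix.gram ℝ fun i => Λ.toAmbient (b i)).det := by
  have := finite_int K P
  have hne : Nonempty (Basis (Fin (finrank ℤ P)) ℤ P) := by
    have := free_int K P
    exact ⟨Module.finBasis ℤ P⟩
  have h1 : Λ.volLeb = √(Matrix.gram ℝ fun i => Λ.toAmbient (hne.some i)).det := by
    rw [volLeb, dif_pos hne]; rfl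
  rw [h1, Real.sq_sqrt (det_gram_nonneg _)]
  set c := hne.some.reindex (hne.some.indexEquiv b)
  have h2 : (Matrix.gram ℝ fun i => Λ.toAmbient (hne.some i)).det =
      (Matrix.gram ℝ fun i => Λ.toAmbient (c i)).det := by
    rw [← Matrix.det_reindex_self (hne.some.indexEquiv b)]
    congr 1
    ext i j
    simp [Matrix.gram_apply, c]
  have h3 : (fun i => Λ.toAmbient (b i)) = fun i => ∑ j, ((c.repr (b i) j : ℤ) : ℝ) •
      Λ.toAmbient (c j) := by
    funext i
    conv_lhs => rw [← c.sum_repr (b i), map_sum]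
    refine Finset.sum_congr rfl fun j _ => ?_
    rw [map_zsmul, Int.cast_smul_eq_zsmul]
  have h4 : (Matrix.of fun i j => ((c.repr (b i) j : ℤ) : ℝ)).det ^ 2 = 1 := by
    have h5 : (Matrix.of fun i j => ((c.repr (b i) j : ℤ) : ℝ)) =
        ((c.toMatrix b).transpose.map (Int.castRingHom ℝ)) := by
      ext i j; simp [Basis.toMatrix_apply]
    have h6 : IsUnit (c.toMatrix b).det := c.isUnit_det b
    rw [h5, ← RingHom.mapMatrix_apply, ← RingHom.map_det, Matrix.det_transpose]
    rcases Int.isUnit_iff.1 h6 with h | h <;> simp [h]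
  rw [h2, h3]
  have := det_gram_sum_smul (Matrix.of fun i j => ((c.repr (b i) j : ℤ) : ℝ))
    fun j => Λ.toAmbient (c j)
  rw [h4, one_mul] at this
  exact this.symm

/-- The Lebesgue volume of a sublattice. -/
def covol (Λ : OKLattice K P) (N : Submodule (𝓞 K) P) : ℝ := (Λ.restrict N).volLeb

theorem gram_toAmbient_restrict {ι : Type*} (N : Submodule (𝓞 K) P) (x : ι → N) :
    (Matrix.gram ℝ fun i => (Λ.restrict N).toAmbient (x i)) =
      Matrix.gram ℝ fun i => Λ.toAmbient (x i) := rfl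

theorem covol_sq {N : Submodule (𝓞 K) P} {ι : Type*} [Fintype ι] [DecidableEq ι]
    (b : Basis ι ℤ N) :
    Λ.covol N ^ 2 = (Matrix.gram ℝ fun i => Λ.toAmbient (b i)).det := by
  rw [covol, volLeb_sq _ b, gram_toAmbient_restrict]

theorem linearIndependent_toAmbient_coe {N : Submodule (𝓞 K) P} {ι : Type*}
    (b : Basis ι ℤ N) : LinearIndependent ℝ fun i => Λ.toAmbient (b i) := by
  classical
  have := finite_int K N
  have := Module.Finite.finite_basis b
  have := Fintype.ofFinite ι
  rw [← Matrix.det_gram_ne_zero_iff_linearIndependent, ← gram_toAmbient_restrict,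
    Matrix.det_gram_ne_zero_iff_linearIndependent]
  exact (Λ.restrict N).linearIndependent_toAmbient b

theorem volLeb_pos : 0 < Λ.volLeb := by
  have := finite_int K P
  have := free_int K P
  have h0 : 0 ≤ Λ.volLeb := by
    rw [volLeb]; split_ifs
    · exact Real.sqrt_nonneg _
    · exact le_rfl
  refine lt_of_le_of_ne h0 fun h => ?_
  have h1 := Λ.volLeb_sq (Module.finBasis ℤ P)
  have h2 := det_gram_pos (Λ.linearIndependent_toAmbient (Module.finBasis ℤ P))
  rw [← h1, ← h] at h2
  simp at h2

theorem covol_pos (N : Submodule (𝓞 K) P) : 0 < Λ.covol N := (Λ.restrict N).volLeb_pos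

end OKLattice

end Covolume

end ArakelovLattice
end

noncomputable section
namespace ArakelovLattice

/-! ### Comparison of covolumes -/

section Compare

variable {K : Type*} [Field K] [NumberField K] {P : Type*} [AddCommGroup P] [Module (𝓞 K) P]

namespace OKLattice

variable (Λ : OKLattice K P)

/-- The real subspace spanned by a sublattice. -/
def realSpan (N : Submodule (𝓞 K) P) : Submodule ℝ Λ.Ambient :=
  Submodule.span ℝ (Λ.toAmbient '' N)

theorem toAmbient_mem_realSpan {N : Submodule (𝓞 K) P} {x : P} (hx : x ∈ N) :
    Λ.toAmbient x ∈ Λ.realSpan N := Submodule.subset_span ⟨x, hx, rfl⟩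

theorem realSpan_mono {M N : Submodule (𝓞 K) P} (h : M ≤ N) : Λ.realSpan M ≤ Λ.realSpan N :=
  Submodule.span_mono (Set.image_mono h)

/-- The map `N ⊗ ℝ → P ⊗ ℝ`. -/
def ambientMap (N : Submodule (𝓞 K) P) : (Λ.restrict N).Ambient →ₗ[ℝ] Λ.Ambient where
  toFun u := fun v => N.subtype.baseChange v.Completion (u v)
  map_add' _ _ := funext fun _ => map_add _ _ _
  map_smul' t u := funext fun v => by
    change N.subtype.baseChange v.Completion (realHom v t • u v) =
      realHom v t • N.subtype.baseChange v.Completion (u v)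
    exact map_smul _ _ _

theorem ambientMap_toAmbient (N : Submodule (𝓞 K) P) (x : N) :
    Λ.ambientMap N ((Λ.restrict N).toAmbient x) = Λ.toAmbient x := rfl

theorem range_ambientMap (N : Submodule (𝓞 K) P) :
    LinearMap.range (Λ.ambientMap N) = Λ.realSpan N := by
  rw [LinearMap.range_eq_map, ← span_range_toAmbient, Submodule.map_span, realSpan]
  congr 1
  ext u
  simp only [Set.mem_image, Set.mem_range, exists_exists_eq_and, ambientMap_toAmbient]
  exact ⟨fun ⟨x, hx⟩ => ⟨x, x.2, hx⟩, fun ⟨x, hx, h⟩ => ⟨⟨x, hx⟩, h⟩⟩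

/-- The real span of a sublattice is stable under all the `K_v`, so membership can be tested place
by place. This is what allows orthogonal projections over `ℝ` to be compared with those over each
`K_v`. -/
theorem mem_realSpan_iff {N : Submodule (𝓞 K) P} {u : Λ.Ambient} :
    u ∈ Λ.realSpan N ↔
      ∀ v, u v ∈ LinearMap.range (N.subtype.baseChange v.Completion) := by
  rw [← range_ambientMap]
  constructor
  · rintro ⟨w, rfl⟩ v
    exact ⟨w v, rfl⟩
  · intro h
    choose w hw using h
    exact ⟨w, funext hw⟩

variable [Module.Finite (𝓞 K) P] [Module.IsTorsionFree (𝓞 K) P]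

theorem realSpan_eq_span_basis {N : Submodule (𝓞 K) P} {ι : Type*} (b : Basis ι ℤ N) :
    Λ.realSpan N = Submodule.span ℝ (Set.range fun i => Λ.toAmbient (b i)) := by
  rw [← range_ambientMap, LinearMap.range_eq_map, ← span_range_toAmbient_basis _ b,
    Submodule.map_span, ← Set.range_comp]
  rfl

/-- Covolumes of sublattices of the same rank. -/
theorem exists_covol_eq_mul {A B : Submodule (𝓞 K) P} (hAB : A ≤ B)
    (h : finrank (𝓞 K) A = finrank (𝓞 K) B) :
    ∃ m : ℕ, 0 < m ∧ Λ.covol A = m * Λ.covol B ∧ ∀ x ∈ B, m • x ∈ A := by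
  have := finite_int K A
  have := finite_int K B
  have := free_int K A
  have := free_int K B
  have hZ : finrank ℤ A = finrank ℤ B := by rw [finrank_int_eq K A, finrank_int_eq K B, h]
  let a := Module.finBasisOfFinrankEq ℤ A hZ
  let b := Module.finBasis ℤ B
  -- `M` expresses a basis of `A` in a basis of `B`. The number sought is `|det M|`, the index,
  -- which multiplies `B` into `A` by the adjugate identity.
  let M : Matrix (Fin (finrank ℤ B)) (Fin (finrank ℤ B)) ℤ :=
    Matrix.of fun i j => b.repr ⟨a i, hAB (a i).2⟩ j
  have hM (i) : (a i : P) = ∑ j, M i j • (b j : P) := by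
    have := congrArg (Subtype.val) (b.sum_repr ⟨a i, hAB (a i).2⟩)
    simp only [Submodule.coe_sum] at this
    exact this.symm
  have h1 : Λ.covol A ^ 2 = (M.det : ℝ) ^ 2 * Λ.covol B ^ 2 := by
    rw [Λ.covol_sq a, Λ.covol_sq b]
    have h2 := det_gram_sum_smul (M.map (Int.castRingHom ℝ)) fun j => Λ.toAmbient (b j)
    rw [← RingHom.mapMatrix_apply, ← RingHom.map_det] at h2
    rw [show (M.det : ℝ) = Int.castRingHom ℝ M.det from rfl, ← h2]
    congr 2
    funext i
    rw [hM, map_sum]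
    refine Finset.sum_congr rfl fun j _ => ?_
    rw [map_zsmul]
    exact (Int.cast_smul_eq_zsmul ℝ _ _).symm
  have h0 : M.det ≠ 0 := fun h0 => by
    rw [h0] at h1
    have := Λ.covol_pos A
    simp at h1
    exact this.ne' h1
  refine ⟨M.det.natAbs, Int.natAbs_pos.2 h0, ?_, fun x hx => ?_⟩
  · have h3 : ((M.det.natAbs : ℕ) : ℝ) = |(M.det : ℝ)| := by
      rw [Nat.cast_natAbs, Int.cast_abs]
    rw [h3, ← abs_of_pos (Λ.covol_pos A), ← abs_of_pos (Λ.covol_pos B), ← abs_mul,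
      ← sq_eq_sq_iff_abs_eq_abs, h1, mul_pow]
  · have h4 : M.det • x ∈ A := by
      have h5 (j) : M.det • (b j : P) ∈ A := by
        have h6 : M.det • (b j : P) = ∑ i, M.adjugate j i • (a i : P) := by
          simp_rw [hM, Finset.smul_sum, smul_smul]
          rw [Finset.sum_comm]
          simp_rw [← Finset.sum_smul]
          have h7 (k) : ∑ i, M.adjugate j i * M i k = (M.adjugate * M) j k := rfl
          simp_rw [h7, Matrix.adjugate_mul]
          simp [Matrix.one_apply]
        rw [h6]
        exact A.sum_mem fun i _ => zsmul_mem (a i).2 _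
      have h8 := congrArg Subtype.val (b.sum_repr ⟨x, hx⟩)
      simp only [Submodule.coe_sum] at h8
      rw [← h8, Finset.smul_sum]
      refine A.sum_mem fun j _ => ?_
      change M.det • (b.repr ⟨x, hx⟩ j • (b j : P)) ∈ A
      rw [smul_comm]
      exact zsmul_mem (h5 j) _
    rw [← natCast_zsmul]
    rcases Int.natAbs_eq M.det with h | h
    · rwa [← h]
    · rw [← neg_neg ((M.det.natAbs : ℕ) : ℤ), ← h, neg_smul]
      exact A.neg_mem h4

theorem covol_le_of_le {A B : Submodule (𝓞 K) P} (hAB : A ≤ B)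
    (h : finrank (𝓞 K) A = finrank (𝓞 K) B) : Λ.covol B ≤ Λ.covol A := by
  obtain ⟨m, hm, h1, -⟩ := Λ.exists_covol_eq_mul hAB h
  rw [h1]
  exact le_mul_of_one_le_left (Λ.covol_pos B).le (by exact_mod_cast hm)

/-- The covolume of a sublattice `B` in terms of a sublattice `A` and of the projections `y k` of a
basis of `B / A` to the orthogonal complement of `A`. -/
theorem covol_sq_eq_mul_det_gram {A B : Submodule (𝓞 K) P} (hAB : A ≤ B) {κ : Type*} [Fintype κ]
    [DecidableEq κ] (c : Basis κ ℤ (B ⧸ A.submoduleOf B)) (y : κ → Λ.Ambient)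
    (hy : ∀ k, ∀ x ∈ A, inner ℝ (Λ.toAmbient x) (y k) = 0)
    (hc : ∀ k, ∃ x : B, Submodule.Quotient.mk x = c k ∧ Λ.toAmbient x - y k ∈ Λ.realSpan A) :
    Λ.covol B ^ 2 = Λ.covol A ^ 2 * (Matrix.gram ℝ y).det := by
  classical
  have := finite_int K A
  have := free_int K A
  let a := Module.finBasis ℤ A
  let a' : Basis _ ℤ ((A.submoduleOf B).restrictScalars ℤ) :=
    a.map ((Submodule.submoduleOfEquivOfLe hAB).symm.restrictScalars ℤ)
  let c' : Basis κ ℤ (B ⧸ (A.submoduleOf B).restrictScalars ℤ) :=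
    c.map (Submodule.Quotient.restrictScalarsEquiv ℤ _).symm
  -- A `ℤ`-basis of `B` made of one of `A` and lifts of `c`. Replacing the lifts by the `y k`
  -- changes them only within the real span of `A`, and orthogonality then splits the Gram
  -- determinant.
  let e := Basis.sumQuot a' c'
  have hal (i) : ((e (Sum.inl i) : B) : P) = a i := by
    rw [Basis.sumQuot_inl]; rfl
  have har (k) : (Submodule.Quotient.mk (e (Sum.inr k)) : B ⧸ A.submoduleOf B) = c k := by
    have := congrArg (Submodule.Quotient.restrictScalarsEquiv ℤ (A.submoduleOf B))
      (Basis.sumQuot_inr a' c' k)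
    rw [Basis.map_apply, LinearEquiv.apply_symm_apply] at this
    exact this
  rw [Λ.covol_sq e, Λ.covol_sq a]
  have h1 : (fun s => Λ.toAmbient (e s)) = Sum.elim (fun i => Λ.toAmbient (a i))
      fun k => Λ.toAmbient (e (Sum.inr k)) := by
    funext s
    rcases s with i | k
    · simp only [Sum.elim_inl]; rw [hal]
    · rfl
  rw [h1, det_gram_sumElim_of_sub_mem_span _ _ y, det_gram_sumElim_of_orthogonal]
  · exact fun i k => hy k _ (a i).2
  · intro k
    rw [← realSpan_eq_span_basis]
    obtain ⟨x, hx, hxy⟩ := hc k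
    rw [← har k, Submodule.Quotient.eq] at hx
    have hx' : (x : P) - e (Sum.inr k) ∈ A := hx
    have h2 := Submodule.sub_mem _ hxy (Λ.toAmbient_mem_realSpan hx')
    rw [map_sub] at h2
    convert h2 using 1
    abel

/-- Projection to the orthogonal complement of a sublattice. -/
def orthProj (N : Submodule (𝓞 K) P) (u : Λ.Ambient) : Λ.Ambient :=
  u - (Λ.realSpan N).starProjection u

theorem sub_orthProj_mem (N : Submodule (𝓞 K) P) (u : Λ.Ambient) :
    u - Λ.orthProj N u ∈ Λ.realSpan N := by
  rw [orthProj, sub_sub_cancel]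
  exact Submodule.starProjection_apply_mem _ _

theorem inner_orthProj (N : Submodule (𝓞 K) P) (u : Λ.Ambient) {w : Λ.Ambient}
    (hw : w ∈ Λ.realSpan N) : inner ℝ w (Λ.orthProj N u) = 0 :=
  Submodule.sub_starProjection_mem_orthogonal u w hw

theorem free_quotient {A B : Submodule (𝓞 K) P}
    (h : ∀ (a : 𝓞 K), ∀ x ∈ B, a ≠ 0 → a • x ∈ A → x ∈ A) :
    Module.Free ℤ (B ⧸ A.submoduleOf B) := by
  have : Module.IsTorsionFree (𝓞 K) (B ⧸ A.submoduleOf B) :=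
    isTorsionFree_quotient_iff.2 fun a x ha hx => h a x x.2 ha hx
  exact free_int K _

/-- The parallelogram inequality for covolumes. -/
theorem covol_sup_mul_covol_inf_le {A B : Submodule (𝓞 K) P} (hB : IsSaturated B) :
    Λ.covol (A ⊔ B) * Λ.covol (A ⊓ B) ≤ Λ.covol A * Λ.covol B := by
  have := free_quotient (A := A ⊓ B) (B := A) fun a x hx ha h => ⟨hx, hB a x ha h.2⟩
  have := finite_int K (A ⧸ (A ⊓ B).submoduleOf A)
  let c := Module.finBasis ℤ (A ⧸ (A ⊓ B).submoduleOf A)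
  choose x hx using fun k => Submodule.Quotient.mk_surjective _ (c k)
  have h1 := Λ.covol_sq_eq_mul_det_gram inf_le_left c
    (fun k => Λ.orthProj (A ⊓ B) (Λ.toAmbient (x k)))
    (fun k z hz => Λ.inner_orthProj _ _ (Λ.toAmbient_mem_realSpan hz))
    (fun k => ⟨x k, hx k, Λ.sub_orthProj_mem _ _⟩)
  have hcomap : (A ⊓ B).submoduleOf A = Submodule.comap A.subtype A ⊓ Submodule.comap A.subtype B := by
    rw [← Submodule.comap_inf]; rfl
  -- The same lifts `x k` represent bases of both `A / (A ⊓ B)` and `(A ⊔ B) / B`; the two relative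
  -- covolumes differ only in the subspace that is projected away.
  let e : (A ⧸ (A ⊓ B).submoduleOf A) ≃ₗ[𝓞 K] (↥(A ⊔ B) ⧸ B.submoduleOf (A ⊔ B)) :=
    (Submodule.quotEquivOfEq _ _ hcomap).trans (LinearMap.quotientInfEquivSupQuotient A B)
  have he (z : A) : e (Submodule.Quotient.mk z) =
      Submodule.Quotient.mk ⟨z, Submodule.mem_sup_left z.2⟩ := rfl
  have h2 := Λ.covol_sq_eq_mul_det_gram le_sup_right (c.map (e.restrictScalars ℤ))
    (fun k => Λ.orthProj B (Λ.toAmbient (x k)))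
    (fun k z hz => Λ.inner_orthProj _ _ (Λ.toAmbient_mem_realSpan hz))
    (fun k => ⟨⟨x k, Submodule.mem_sup_left (x k).2⟩, by
      rw [← he, hx]; rfl, Λ.sub_orthProj_mem _ _⟩)
  -- The difference of the two projections lies in the real span of `B`, so it is orthogonal to the
  -- projection away from `B`.
  have h3 := det_gram_le_of_eq_add (fun k => Λ.orthProj (A ⊓ B) (Λ.toAmbient (x k)))
    (fun k => Λ.orthProj B (Λ.toAmbient (x k)))
    (fun k => Λ.orthProj (A ⊓ B) (Λ.toAmbient (x k)) - Λ.orthProj B (Λ.toAmbient (x k)))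
    (fun k => (add_sub_cancel _ _).symm) fun i j => by
      rw [real_inner_comm]
      refine Λ.inner_orthProj _ _ ?_
      have h4 := Λ.sub_orthProj_mem B (Λ.toAmbient (x j))
      have h5 := Λ.realSpan_mono (inf_le_right (a := A) (b := B))
        (Λ.sub_orthProj_mem (A ⊓ B) (Λ.toAmbient (x j)))
      have h6 := Submodule.sub_mem _ h4 h5
      convert h6 using 1
      abel
  have p1 := Λ.covol_pos A
  have p2 := Λ.covol_pos B
  have p3 := Λ.covol_pos (A ⊓ B)
  have p4 := Λ.covol_pos (A ⊔ B)
  refine (pow_le_pow_iff_left₀ (by positivity) (by positivity) two_ne_zero).1 ?_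
  rw [mul_pow, mul_pow, h1, h2]
  have : 0 ≤ Λ.covol B ^ 2 * Λ.covol (A ⊓ B) ^ 2 := by positivity
  nlinarith

theorem covol_restrict (B : Submodule (𝓞 K) P) (N : Submodule (𝓞 K) B) :
    (Λ.restrict B).covol N = Λ.covol (N.map B.subtype) := by
  have := finite_int K N
  have := free_int K N
  let e : N ≃ₗ[𝓞 K] N.map B.subtype := Submodule.equivMapOfInjective _ B.injective_subtype N
  let b := Module.finBasis ℤ N
  have h : (Λ.restrict B).covol N ^ 2 = Λ.covol (N.map B.subtype) ^ 2 := by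
    rw [covol_sq _ b, covol_sq _ (b.map (e.restrictScalars ℤ))]
    rfl
  exact (sq_eq_sq₀ (covol_pos _ _).le (covol_pos _ _).le).1 h

/-- The covolume of a sublattice of a quotient lattice. -/
theorem covol_quotient_mul {A : Submodule (𝓞 K) P} (hA : IsSaturated A)
    (N : Submodule (𝓞 K) (P ⧸ A)) :
    (Λ.quotient A).covol N * Λ.covol A = Λ.covol (N.comap A.mkQ) := by
  have htf : Module.IsTorsionFree (𝓞 K) (P ⧸ A) := isTorsionFree_quotient_iff.2 hA
  have := finite_int K N
  have := free_int K N
  let b := Module.finBasis ℤ N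
  set B := N.comap A.mkQ with hB
  have hAB : A ≤ B := fun x hx => by
    rw [hB, Submodule.mem_comap, Submodule.mkQ_apply, (Submodule.Quotient.mk_eq_zero A).2 hx]
    exact zero_mem _
  let f : B →ₗ[𝓞 K] N := A.mkQ.restrict fun x hx => hx
  have hf : Function.Surjective f := by
    rintro ⟨n, hn⟩
    obtain ⟨x, rfl⟩ := A.mkQ_surjective n
    exact ⟨⟨x, hn⟩, rfl⟩
  have hker : A.submoduleOf B = LinearMap.ker f := by
    ext x
    rw [LinearMap.mem_ker, ← Subtype.coe_inj]
    exact (Submodule.Quotient.mk_eq_zero A).symm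
  let e : (B ⧸ A.submoduleOf B) ≃ₗ[𝓞 K] N :=
    (Submodule.quotEquivOfEq _ _ hker).trans (f.quotKerEquivOfSurjective hf)
  have he (x : B) : e (Submodule.Quotient.mk x) = f x := rfl
  -- The quotient inner products are by definition those of the orthogonal lifts, so these lifts can
  -- play the role of the vectors `y` in `covol_sq_eq_mul_det_gram`.
  let lift (z : P ⧸ A) : Λ.Ambient := fun v =>
    letI := completionRCLike v
    orthogonalLift (Λ v) (A.mkQ.baseChange v.Completion)
        (LinearMap.lTensor_surjective _ A.mkQ_surjective) (1 ⊗ₜ z)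
  have h1 := Λ.covol_sq_eq_mul_det_gram hAB (b.map (e.symm.restrictScalars ℤ))
    (fun k => lift (b k)) (fun k x hx => by
      rw [ambient_inner]
      refine Finset.sum_eq_zero fun v _ => ?_
      let := completionRCLike v
      have h2 := orthogonalLift_mem (Λ v) (A.mkQ.baseChange v.Completion)
        (LinearMap.lTensor_surjective _ A.mkQ_surjective) (1 ⊗ₜ (b k : P ⧸ A))
      rw [mem_coreOrthogonal] at h2
      have h3 := h2 (1 ⊗ₜ x) (by
        rw [LinearMap.mem_ker, LinearMap.baseChange_tmul, Submodule.mkQ_apply,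
          (Submodule.Quotient.mk_eq_zero A).2 hx, TensorProduct.tmul_zero])
      have h4 : Λ.innerAt v (Λ.toAmbient x v) (lift (b k) v) = 0 := h3
      rw [h4]; simp) (fun k => by
      obtain ⟨x, hx⟩ := Submodule.Quotient.mk_surjective _ (e.symm (b k))
      refine ⟨x, hx, ?_⟩
      rw [mem_realSpan_iff]
      intro v
      let := completionRCLike v
      rw [← ker_baseChange_mkQ, LinearMap.mem_ker]
      have h5 := apply_orthogonalLift (Λ v) (A.mkQ.baseChange v.Completion)
        (LinearMap.lTensor_surjective _ A.mkQ_surjective) (1 ⊗ₜ (b k : P ⧸ A))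
      have h6 : A.mkQ (x : P) = b k := by
        have := congrArg e hx
        rw [he, LinearEquiv.apply_symm_apply] at this
        rw [← this]; rfl
      have h7 : (Λ.toAmbient (x : P) - lift (b k)) v = 1 ⊗ₜ (x : P) - lift (b k) v := rfl
      rw [h7, map_sub, LinearMap.baseChange_tmul, h6, sub_eq_zero]
      exact h5.symm)
  have h8 : (Λ.quotient A).covol N ^ 2 = (Matrix.gram ℝ fun k => lift (b k)).det := by
    rw [covol_sq _ b]; rfl
  rw [← h8, ← mul_pow, sq_eq_sq₀ (covol_pos _ _).le
    (mul_pos (covol_pos _ _) (covol_pos _ _)).le] at h1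
  rw [h1, mul_comm]

end OKLattice

end Compare

end ArakelovLattice
end

noncomputable section
namespace ArakelovLattice

/-! ### Reduction theory -/

section Reduction

variable {K : Type*} [Field K] [NumberField K] {P : Type*} [AddCommGroup P] [Module (𝓞 K) P]

variable (K) in
/-- A bound for the absolute values of an integral basis of `K`. -/
def basisBound : ℝ :=
  ∑ i : Free.ChooseBasisIndex ℤ (𝓞 K), ∑ v : InfinitePlace K,
    ‖v.embedding (RingOfIntegers.basis K i)‖

variable (K) in
theorem basisBound_nonneg : 0 ≤ basisBound K :=
  Finset.sum_nonneg fun _ _ => Finset.sum_nonneg fun _ _ => norm_nonneg _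

theorem norm_embedding_basis_le (v : InfinitePlace K) (i : Free.ChooseBasisIndex ℤ (𝓞 K)) :
    ‖v.embedding (RingOfIntegers.basis K i)‖ ≤ basisBound K :=
  (Finset.single_le_sum (f := fun v : InfinitePlace K =>
      ‖v.embedding (RingOfIntegers.basis K i)‖) (fun _ _ => norm_nonneg _)
      (Finset.mem_univ v)).trans
    (Finset.single_le_sum (f := fun i : Free.ChooseBasisIndex ℤ (𝓞 K) =>
      ∑ v : InfinitePlace K, ‖v.embedding (RingOfIntegers.basis K i)‖)
      (fun _ _ => Finset.sum_nonneg fun _ _ => norm_nonneg _) (Finset.mem_univ i))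

namespace OKLattice

variable (Λ : OKLattice K P)

theorem norm_sq_ambient (u : Λ.Ambient) :
    ‖u‖ ^ 2 = ∑ v, (Completion.extensionEmbedding v (Λ.innerAt v (u v) (u v))).re := by
  rw [← real_inner_self_eq_norm_sq, ambient_inner]

theorem re_innerAt_smul (v : InfinitePlace K) (c : v.Completion) (u : LocalSpace K P v) :
    (Completion.extensionEmbedding v (Λ.innerAt v (c • u) (c • u))).re =
      ‖c‖ ^ 2 * (Completion.extensionEmbedding v (Λ.innerAt v u u)).re := by
  rw [innerAt_smul_left, innerAt_smul_right, ← mul_assoc, map_mul, map_mul,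
    extensionEmbedding_conjHom, ← Complex.normSq_eq_conj_mul_self, Complex.re_ofReal_mul,
    Complex.normSq_eq_norm_sq, norm_extensionEmbedding]

/-- Multiplication by `ω_i` multiplies lengths at the place `v` by `|ω_i|_v`. Bounds for an `𝓞
K`-independent family thereby extend to the real basis `ω_i x_j`. -/
theorem norm_toAmbient_basis_smul_le (i : Free.ChooseBasisIndex ℤ (𝓞 K)) (x : P) :
    ‖Λ.toAmbient (RingOfIntegers.basis K i • x)‖ ≤ basisBound K * ‖Λ.toAmbient x‖ := by
  refine le_of_sq_le_sq ?_ (mul_nonneg (basisBound_nonneg K) (norm_nonneg _))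
  rw [mul_pow, norm_sq_ambient, norm_sq_ambient, Finset.mul_sum]
  refine Finset.sum_le_sum fun v _ => ?_
  have h : Λ.toAmbient (RingOfIntegers.basis K i • x) v =
      (algebraMap (𝓞 K) v.Completion (RingOfIntegers.basis K i)) • Λ.toAmbient x v := by
    rw [toAmbient_apply, toAmbient_apply, algebraMap_smul, TensorProduct.tmul_smul]
  rw [h, re_innerAt_smul]
  refine mul_le_mul_of_nonneg_right ?_ (Λ.re_innerAt_self_nonneg v _)
  refine pow_le_pow_left₀ (norm_nonneg _) ?_ 2
  rw [← norm_extensionEmbedding]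
  exact (congrArg norm (extensionEmbedding_algebraMap v _)).trans_le (norm_embedding_basis_le v i)

variable [Module.Finite (𝓞 K) P] [Module.IsTorsionFree (𝓞 K) P]

/-- A nonzero integral multiple of each element of `W` lies in the `𝓞 K`-span of the family, hence
in the `ℤ`-span of the `ω_i x_j`; over `ℝ` the multiple can be divided out. -/
theorem realSpan_le_span_smul {W : Submodule (𝓞 K) P} {k : ℕ} {x : Fin k → P}
    (hx : LinearIndependent (𝓞 K) x) (hxW : ∀ j, x j ∈ W) (hk : finrank (𝓞 K) W = k) :
    Λ.realSpan W ≤ Submodule.span ℝ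
      (Set.range fun q : Free.ChooseBasisIndex ℤ (𝓞 K) × Fin k =>
        Λ.toAmbient (RingOfIntegers.basis K q.1 • x q.2)) := by
  set S := Submodule.span ℝ (Set.range fun q : Free.ChooseBasisIndex ℤ (𝓞 K) × Fin k =>
        Λ.toAmbient (RingOfIntegers.basis K q.1 • x q.2)) with hS
  have h1 (s : P) (hs : s ∈ Submodule.span (𝓞 K) (Set.range x)) : Λ.toAmbient s ∈ S := by
    obtain ⟨a, rfl⟩ := (Submodule.mem_span_range_iff_exists_fun _).1 hs
    rw [map_sum]
    refine S.sum_mem fun j _ => ?_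
    rw [← (RingOfIntegers.basis K).sum_repr (a j), Finset.sum_smul, map_sum]
    refine S.sum_mem fun i _ => ?_
    rw [smul_assoc, map_zsmul, ← Int.cast_smul_eq_zsmul ℝ]
    exact S.smul_mem _ (Submodule.subset_span ⟨(i, j), rfl⟩)
  rw [realSpan, Submodule.span_le]
  rintro _ ⟨w, hw, rfl⟩
  have hle : Submodule.span (𝓞 K) (Set.range x) ≤ W :=
    Submodule.span_le.2 (by rintro _ ⟨j, rfl⟩; exact hxW j)
  have hsat := submoduleOf_saturation_eq_top hle
    (by rw [finrank_span_eq_card hx, hk, Fintype.card_fin])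
  obtain ⟨a, ha, haw⟩ : (⟨w, hw⟩ : W) ∈ saturation _ := by rw [hsat]; trivial
  obtain ⟨m, hm, c, hc⟩ := exists_int_dvd ha
  have h2 : m • w ∈ Submodule.span (𝓞 K) (Set.range x) := by
    rw [← Int.cast_smul_eq_zsmul (𝓞 K), hc, mul_comm, mul_smul]
    exact Submodule.smul_mem _ _ haw
  have h3 := h1 _ h2
  rw [map_zsmul, ← Int.cast_smul_eq_zsmul ℝ] at h3
  exact (S.smul_mem_iff (Int.cast_ne_zero.2 hm)).1 h3

end OKLattice

variable (K) in
/-- The bound for the length of a new vector in terms of the lengths of the previous ones. -/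
def stepBound (n : ℕ) (C R : ℝ) : ℝ :=
  √((finrank ℚ K * n : ℕ) * (C ^ 2 + 1)) + (finrank ℚ K * n : ℕ) * (basisBound K * R)

namespace OKLattice

variable (Λ : OKLattice K P) [Module.Finite (𝓞 K) P] [Module.IsTorsionFree (𝓞 K) P]

/-- The inductive step of the reduction. The projection of `V` orthogonal to `W` is a lattice of
covolume `covol V / covol W ≤ C`, so Minkowski's theorem gives a short nonzero vector there. Any
lift to `V` can be corrected by elements of `W` until its component along `W` is a combination of
the known short vectors with coefficients in `[0, 1)`. -/
theorem exists_short_vector {n : ℕ} (hn : finrank (𝓞 K) P ≤ n) {C R : ℝ} (hR : 0 ≤ R)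
    {W V : Submodule (𝓞 K) P} (hWV : W < V) (hW : IsSaturated W) {k : ℕ} {x : Fin k → P}
    (hx : LinearIndependent (𝓞 K) x) (hxW : ∀ j, x j ∈ W) (hk : finrank (𝓞 K) W = k)
    (hxR : ∀ j, ‖Λ.toAmbient (x j)‖ ≤ R) (hC : Λ.covol V ≤ C * Λ.covol W) :
    ∃ y ∈ V, y ∉ W ∧ ‖Λ.toAmbient y‖ ≤ stepBound K n C R := by
  have := free_quotient (A := W) (B := V) fun a x _ ha h => hW a x ha h
  have := finite_int K (V ⧸ W.submoduleOf V)
  have hPn : finrank ℤ P ≤ finrank ℚ K * n := by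
    rw [finrank_int_eq K P]; exact Nat.mul_le_mul_left _ hn
  let c := Module.finBasis ℤ (V ⧸ W.submoduleOf V)
  set m := finrank ℤ (V ⧸ W.submoduleOf V) with hm
  have hmle : m ≤ finrank ℚ K * n := by
    rw [hm, finrank_int_eq K]
    refine Nat.mul_le_mul_left _ (le_trans ?_ hn)
    exact (Submodule.finrank_quotient_le _).trans (Submodule.finrank_le V)
  have hm0 : m ≠ 0 := by
    rw [hm, finrank_int_eq K]
    refine mul_ne_zero finrank_pos.ne' fun h => ?_
    have h1 := (W.submoduleOf V).finrank_quotient_add_finrank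
    rw [h, zero_add, LinearEquiv.finrank_eq (Submodule.submoduleOfEquivOfLe hWV.le)] at h1
    exact (finrank_lt_finrank hW hWV).ne h1
  choose l hl using fun k => Submodule.Quotient.mk_surjective _ (c k)
  set y : Fin m → Λ.Ambient := fun k => Λ.orthProj W (Λ.toAmbient (l k)) with hy
  have h1 := Λ.covol_sq_eq_mul_det_gram hWV.le c y
    (fun k z hz => Λ.inner_orthProj _ _ (Λ.toAmbient_mem_realSpan hz))
    (fun k => ⟨l k, hl k, Λ.sub_orthProj_mem _ _⟩)
  have hWpos := Λ.covol_pos W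
  have hVpos := Λ.covol_pos V
  -- Adding `1` makes the inequality strict and the base at least one, so the exponent `m ≥ 1` does
  -- no harm and the bound does not depend on `m`.
  have hdet : (Matrix.gram ℝ y).det < (C ^ 2 + 1) ^ Fintype.card (Fin m) := by
    have h2 : Λ.covol V ^ 2 ≤ (C * Λ.covol W) ^ 2 := pow_le_pow_left₀ hVpos.le hC 2
    rw [h1, mul_pow, mul_comm (C ^ 2)] at h2
    have h3 : (Matrix.gram ℝ y).det ≤ C ^ 2 := le_of_mul_le_mul_left h2 (by positivity)
    rw [Fintype.card_fin]
    calc (Matrix.gram ℝ y).det < C ^ 2 + 1 := by linarith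
      _ ≤ (C ^ 2 + 1) ^ m := le_self_pow₀ (by nlinarith [sq_nonneg C]) hm0
  have hyli : LinearIndependent ℝ y := by
    rw [← Matrix.det_gram_ne_zero_iff_linearIndependent]
    intro h0
    rw [h0, mul_zero] at h1
    exact (pow_pos hVpos 2).ne' h1
  obtain ⟨z, hz0, hz⟩ := exists_int_norm_sq_le hyli (by positivity) hdet
  set w : V := ∑ k, z k • l k with hw
  have hwW : (w : P) ∉ W := by
    intro h
    have h4 : (Submodule.Quotient.mk w : V ⧸ W.submoduleOf V) = 0 :=
      (Submodule.Quotient.mk_eq_zero _).2 h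
    have h5 : (Submodule.Quotient.mk w : V ⧸ W.submoduleOf V) = ∑ k, z k • c k := by
      rw [hw, ← Submodule.mkQ_apply, map_sum]
      refine Finset.sum_congr rfl fun k _ => ?_
      rw [map_zsmul, Submodule.mkQ_apply, hl]
    rw [h5] at h4
    exact hz0 (funext (Fintype.linearIndependent_iff.1 c.linearIndependent z h4))
  have hwa : Λ.toAmbient (w : P) - ∑ k, (z k : ℝ) • y k ∈ Λ.realSpan W := by
    have h6 : Λ.toAmbient (w : P) = ∑ k, (z k : ℝ) • Λ.toAmbient (l k : P) := by
      rw [hw, Submodule.coe_sum, map_sum]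
      refine Finset.sum_congr rfl fun k _ => ?_
      rw [Int.cast_smul_eq_zsmul, ← map_zsmul Λ.toAmbient]; rfl
    rw [h6, ← Finset.sum_sub_distrib]
    refine Submodule.sum_mem _ fun k _ => ?_
    rw [← smul_sub]
    exact Submodule.smul_mem _ _ (Λ.sub_orthProj_mem _ _)
  obtain ⟨t, ht⟩ := (Submodule.mem_span_range_iff_exists_fun ℝ).1
    (Λ.realSpan_le_span_smul hx hxW hk hwa)
  -- Rounding down the coordinates along `W` gives an element of `W` whose subtraction leaves only
  -- fractional parts.
  set s : P := ∑ q : Free.ChooseBasisIndex ℤ (𝓞 K) × Fin k,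
    ⌊t q⌋ • (RingOfIntegers.basis K q.1 • x q.2) with hs
  have hsW : s ∈ W := W.sum_mem fun q _ => zsmul_mem (W.smul_mem _ (hxW _)) _
  refine ⟨w - s, V.sub_mem w.2 (hWV.le hsW), fun h => hwW ?_, ?_⟩
  · have := W.add_mem h hsW
    rwa [sub_add_cancel] at this
  · have h7 : Λ.toAmbient (w - s) = ∑ k, (z k : ℝ) • y k +
        ∑ q : Free.ChooseBasisIndex ℤ (𝓞 K) × Fin k,
          Int.fract (t q) • Λ.toAmbient (RingOfIntegers.basis K q.1 • x q.2) := by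
      rw [map_sub, sub_eq_iff_eq_add, hs, map_sum, add_assoc, ← Finset.sum_add_distrib,
        ← sub_eq_iff_eq_add', ← ht]
      refine Finset.sum_congr rfl fun q _ => ?_
      rw [map_zsmul, ← Int.cast_smul_eq_zsmul ℝ, ← add_smul, Int.fract_add_floor]
    rw [h7, stepBound]
    refine (norm_add_le _ _).trans (add_le_add ?_ ?_)
    · refine Real.le_sqrt_of_sq_le (hz.trans ?_)
      rw [Fintype.card_fin]
      refine mul_le_mul_of_nonneg_right (by exact_mod_cast hmle) (by positivity)
    · refine (norm_sum_le _ _).trans ?_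
      refine (Finset.sum_le_card_nsmul _ _ (basisBound K * R) fun q _ => ?_).trans ?_
      · rw [norm_smul, Real.norm_eq_abs, Int.abs_fract]
        refine (mul_le_of_le_one_left (norm_nonneg _) (Int.fract_lt_one _).le).trans ?_
        exact (Λ.norm_toAmbient_basis_smul_le _ _).trans
          (mul_le_mul_of_nonneg_left (hxR _) (basisBound_nonneg K))
      · rw [nsmul_eq_mul]
        refine mul_le_mul_of_nonneg_right ?_ (mul_nonneg (basisBound_nonneg K) hR)
        rw [Finset.card_univ, Fintype.card_prod, Fintype.card_fin,
          ← Module.finrank_eq_card_chooseBasisIndex, RingOfIntegers.rank]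
        have : k ≤ n := by rw [← hk]; exact (Submodule.finrank_le W).trans hn
        exact_mod_cast Nat.mul_le_mul_left _ this

end OKLattice

variable (K) in
/-- The bound for the lengths of the first `k` vectors of an adapted family. -/
def familyBound (n : ℕ) (C : ℝ) : ℕ → ℝ
  | 0 => 0
  | k + 1 => max (familyBound n C k) (stepBound K n C (familyBound n C k))

theorem familyBound_mono (n : ℕ) (C : ℝ) : Monotone (familyBound K n C) :=
  monotone_nat_of_le_succ fun _ => le_max_left _ _

theorem familyBound_nonneg (n : ℕ) (C : ℝ) (k : ℕ) : 0 ≤ familyBound K n C k :=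
  familyBound_mono n C (Nat.zero_le k)

theorem finrank_saturation_span [Module.Finite (𝓞 K) P] {k : ℕ} {x : Fin k → P}
    (hx : LinearIndependent (𝓞 K) x) :
    finrank (𝓞 K) (saturation (Submodule.span (𝓞 K) (Set.range x))) = k := by
  rw [finrank_saturation, finrank_span_eq_card hx, Fintype.card_fin]

theorem linearIndependent_snoc {k : ℕ} {x : Fin k → P} (hx : LinearIndependent (𝓞 K) x) {y : P}
    (hy : y ∉ saturation (Submodule.span (𝓞 K) (Set.range x))) :
    LinearIndependent (𝓞 K) (Fin.snoc x y : Fin (k + 1) → P) := by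
  rw [Fintype.linearIndependent_iff]
  intro a ha
  rw [Fin.sum_univ_castSucc] at ha
  simp only [Fin.snoc_castSucc, Fin.snoc_last] at ha
  have h0 : a (Fin.last k) = 0 := by
    by_contra h0
    refine hy ⟨a (Fin.last k), h0, ?_⟩
    rw [eq_neg_of_add_eq_zero_right ha]
    exact Submodule.neg_mem _ (Submodule.sum_mem _ fun j _ =>
      Submodule.smul_mem _ _ (Submodule.subset_span ⟨j, rfl⟩))
  rw [h0, zero_smul, add_zero] at ha
  have h1 := Fintype.linearIndependent_iff.1 hx _ ha
  intro i
  induction i using Fin.lastCases with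
  | last => exact h0
  | cast i => exact h1 i

namespace OKLattice

variable (Λ : OKLattice K P) [Module.Finite (𝓞 K) P] [Module.IsTorsionFree (𝓞 K) P]

/-- Short vectors adapted to a sequence of sublattices. -/
theorem exists_adapted_family {n : ℕ} (hn : finrank (𝓞 K) P ≤ n) {C : ℝ} {r : ℕ}
    (V : ℕ → Submodule (𝓞 K) P)
    (H : ∀ k < r, ∀ x : Fin k → P, LinearIndependent (𝓞 K) x → (∀ j : Fin k, x j ∈ V j) →
      saturation (Submodule.span (𝓞 K) (Set.range x)) < V k ∧
        Λ.covol (V k) ≤ C * Λ.covol (saturation (Submodule.span (𝓞 K) (Set.range x)))) :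
    ∀ k ≤ r, ∃ x : Fin k → P, LinearIndependent (𝓞 K) x ∧ (∀ j : Fin k, x j ∈ V j) ∧
      ∀ j, ‖Λ.toAmbient (x j)‖ ≤ familyBound K n C k := by
  intro k
  induction k with
  | zero => exact fun _ => ⟨Fin.elim0, linearIndependent_empty_type, fun j => j.elim0,
      fun j => j.elim0⟩
  | succ k ih =>
    intro hk
    obtain ⟨x, hx, hxV, hxR⟩ := ih (Nat.le_of_succ_le hk)
    obtain ⟨h1, h2⟩ := H k hk x hx hxV
    -- The new vector avoids the saturation of the span of the old ones, which is exactly what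
    -- independence of the extended family requires.
    obtain ⟨y, hyV, hyW, hy⟩ := Λ.exists_short_vector hn (familyBound_nonneg n C k) h1
      (isSaturated_saturation _) hx
      (fun j => le_saturation _ (Submodule.subset_span ⟨j, rfl⟩)) (finrank_saturation_span hx)
      hxR h2
    refine ⟨Fin.snoc x y, linearIndependent_snoc hx hyW, fun j => ?_, fun j => ?_⟩
    · induction j using Fin.lastCases with
      | last => simpa using hyV
      | cast j => simpa using hxV j
    · induction j using Fin.lastCases with
      | last => rw [Fin.snoc_last]; exact hy.trans (le_max_right _ _)
      | cast j => rw [Fin.snoc_castSucc]; exact (hxR j).trans (le_max_left _ _)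

/-! ### Discreteness of a lattice and finiteness of its sublattices -/

theorem toAmbient_injective : Function.Injective Λ.toAmbient := by
  have := finite_int K P
  have := free_int K P
  let b := Module.finBasis ℤ P
  rw [injective_iff_map_eq_zero]
  intro x hx
  rw [← b.sum_repr x, map_sum] at hx
  simp_rw [map_zsmul, ← Int.cast_smul_eq_zsmul ℝ] at hx
  have h := Fintype.linearIndependent_iff.1 (Λ.linearIndependent_toAmbient b) _ hx
  rw [← b.sum_repr x]
  exact Finset.sum_eq_zero fun i _ => by rw [Int.cast_eq_zero.1 (h i), zero_smul]

theorem finite_norm_le (R : ℝ) : {x : P | ‖Λ.toAmbient x‖ ≤ R}.Finite := by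
  have := finite_int K P
  have := free_int K P
  let b := Module.finBasis ℤ P
  let e : Basis _ ℝ Λ.Ambient := Basis.mk (Λ.linearIndependent_toAmbient b)
    (Λ.span_range_toAmbient_basis b).ge
  have hfin := ZSpan.setFinite_inter e (Metric.isBounded_closedBall (x := (0 : Λ.Ambient)) (r := R))
  refine Set.Finite.of_finite_image (hfin.subset ?_) Λ.toAmbient_injective.injOn
  rintro _ ⟨x, hx, rfl⟩
  refine ⟨by simpa using hx, ?_⟩
  rw [← b.sum_repr x, map_sum]
  refine Submodule.sum_mem _ fun i _ => ?_
  rw [map_zsmul]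
  exact Submodule.smul_mem _ _ (Submodule.subset_span ⟨i, Basis.mk_apply _ _ _⟩)

theorem exists_norm_sq_gt : ∃ ε : ℝ, 0 < ε ∧ ∀ x : P, x ≠ 0 → ε < ‖Λ.toAmbient x‖ ^ 2 := by
  by_cases hne : ({x : P | ‖Λ.toAmbient x‖ ≤ 1} \ {0}).Nonempty
  · obtain ⟨x₀, hx₀, hmin⟩ := Set.exists_min_image _ (fun x => ‖Λ.toAmbient x‖ ^ 2)
      ((Λ.finite_norm_le 1).sdiff (t := {0})) hne
    have h0 : 0 < ‖Λ.toAmbient x₀‖ ^ 2 := by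
      have : Λ.toAmbient x₀ ≠ 0 := fun h =>
        hx₀.2 (Λ.toAmbient_injective (h.trans (map_zero _).symm))
      positivity
    refine ⟨‖Λ.toAmbient x₀‖ ^ 2 / 2, by positivity, fun x hx => ?_⟩
    by_cases h1 : ‖Λ.toAmbient x‖ ≤ 1
    · exact (half_lt_self h0).trans_le (hmin x ⟨h1, hx⟩)
    · have h2 : ‖Λ.toAmbient x₀‖ ^ 2 ≤ 1 := pow_le_one₀ (norm_nonneg _) hx₀.1
      have h3 : 1 < ‖Λ.toAmbient x‖ ^ 2 := one_lt_pow₀ (not_le.1 h1) two_ne_zero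
      linarith
  · refine ⟨1, one_pos, fun x hx => ?_⟩
    by_contra h
    refine hne ⟨x, ?_, hx⟩
    by_contra h1
    exact h (one_lt_pow₀ (not_le.1 h1) two_ne_zero)

/-- The covolumes of the sublattices of a lattice are bounded below. -/
theorem exists_le_covol : ∃ δ : ℝ, 0 < δ ∧ ∀ N : Submodule (𝓞 K) P, δ ≤ Λ.covol N := by
  obtain ⟨ε, hε, h⟩ := Λ.exists_norm_sq_gt
  set M := finrank ℤ P
  -- If the squared covolume of `N` were below `A ^ M`, Minkowski's theorem would give a nonzero
  -- vector of squared norm at most `M * A < ε`. The minimum with `1` makes `A ^ M` at most `A ^ rk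
  -- N`.
  set A : ℝ := min 1 (ε / (M + 1)) with hA
  have hA0 : 0 < A := lt_min one_pos (by positivity)
  refine ⟨√(A ^ M), Real.sqrt_pos.2 (by positivity), fun N => ?_⟩
  refine Real.sqrt_le_iff.2 ⟨(Λ.covol_pos N).le, ?_⟩
  have := finite_int K P
  have := finite_int K N
  have := free_int K N
  let b := Module.finBasis ℤ N
  have hmM : finrank ℤ N ≤ M :=
    LinearMap.finrank_le_finrank_of_injective (f := (N.restrictScalars ℤ).subtype)
      (Submodule.injective_subtype _)
  rw [Λ.covol_sq b]
  by_contra hlt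
  push Not at hlt
  have h1 : (Matrix.gram ℝ fun i => Λ.toAmbient (b i : P)).det <
      A ^ Fintype.card (Fin (finrank ℤ N)) := by
    rw [Fintype.card_fin]
    exact hlt.trans_le (pow_le_pow_of_le_one hA0.le (min_le_left _ _) hmM)
  obtain ⟨z, hz0, hz⟩ := exists_int_norm_sq_le (Λ.linearIndependent_toAmbient_coe b) hA0 h1
  set x : N := ∑ i, z i • b i with hx
  have hx0 : (x : P) ≠ 0 := by
    intro h0
    have h2 : x = 0 := Subtype.ext h0
    exact hz0 (funext (Fintype.linearIndependent_iff.1 b.linearIndependent z h2))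
  have h3 : Λ.toAmbient (x : P) = ∑ i, (z i : ℝ) • Λ.toAmbient (b i : P) := by
    rw [hx, Submodule.coe_sum, map_sum]
    refine Finset.sum_congr rfl fun k _ => ?_
    rw [Int.cast_smul_eq_zsmul, ← map_zsmul Λ.toAmbient]; rfl
  have h4 := h x hx0
  rw [h3] at h4
  have h5 : (Fintype.card (Fin (finrank ℤ N)) : ℝ) * A ≤ M * (ε / (M + 1)) := by
    rw [Fintype.card_fin]
    exact mul_le_mul (by exact_mod_cast hmM) (min_le_right _ _) hA0.le (by positivity)
  have h6 : (M : ℝ) * (ε / (M + 1)) < ε := by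
    rw [← mul_div_assoc, div_lt_iff₀ (by positivity)]
    nlinarith
  linarith

theorem covol_top : Λ.covol ⊤ = Λ.volLeb := by
  have := finite_int K P
  have := free_int K P
  let b := Module.finBasis ℤ P
  have h : Λ.covol ⊤ ^ 2 = Λ.volLeb ^ 2 := by
    rw [Λ.covol_sq (b.map (Submodule.topEquiv.symm.restrictScalars ℤ)), Λ.volLeb_sq b]
    rfl
  exact (sq_eq_sq₀ (covol_pos _ _).le (volLeb_pos _).le).1 h

/-- There are only finitely many saturated sublattices of bounded covolume. -/
theorem finite_saturated_covol_le (c : ℝ) :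
    {N : Submodule (𝓞 K) P | IsSaturated N ∧ Λ.covol N ≤ c}.Finite := by
  obtain ⟨δ, hδ, hδN⟩ := Λ.exists_le_covol
  set n := finrank (𝓞 K) P with hn
  set R := familyBound K n (c / δ) n
  have hfin := (Λ.finite_norm_le R).finite_subsets
  -- Each `N` is the saturation of the span of short vectors of its own, and a finite set of short
  -- vectors has only finitely many subsets. The ratio `c / δ` compares `N` with any of its
  -- sublattices.
  refine (hfin.image fun T => saturation (Submodule.span (𝓞 K) T)).subset ?_
  rintro N ⟨hN, hNc⟩
  have hc : 0 < c := (Λ.covol_pos N).trans_le hNc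
  have hNn : finrank (𝓞 K) N ≤ n := Submodule.finrank_le N
  obtain ⟨x, hx, -, hxR⟩ := (Λ.restrict N).exists_adapted_family hNn (C := c / δ)
    (r := finrank (𝓞 K) N) (fun _ => ⊤) (fun k hk x hx _ => by
      refine ⟨lt_top_iff_ne_top.2 fun h => ?_, ?_⟩
      · have h1 := finrank_saturation_span hx
        rw [h, finrank_top] at h1
        omega
      · rw [covol_restrict, covol_restrict, Submodule.map_subtype_top]
        refine hNc.trans ?_
        rw [div_mul_eq_mul_div, le_div_iff₀ hδ]
        exact mul_le_mul_of_nonneg_left (hδN _) hc.le) _ le_rfl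
  refine ⟨Set.range fun j => (x j : P), ?_, ?_⟩
  · rintro _ ⟨j, rfl⟩
    exact (hxR j).trans (familyBound_mono n _ hNn)
  · have hx' : LinearIndependent (𝓞 K) fun j => (x j : P) :=
      hx.map' N.subtype N.ker_subtype
    refine eq_of_le_of_finrank_eq (isSaturated_saturation _) (saturation_le hN ?_) ?_
    · rw [Submodule.span_le]
      rintro _ ⟨j, rfl⟩
      exact (x j).2
    · exact finrank_saturation_span hx'

/-- The contribution of the discriminant and of the complex places to the degree, per rank. -/
theorem deg_restrict (N : Submodule (𝓞 K) P) :
    (Λ.restrict N).deg = finrank (𝓞 K) N *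
      (Real.log |(discr K : ℝ)| / 2 - nrComplexPlaces K * Real.log 2) -
        Real.log (Λ.covol N) := by
  rw [deg, vol, Real.log_mul (by positivity) (volLeb_pos _).ne', Real.log_pow, covol]
  push_cast
  ring

end OKLattice

end Reduction

end ArakelovLattice
end

noncomputable section
namespace ArakelovLattice

/-! ### Interpolation -/

section Interpolate

theorem exists_mem_Icc_succ {n : ℕ} {x : Fin (n + 1) → ℝ} {s : ℝ}
    (hs : s ∈ Set.Icc (x 0) (x (Fin.last n))) :
    s = x (Fin.last n) ∨ ∃ k : Fin n, s ∈ Set.Icc (x k.castSucc) (x k.succ) := by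
  induction n with
  | zero => exact Or.inl (le_antisymm hs.2 hs.1)
  | succ n ih =>
    rcases le_total s (x (Fin.last n).castSucc) with h | h
    · rcases ih (x := fun i => x i.castSucc) ⟨hs.1, h⟩ with h1 | ⟨k, hk⟩
      · exact Or.inr ⟨Fin.last n, h1.ge, by rw [Fin.succ_last]; exact hs.2⟩
      · exact Or.inr ⟨k.castSucc, hk⟩
    · exact Or.inr ⟨Fin.last n, h, by rw [Fin.succ_last]; exact hs.2⟩

theorem interpolate_apply {n : ℕ} {x : Fin (n + 1) → ℝ} (hx : StrictMono x)
    (y : Fin (n + 1) → ℝ) (i : Fin (n + 1)) : interpolate x y (x i) = y i := by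
  induction i using Fin.lastCases with
  | last => exact interpolate_of_last_le hx y le_rfl
  | cast k =>
    rw [interpolate_of_mem hx y k ⟨le_rfl, (hx Fin.castSucc_lt_succ).le⟩]
    ring

/-- On each segment the value is a convex combination of the values at the two ends. -/
theorem interpolate_le_of_forall_le {n : ℕ} {x : Fin (n + 1) → ℝ} (hx : StrictMono x)
    {y : Fin (n + 1) → ℝ} {a b : ℝ} (h : ∀ i, y i ≤ a * x i + b) {s : ℝ}
    (hs : s ∈ Set.Icc (x 0) (x (Fin.last n))) : interpolate x y s ≤ a * s + b := by
  rcases exists_mem_Icc_succ hs with rfl | ⟨k, hk⟩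
  · rw [interpolate_apply hx]
    exact h _
  · rw [interpolate_of_mem hx y k hk]
    have hlt : 0 < x k.succ - x k.castSucc := sub_pos.2 (hx Fin.castSucc_lt_succ)
    have h1 := h k.castSucc
    have h2 := h k.succ
    have h3 : (y k.succ - y k.castSucc) / (x k.succ - x k.castSucc) * (s - x k.castSucc) =
        (y k.succ - y k.castSucc) * (s - x k.castSucc) / (x k.succ - x k.castSucc) := by ring
    rw [h3, ← sub_nonneg]
    have h4 : a * s + b - (y k.castSucc + (y k.succ - y k.castSucc) * (s - x k.castSucc) /
        (x k.succ - x k.castSucc)) =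
        ((a * x k.castSucc + b - y k.castSucc) * (x k.succ - s) +
          (a * x k.succ + b - y k.succ) * (s - x k.castSucc)) / (x k.succ - x k.castSucc) := by
      field_simp
      ring
    rw [h4]
    exact div_nonneg (add_nonneg (mul_nonneg (sub_nonneg.2 h1) (sub_nonneg.2 hk.2))
      (mul_nonneg (sub_nonneg.2 h2) (sub_nonneg.2 hk.1))) hlt.le

end Interpolate

/-! ### Degrees of sublattices -/

section Degree

namespace OKLattice

section Compare

variable {K : Type*} [Field K] [NumberField K]
variable {P : Type*} [AddCommGroup P] [Module (𝓞 K) P] [Module.Finite (𝓞 K) P]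
  [Module.IsTorsionFree (𝓞 K) P]
variable {Q : Type*} [AddCommGroup Q] [Module (𝓞 K) Q] [Module.Finite (𝓞 K) Q]
  [Module.IsTorsionFree (𝓞 K) Q]

theorem vol_pos (Λ : OKLattice K P) : 0 < Λ.vol := mul_pos (by positivity) Λ.volLeb_pos

theorem log_vol (Λ : OKLattice K P) :
    Real.log Λ.vol = (finrank (𝓞 K) P : ℝ) / 2 * Real.log |(discr K : ℝ)| - Λ.deg := by
  rw [deg]; ring

/-- After taking logarithms both sides carry the same discriminant term, proportional to the product
of the ranks, and it cancels. -/
theorem vol_pow_le_iff (Λ : OKLattice K P) (M : OKLattice K Q) :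
    Λ.vol ^ finrank (𝓞 K) Q ≤ M.vol ^ finrank (𝓞 K) P ↔
      finrank (𝓞 K) P * M.deg ≤ finrank (𝓞 K) Q * Λ.deg := by
  rw [← Real.log_le_log_iff (pow_pos Λ.vol_pos _) (pow_pos M.vol_pos _), Real.log_pow,
    Real.log_pow, log_vol, log_vol, ← sub_nonneg, ← sub_nonneg (b := (finrank (𝓞 K) P : ℝ) * _)]
  apply Iff.of_eq
  congr 1
  ring

theorem vol_pow_lt_iff (Λ : OKLattice K P) (M : OKLattice K Q) :
    Λ.vol ^ finrank (𝓞 K) Q < M.vol ^ finrank (𝓞 K) P ↔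
      finrank (𝓞 K) P * M.deg < finrank (𝓞 K) Q * Λ.deg := by
  rw [← not_le, ← not_le, vol_pow_le_iff]

end Compare

variable {K : Type*} [Field K] [NumberField K]
variable {P : Type*} [AddCommGroup P] [Module (𝓞 K) P] [Module.Finite (𝓞 K) P]
  [Module.IsTorsionFree (𝓞 K) P] (Λ : OKLattice K P)

/-- The degree of the sublattice with underlying module `N`. -/
def degAt (N : Submodule (𝓞 K) P) : ℝ := (Λ.restrict N).deg

theorem degAt_top : Λ.degAt ⊤ = Λ.deg := by
  rw [degAt, deg_restrict, covol_top, finrank_top, deg, vol,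
    Real.log_mul (by positivity) (volLeb_pos _).ne', Real.log_pow]
  push_cast
  ring

/-- The logarithm of the parallelogram inequality; the rank terms balance by the rank formula for
sum and intersection. -/
theorem degAt_add_degAt_le {A B : Submodule (𝓞 K) P} (hB : IsSaturated B) :
    Λ.degAt A + Λ.degAt B ≤ Λ.degAt (A ⊔ B) + Λ.degAt (A ⊓ B) := by
  have h := Real.log_le_log (mul_pos (Λ.covol_pos _) (Λ.covol_pos _))
    (Λ.covol_sup_mul_covol_inf_le (A := A) hB)
  rw [Real.log_mul (Λ.covol_pos _).ne' (Λ.covol_pos _).ne',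
    Real.log_mul (Λ.covol_pos _).ne' (Λ.covol_pos _).ne'] at h
  have h1 : (finrank (𝓞 K) ↥(A ⊔ B) : ℝ) + finrank (𝓞 K) ↥(A ⊓ B) =
      finrank (𝓞 K) A + finrank (𝓞 K) B := by exact_mod_cast finrank_sup_add_finrank_inf A B
  simp only [degAt, deg_restrict]
  set c := Real.log |(discr K : ℝ)| / 2 - nrComplexPlaces K * Real.log 2
  have h2 : (finrank (𝓞 K) ↥(A ⊔ B) : ℝ) * c + finrank (𝓞 K) ↥(A ⊓ B) * c =
      finrank (𝓞 K) A * c + finrank (𝓞 K) B * c := by rw [← add_mul, h1, add_mul]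
  linarith

theorem degAt_le_degAt_saturation (N : Submodule (𝓞 K) P) :
    Λ.degAt N ≤ Λ.degAt (saturation N) := by
  have h := Real.log_le_log (Λ.covol_pos _)
    (Λ.covol_le_of_le (le_saturation N) (finrank_saturation N).symm)
  simp only [degAt, deg_restrict, finrank_saturation]
  linarith

theorem isSaturated_submoduleOf {A : Submodule (𝓞 K) P} (hA : IsSaturated A)
    (B : Submodule (𝓞 K) P) : IsSaturated (A.submoduleOf B) :=
  fun a x ha hx => hA a x ha hx

theorem map_subtype_comap_mkQ_le (A B : Submodule (𝓞 K) P)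
    (N : Submodule (𝓞 K) (B ⧸ A.submoduleOf B)) :
    (N.comap (A.submoduleOf B).mkQ).map B.subtype ≤ B := by
  rintro _ ⟨x, -, rfl⟩
  exact x.2

theorem le_map_subtype_comap_mkQ {A B : Submodule (𝓞 K) P} (hAB : A ≤ B)
    (N : Submodule (𝓞 K) (B ⧸ A.submoduleOf B)) :
    A ≤ (N.comap (A.submoduleOf B).mkQ).map B.subtype := by
  intro x hx
  refine ⟨⟨x, hAB hx⟩, ?_, rfl⟩
  change (Submodule.Quotient.mk _ : B ⧸ A.submoduleOf B) ∈ N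
  rw [(Submodule.Quotient.mk_eq_zero (A.submoduleOf B)).2 hx]
  exact zero_mem _

theorem finrank_map_subtype_comap_mkQ {A B : Submodule (𝓞 K) P} (hAB : A ≤ B)
    (N : Submodule (𝓞 K) (B ⧸ A.submoduleOf B)) :
    finrank (𝓞 K) N + finrank (𝓞 K) A =
      finrank (𝓞 K) ((N.comap (A.submoduleOf B).mkQ).map B.subtype) := by
  have hle := le_map_subtype_comap_mkQ hAB N
  set M := (N.comap (A.submoduleOf B).mkQ).map B.subtype with hM
  let f : M →ₗ[𝓞 K] B ⧸ A.submoduleOf B :=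
    (A.submoduleOf B).mkQ ∘ₗ Submodule.inclusion (map_subtype_comap_mkQ_le A B N)
  have hr : LinearMap.range f = N := by
    ext y
    constructor
    · rintro ⟨⟨_, x, hx, rfl⟩, rfl⟩
      exact hx
    · intro hy
      obtain ⟨x, rfl⟩ := Submodule.Quotient.mk_surjective _ y
      exact ⟨⟨x, x, hy, rfl⟩, rfl⟩
  have hk : LinearMap.ker f = A.submoduleOf M := by
    ext x
    rw [LinearMap.mem_ker]
    exact Submodule.Quotient.mk_eq_zero (A.submoduleOf B)
  have h1 := (LinearMap.ker f).finrank_quotient_add_finrank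
  rw [f.quotKerEquivRange.finrank_eq, hr, hk, (Submodule.submoduleOfEquivOfLe hle).finrank_eq] at h1
  exact h1

theorem map_subtype_submoduleOf {A B : Submodule (𝓞 K) P} (hAB : A ≤ B) :
    (A.submoduleOf B).map B.subtype = A := by
  rw [Submodule.submoduleOf, Submodule.map_comap_subtype, inf_eq_right.2 hAB]

theorem finrank_quotient_submoduleOf {A B : Submodule (𝓞 K) P} (hAB : A ≤ B) :
    finrank (𝓞 K) (B ⧸ A.submoduleOf B) + finrank (𝓞 K) A = finrank (𝓞 K) B := by
  rw [← (A.submoduleOf B).finrank_quotient_add_finrank,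
    (Submodule.submoduleOfEquivOfLe hAB).finrank_eq]

theorem degAt_subquotient {A B : Submodule (𝓞 K) P} (hA : IsSaturated A) (hAB : A ≤ B)
    (N : Submodule (𝓞 K) (B ⧸ A.submoduleOf B)) :
    ((Λ.subquotient A B).restrict N).deg =
      Λ.degAt ((N.comap (A.submoduleOf B).mkQ).map B.subtype) - Λ.degAt A := by
  have htf : Module.IsTorsionFree (𝓞 K) (B ⧸ A.submoduleOf B) :=
    isTorsionFree_quotient_iff.2 (isSaturated_submoduleOf hA B)
  have h1 := (Λ.restrict B).covol_quotient_mul (isSaturated_submoduleOf hA B) N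
  rw [covol_restrict, covol_restrict, map_subtype_submoduleOf hAB] at h1
  have h2 : (finrank (𝓞 K) N : ℝ) + finrank (𝓞 K) A =
      finrank (𝓞 K) ((N.comap (A.submoduleOf B).mkQ).map B.subtype) := by
    exact_mod_cast finrank_map_subtype_comap_mkQ hAB N
  rw [degAt, degAt, deg_restrict, deg_restrict, deg_restrict, ← h2]
  rw [← h1, Real.log_mul (covol_pos _ _).ne' (covol_pos _ _).ne', subquotient]
  ring

theorem deg_subquotient {A B : Submodule (𝓞 K) P} (hA : IsSaturated A) (hAB : A ≤ B) :
    (Λ.subquotient A B).deg = Λ.degAt B - Λ.degAt A := by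
  have htf : Module.IsTorsionFree (𝓞 K) (B ⧸ A.submoduleOf B) :=
    isTorsionFree_quotient_iff.2 (isSaturated_submoduleOf hA B)
  have h := Λ.degAt_subquotient hA hAB ⊤
  rw [Submodule.comap_top, Submodule.map_top, Submodule.range_subtype] at h
  rw [← h]
  exact (degAt_top _).symm

/-- Semi-stability of a subquotient in terms of degrees and ranks. -/
theorem isSemistable_subquotient_iff {A B : Submodule (𝓞 K) P} (hA : IsSaturated A)
    (hB : IsSaturated B) (hAB : A ≤ B) :
    (Λ.subquotient A B).IsSemistable ↔ ∀ N : Submodule (𝓞 K) P, IsSaturated N → A ≤ N → N ≤ B →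
      ((finrank (𝓞 K) B : ℝ) - finrank (𝓞 K) A) * (Λ.degAt N - Λ.degAt A) ≤
        ((finrank (𝓞 K) N : ℝ) - finrank (𝓞 K) A) * (Λ.degAt B - Λ.degAt A) := by
  have htf : Module.IsTorsionFree (𝓞 K) (B ⧸ A.submoduleOf B) :=
    isTorsionFree_quotient_iff.2 (isSaturated_submoduleOf hA B)
  have hrB : (finrank (𝓞 K) (B ⧸ A.submoduleOf B) : ℝ) =
      (finrank (𝓞 K) B : ℝ) - finrank (𝓞 K) A := by
    rw [← finrank_quotient_submoduleOf hAB]; push_cast; ring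
  constructor
  · intro h N hN hAN hNB
    by_cases hNB' : N = B
    · rw [hNB']
    -- Saturated submodules of `B / A` correspond to saturated submodules of `P` between `A` and
    -- `B`; here `N'` is the image of `N`.
    set N' := (N.submoduleOf B).map (A.submoduleOf B).mkQ with hN'
    have hcomap : N'.comap (A.submoduleOf B).mkQ = N.submoduleOf B := by
      rw [hN', Submodule.comap_map_mkQ, sup_eq_right]
      exact fun x hx => hAN hx
    have hmap : (N'.comap (A.submoduleOf B).mkQ).map B.subtype = N := by
      rw [hcomap, map_subtype_submoduleOf hNB]
    have hsat : IsSaturated N' := by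
      intro a y ha hy
      obtain ⟨x, rfl⟩ := Submodule.Quotient.mk_surjective _ y
      have h1 : a • x ∈ N'.comap (A.submoduleOf B).mkQ := hy
      rw [hcomap] at h1
      have h2 : x ∈ N'.comap (A.submoduleOf B).mkQ := by
        rw [hcomap]
        exact hN a x ha h1
      exact h2
    have htop : N' ≠ ⊤ := by
      intro h1
      apply hNB'
      rw [← hmap, h1, Submodule.comap_top, Submodule.map_top, Submodule.range_subtype]
    have h1 := h N' (projective_quotient_iff.2 hsat) htop
    rw [vol_pow_le_iff, Λ.degAt_subquotient hA hAB, hmap, Λ.deg_subquotient hA hAB, hrB] at h1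
    have h2 := finrank_map_subtype_comap_mkQ hAB N'
    rw [hmap] at h2
    have h3 : (finrank (𝓞 K) N' : ℝ) = (finrank (𝓞 K) N : ℝ) - finrank (𝓞 K) A := by
      rw [← h2]; push_cast; ring
    rwa [h3] at h1
  · intro h N hN _
    rw [projective_quotient_iff] at hN
    have h1 := h ((N.comap (A.submoduleOf B).mkQ).map B.subtype) ?_
      (le_map_subtype_comap_mkQ hAB N) (map_subtype_comap_mkQ_le A B N)
    · rw [vol_pow_le_iff, Λ.degAt_subquotient hA hAB, Λ.deg_subquotient hA hAB, hrB]
      have h2 := finrank_map_subtype_comap_mkQ hAB N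
      rw [← h2] at h1
      push_cast at h1
      rwa [add_sub_cancel_right] at h1
    · rintro a x ha ⟨y, hy, hyx⟩
      have hx : x ∈ B := hB a x ha (hyx ▸ y.2)
      refine ⟨⟨x, hx⟩, hN a _ ha ?_, rfl⟩
      have : y = a • (⟨x, hx⟩ : B) := Subtype.ext hyx
      rw [this] at hy
      exact hy

/-- The slope of `B / A`. -/
def slope (A B : Submodule (𝓞 K) P) : ℝ :=
  (Λ.degAt B - Λ.degAt A) / ((finrank (𝓞 K) B : ℝ) - finrank (𝓞 K) A)

theorem finrank_sub_pos {A B : Submodule (𝓞 K) P} (hA : IsSaturated A) (hAB : A < B) :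
    0 < (finrank (𝓞 K) B : ℝ) - finrank (𝓞 K) A :=
  sub_pos.2 (by exact_mod_cast finrank_lt_finrank hA hAB)

theorem degAt_eq_add_slope {A B : Submodule (𝓞 K) P} (hA : IsSaturated A) (hAB : A < B) :
    Λ.degAt B = Λ.degAt A + Λ.slope A B * ((finrank (𝓞 K) B : ℝ) - finrank (𝓞 K) A) := by
  rw [slope, div_mul_cancel₀ _ (finrank_sub_pos hA hAB).ne']
  ring

/-- Translates the volume condition between consecutive quotients into strict decrease of slopes,
that is, strict concavity of the degree polygon. -/
theorem subquotient_vol_pow_lt_iff {A B C : Submodule (𝓞 K) P} (hA : IsSaturated A)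
    (hB : IsSaturated B) (hAB : A < B) (hBC : B < C) :
    (Λ.subquotient A B).vol ^ finrank (𝓞 K) (C ⧸ B.submoduleOf C) <
        (Λ.subquotient B C).vol ^ finrank (𝓞 K) (B ⧸ A.submoduleOf B) ↔
      Λ.slope B C < Λ.slope A B := by
  have htf : Module.IsTorsionFree (𝓞 K) (B ⧸ A.submoduleOf B) :=
    isTorsionFree_quotient_iff.2 (isSaturated_submoduleOf hA B)
  have htf' : Module.IsTorsionFree (𝓞 K) (C ⧸ B.submoduleOf C) :=
    isTorsionFree_quotient_iff.2 (isSaturated_submoduleOf hB C)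
  rw [vol_pow_lt_iff, Λ.deg_subquotient hA hAB.le, Λ.deg_subquotient hB hBC.le, slope, slope,
    div_lt_div_iff₀ (finrank_sub_pos hB hBC) (finrank_sub_pos hA hAB)]
  rw [← finrank_quotient_submoduleOf hAB.le, ← finrank_quotient_submoduleOf hBC.le]
  push_cast
  rw [add_sub_cancel_right, ← finrank_quotient_submoduleOf hAB.le]
  push_cast
  rw [add_sub_cancel_right, mul_comm, mul_comm (finrank (𝓞 K) (C ⧸ B.submoduleOf C) : ℝ)]

/-- `B` is the maximal among the saturated submodules above `A` of maximal slope over `A`. -/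
structure IsNext (A B : Submodule (𝓞 K) P) : Prop where
  lt : A < B
  saturated : IsSaturated B
  slope_le : ∀ N, IsSaturated N → A < N → Λ.slope A N ≤ Λ.slope A B
  slope_lt : ∀ N, IsSaturated N → B < N → Λ.slope A N < Λ.slope A B

/-! ### Existence of the canonical filtration -/

theorem finite_le_degAt (c : ℝ) :
    {N : Submodule (𝓞 K) P | IsSaturated N ∧ c ≤ Λ.degAt N}.Finite := by
  set e := Real.log |(discr K : ℝ)| / 2 - nrComplexPlaces K * Real.log 2 with he
  refine (Λ.finite_saturated_covol_le
    (Real.exp (finrank (𝓞 K) P * |e| - c))).subset ?_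
  rintro N ⟨hN, hc⟩
  refine ⟨hN, ?_⟩
  rw [← Real.log_le_iff_le_exp (Λ.covol_pos N)]
  rw [degAt, deg_restrict, ← he] at hc
  have h1 : (finrank (𝓞 K) N : ℝ) * e ≤ finrank (𝓞 K) P * |e| :=
    (mul_le_mul_of_nonneg_left (le_abs_self e) (by positivity)).trans
      (mul_le_mul_of_nonneg_right (by exact_mod_cast Submodule.finrank_le N) (abs_nonneg e))
  linarith

/-- Only finitely many sublattices above `A` have slope at least that of `⊤`, so the maximal slope
is attained, and among those attaining it one of largest rank can be chosen. -/
theorem exists_isNext {A : Submodule (𝓞 K) P} (hA : IsSaturated A) (hAtop : A ≠ ⊤) :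
    ∃ B, Λ.IsNext A B := by
  set S := {N : Submodule (𝓞 K) P | IsSaturated N ∧ A < N ∧ Λ.slope A ⊤ ≤ Λ.slope A N} with hS
  have hfin : S.Finite := by
    refine (Λ.finite_le_degAt (Λ.degAt A - |Λ.slope A ⊤| * finrank (𝓞 K) P)).subset ?_
    rintro N ⟨hN, hAN, h⟩
    refine ⟨hN, ?_⟩
    rw [Λ.degAt_eq_add_slope hA hAN]
    have h1 := (finrank_sub_pos hA hAN).le
    have h2 : (finrank (𝓞 K) N : ℝ) ≤ finrank (𝓞 K) P := by
      exact_mod_cast Submodule.finrank_le N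
    have h3 : (0 : ℝ) ≤ finrank (𝓞 K) A := by positivity
    have h4 := neg_abs_le (Λ.slope A ⊤)
    have h5 : -|Λ.slope A ⊤| * ((finrank (𝓞 K) N : ℝ) - finrank (𝓞 K) A) ≤
        Λ.slope A N * ((finrank (𝓞 K) N : ℝ) - finrank (𝓞 K) A) :=
      mul_le_mul_of_nonneg_right (h4.trans h) h1
    have h6 : |Λ.slope A ⊤| * ((finrank (𝓞 K) N : ℝ) - finrank (𝓞 K) A) ≤
        |Λ.slope A ⊤| * finrank (𝓞 K) P :=
      mul_le_mul_of_nonneg_left (by linarith) (abs_nonneg _)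
    linarith
  have hne : S.Nonempty := ⟨⊤, isSaturated_top, lt_top_iff_ne_top.2 hAtop, le_rfl⟩
  -- The lexicographic order maximizes the slope first and the rank second. A strictly larger
  -- saturated submodule has larger rank, so it cannot have the same slope.
  obtain ⟨B, ⟨hB, hAB, hB1⟩, hmax⟩ := S.exists_max_image
    (fun N => toLex (Λ.slope A N, finrank (𝓞 K) N)) hfin hne
  have hle : ∀ N, IsSaturated N → A < N → Λ.slope A N ≤ Λ.slope A B := by
    intro N hN hAN
    by_contra hlt
    rw [not_le] at hlt
    rcases Prod.Lex.le_iff.1 (hmax N ⟨hN, hAN, hB1.trans hlt.le⟩) with h | h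
    · exact absurd h (not_lt.2 hlt.le)
    · exact hlt.ne' h.1
  refine ⟨B, hAB, hB, hle, fun N hN hBN => lt_of_le_of_ne (hle N hN (hAB.trans hBN)) fun h => ?_⟩
  rcases Prod.Lex.le_iff.1 (hmax N ⟨hN, hAB.trans hBN, hB1.trans h.ge⟩) with h1 | h1
  · exact absurd h1 (not_lt.2 h.ge)
  · exact absurd h1.2 (not_le.2 (finrank_lt_finrank hB hBN))

/-- The slope of `C / A` is a weighted mean of those of `B / A` and `C / B`; as it is smaller than
the former, so is the latter. -/
theorem IsNext.slope_lt_slope {A B C : Submodule (𝓞 K) P} (hA : IsSaturated A)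
    (h : Λ.IsNext A B) (h' : Λ.IsNext B C) : Λ.slope B C < Λ.slope A B := by
  have h1 := h.slope_lt C h'.saturated h'.lt
  have h2 := finrank_sub_pos hA h.lt
  have h3 := finrank_sub_pos h.saturated h'.lt
  have h4 := Λ.degAt_eq_add_slope hA h.lt
  have h5 := Λ.degAt_eq_add_slope h.saturated h'.lt
  have h6 := Λ.degAt_eq_add_slope hA (h.lt.trans h'.lt)
  have h7 := mul_lt_mul_of_pos_right h1 (finrank_sub_pos hA (h.lt.trans h'.lt))
  have h8 : Λ.slope B C * ((finrank (𝓞 K) C : ℝ) - finrank (𝓞 K) B) <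
      Λ.slope A B * ((finrank (𝓞 K) C : ℝ) - finrank (𝓞 K) B) := by
    linarith
  exact lt_of_mul_lt_mul_right h8 h3.le

theorem exists_isNext_chain (A : Submodule (𝓞 K) P) (hA : IsSaturated A) :
    ∃ (n : ℕ) (F : Fin (n + 1) → Submodule (𝓞 K) P), F 0 = A ∧ F (Fin.last n) = ⊤ ∧
      ∀ i : Fin n, Λ.IsNext (F i.castSucc) (F i.succ) := by
  induction hk : finrank (𝓞 K) P - finrank (𝓞 K) A using Nat.strong_induction_on generalizing A with
  | _ k ih =>
    by_cases hAtop : A = ⊤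
    · exact ⟨0, fun _ => A, rfl, hAtop, fun i => i.elim0⟩
    · obtain ⟨B, hB⟩ := Λ.exists_isNext hA hAtop
      have h1 := finrank_lt_finrank hA hB.lt
      have h2 := Submodule.finrank_le B
      obtain ⟨n, F, hF0, hFl, hF⟩ := ih _ (by omega) B hB.saturated rfl
      refine ⟨n + 1, Fin.cons A F, rfl, ?_, ?_⟩
      · rw [← Fin.succ_last, Fin.cons_succ, hFl]
      · intro i
        induction i using Fin.cases with
        | zero =>
          rw [Fin.cons_succ, Fin.castSucc_zero, Fin.cons_zero, hF0]
          exact hB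
        | succ i =>
          rw [Fin.cons_succ, Fin.castSucc_succ, Fin.cons_succ]
          exact hF i

/-- In the chain of maximal destabilizing steps, maximality of the slope gives semi-stability of the
quotients, and maximality of the rank gives strict decrease of the slopes. -/
theorem exists_isCanonicalFiltration :
    ∃ (n : ℕ) (F : Fin (n + 1) → Submodule (𝓞 K) P), Λ.IsCanonicalFiltration F := by
  obtain ⟨n, F, hF0, hFl, hF⟩ := Λ.exists_isNext_chain ⊥ isSaturated_bot
  have hsat : ∀ i, IsSaturated (F i) := by
    intro i
    induction i using Fin.cases with
    | zero => rw [hF0]; exact isSaturated_bot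
    | succ i => exact (hF i).saturated
  refine ⟨n, F, hF0, hFl, Fin.strictMono_iff_lt_succ.2 fun i => (hF i).lt,
    fun i => projective_quotient_iff.2 (hsat i), fun i => ?_, fun i j hij => ?_⟩
  · rw [isSemistable_subquotient_iff _ (hsat _) (hsat _) (hF i).lt.le]
    intro N hN hAN _
    rcases hAN.eq_or_lt with rfl | hAN
    · simp
    · have h1 := (hF i).slope_le N hN hAN
      rwa [slope, slope, div_le_div_iff₀ (finrank_sub_pos (hsat _) hAN)
        (finrank_sub_pos (hsat _) (hF i).lt), mul_comm, mul_comm (Λ.degAt _ - _)] at h1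
  · have hs : j.castSucc = i.succ := Fin.ext hij.symm
    have h1 := hF j
    rw [hs] at h1 ⊢
    exact (Λ.subquotient_vol_pow_lt_iff (hsat _) (hsat _) (hF i).lt h1.lt).2
      ((hF i).slope_lt_slope Λ (hsat _) h1)

end OKLattice

end Degree

end ArakelovLattice
end

noncomputable section
namespace ArakelovLattice

/-! ### The canonical polygon dominates the polygons of all filtrations -/

section Canonical

variable {K : Type*} [Field K] [NumberField K]
variable {P : Type*} [AddCommGroup P] [Module (𝓞 K) P]

/-- A filtration of `P` by saturated submodules. -/
structure IsSaturatedFiltration {n : ℕ} (F : Fin (n + 1) → Submodule (𝓞 K) P) : Prop where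
  zero : F 0 = ⊥
  last : F (Fin.last n) = ⊤
  strictMono : StrictMono F
  saturated : ∀ i, IsSaturated (F i)

variable [Module.Finite (𝓞 K) P] [Module.IsTorsionFree (𝓞 K) P]

theorem IsSaturatedFiltration.strictMono_finrank {n : ℕ} {F : Fin (n + 1) → Submodule (𝓞 K) P}
    (hF : IsSaturatedFiltration F) : StrictMono fun i => (finrank (𝓞 K) (F i) : ℝ) :=
  fun i _ hij => Nat.cast_lt.2 (finrank_lt_finrank (hF.saturated i) (hF.strictMono hij))

theorem IsSaturatedFiltration.finrank_zero {n : ℕ} {F : Fin (n + 1) → Submodule (𝓞 K) P}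
    (hF : IsSaturatedFiltration F) : (finrank (𝓞 K) (F 0) : ℝ) = 0 := by
  rw [hF.zero, finrank_bot, Nat.cast_zero]

theorem IsSaturatedFiltration.finrank_last {n : ℕ} {F : Fin (n + 1) → Submodule (𝓞 K) P}
    (hF : IsSaturatedFiltration F) : (finrank (𝓞 K) (F (Fin.last n)) : ℝ) = finrank (𝓞 K) P := by
  rw [hF.last, finrank_top]

namespace OKLattice

variable (Λ : OKLattice K P)

theorem IsCanonicalFiltration.isSaturatedFiltration {Λ : OKLattice K P} {n : ℕ}
    {F : Fin (n + 1) → Submodule (𝓞 K) P} (hF : Λ.IsCanonicalFiltration F) :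
    IsSaturatedFiltration F :=
  ⟨hF.zero, hF.last, hF.strictMono, fun i => projective_quotient_iff.1 (hF.projective i)⟩

/-- The tangent line to the degree polygon of `F` on its `k`-th segment. -/
def tangent {n : ℕ} (F : Fin (n + 1) → Submodule (𝓞 K) P) (k : Fin n) (t : ℝ) : ℝ :=
  Λ.degAt (F k.castSucc) +
    Λ.slope (F k.castSucc) (F k.succ) * (t - finrank (𝓞 K) (F k.castSucc))

variable {Λ} {n : ℕ} {F : Fin (n + 1) → Submodule (𝓞 K) P}

theorem IsCanonicalFiltration.slope_lt (hF : Λ.IsCanonicalFiltration F) {i j : Fin n}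
    (hij : (i : ℕ) + 1 = j) :
    Λ.slope (F j.castSucc) (F j.succ) < Λ.slope (F i.castSucc) (F i.succ) := by
  have hsat := hF.isSaturatedFiltration.saturated
  have hs : j.castSucc = i.succ := Fin.ext hij.symm
  have h := hF.vol_lt i j hij
  have h1 : F j.castSucc < F j.succ := hF.strictMono Fin.castSucc_lt_succ
  rw [hs] at h h1 ⊢
  exact (Λ.subquotient_vol_pow_lt_iff (hsat _) (hsat _) (hF.strictMono Fin.castSucc_lt_succ)
    h1).1 h

theorem IsCanonicalFiltration.tangent_succ (hF : Λ.IsCanonicalFiltration F) {i j : Fin n}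
    (hij : (i : ℕ) + 1 = j) (t : ℝ) :
    Λ.tangent F j t = Λ.tangent F i t + (Λ.slope (F j.castSucc) (F j.succ) -
      Λ.slope (F i.castSucc) (F i.succ)) * (t - finrank (𝓞 K) (F i.succ)) := by
  have hs : j.castSucc = i.succ := Fin.ext hij.symm
  rw [tangent, tangent, hs, Λ.degAt_eq_add_slope (hF.isSaturatedFiltration.saturated i.castSucc)
    (hF.strictMono Fin.castSucc_lt_succ : F i.castSucc < F i.succ)]
  ring

theorem IsCanonicalFiltration.slope_anti (hF : Λ.IsCanonicalFiltration F) {i j : Fin n}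
    (hij : i ≤ j) : Λ.slope (F j.castSucc) (F j.succ) ≤ Λ.slope (F i.castSucc) (F i.succ) := by
  obtain ⟨m, hm⟩ := Nat.exists_eq_add_of_le (Fin.le_def.1 hij)
  induction m generalizing j with
  | zero => rw [show j = i from Fin.ext hm]
  | succ m ih =>
    have hj : (i : ℕ) + m < n := by have := j.2; omega
    exact (hF.slope_lt (i := ⟨i + m, hj⟩) (by simp; omega)).le.trans
      (ih (j := ⟨i + m, hj⟩) (Fin.le_def.2 (by simp)) rfl)

/-- Concavity: the lines of two adjacent segments meet at their common vertex, and to the left of it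
the line of smaller slope is the higher one. -/
theorem IsCanonicalFiltration.tangent_mono (hF : Λ.IsCanonicalFiltration F) {i j : Fin n}
    (hij : i ≤ j) {t : ℝ} (ht : t ≤ finrank (𝓞 K) (F i.succ)) :
    Λ.tangent F i t ≤ Λ.tangent F j t := by
  obtain ⟨m, hm⟩ := Nat.exists_eq_add_of_le (Fin.le_def.1 hij)
  induction m generalizing j with
  | zero => rw [show j = i from Fin.ext hm]
  | succ m ih =>
    have hj : (i : ℕ) + m < n := by have := j.2; omega
    set k : Fin n := ⟨i + m, hj⟩ with hk
    have hkj : (k : ℕ) + 1 = j := by rw [hk, hm]; simp; omega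
    refine (ih (j := k) (Fin.le_def.2 (by simp [hk])) rfl).trans ?_
    rw [hF.tangent_succ hkj]
    have h1 := hF.slope_lt hkj
    have h2 : (finrank (𝓞 K) (F i.succ) : ℝ) ≤ finrank (𝓞 K) (F k.succ) :=
      hF.isSaturatedFiltration.strictMono_finrank.monotone
        (Fin.le_def.2 (by simp [hk]))
    have h3 : 0 ≤ (Λ.slope (F k.castSucc) (F k.succ) - Λ.slope (F j.castSucc) (F j.succ)) *
        (finrank (𝓞 K) (F k.succ) - t) := mul_nonneg (by linarith) (by linarith)
    linarith

/-- Induction on a member `F j` containing `N`. Supermodularity splits the degree of `N` into that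
of `N ⊓ F j` and the degree that `N` contributes modulo `F j`. The former is covered by induction,
the latter by semi-stability of the quotient. All lines are needed in the induction since the rank
of the intersection may lie over any segment. -/
theorem IsCanonicalFiltration.degAt_le_tangent_of_le (hF : Λ.IsCanonicalFiltration F)
    (j : Fin (n + 1)) {N : Submodule (𝓞 K) P} (hN : IsSaturated N) (hNF : N ≤ F j) (k : Fin n) :
    Λ.degAt N ≤ Λ.tangent F k (finrank (𝓞 K) N) := by
  have hsat := hF.isSaturatedFiltration.saturated
  induction j using Fin.induction generalizing N k with
  | zero =>
    rw [hF.zero, le_bot_iff] at hNF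
    have h1 := hF.tangent_mono (i := ⟨0, k.pos⟩) (j := k) (Fin.le_def.2 (by simp))
      (t := finrank (𝓞 K) N) (by rw [hNF, finrank_bot, Nat.cast_zero]; positivity)
    refine le_trans (le_of_eq ?_) h1
    have h2 : (⟨0, k.pos⟩ : Fin n).castSucc = 0 := rfl
    rw [tangent, h2, hF.zero, hNF, sub_self, mul_zero, add_zero]
  | succ j ih =>
    have hjj : F j.castSucc < F j.succ := hF.strictMono Fin.castSucc_lt_succ
    set M := N ⊓ F j.castSucc with hM
    -- The sum need not be saturated; passing to the saturation keeps the rank, can only raise the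
    -- degree, and stays inside `F j.succ`.
    set S := saturation (N ⊔ F j.castSucc) with hS
    have h1 : Λ.degAt N + Λ.degAt (F j.castSucc) ≤ Λ.degAt S + Λ.degAt M :=
      (Λ.degAt_add_degAt_le (hsat _)).trans (by gcongr; exact Λ.degAt_le_degAt_saturation _)
    have h2 := (Λ.isSemistable_subquotient_iff (hsat _) (hsat _) hjj.le).1 (hF.semistable j) S
      (isSaturated_saturation _) (le_sup_right.trans (le_saturation _))
      (saturation_le (hsat _) (sup_le hNF hjj.le))
    have h3 := finrank_sub_pos (hsat _) hjj
    have h4 : (finrank (𝓞 K) S : ℝ) + finrank (𝓞 K) M =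
        finrank (𝓞 K) N + finrank (𝓞 K) (F j.castSucc) := by
      rw [hS, finrank_saturation, hM]
      exact_mod_cast finrank_sup_add_finrank_inf N (F j.castSucc)
    have h5 : Λ.degAt S - Λ.degAt (F j.castSucc) ≤ Λ.slope (F j.castSucc) (F j.succ) *
        ((finrank (𝓞 K) N : ℝ) - finrank (𝓞 K) M) := by
      have : (finrank (𝓞 K) N : ℝ) - finrank (𝓞 K) M =
        finrank (𝓞 K) S - finrank (𝓞 K) (F j.castSucc) := by linarith
      rw [this, slope, div_mul_eq_mul_div, le_div_iff₀ h3]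
      linarith
    have h6 : (finrank (𝓞 K) M : ℝ) ≤ finrank (𝓞 K) N := by
      exact_mod_cast Submodule.finrank_mono (inf_le_left : M ≤ N)
    -- For segments up to the `j`-th the slope is at least that of the quotient, so extending the
    -- line from the rank of `M` to that of `N` gains enough. Later segments follow from
    -- `tangent_mono`.
    have key (i : Fin n) (hi : i ≤ j) : Λ.degAt N ≤ Λ.tangent F i (finrank (𝓞 K) N) := by
      have h7 := ih (hN.inf (hsat _)) (inf_le_right : M ≤ _) i
      have h8 := mul_le_mul_of_nonneg_right (hF.slope_anti hi) (sub_nonneg.2 h6)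
      rw [tangent] at h7 ⊢
      have h9 : Λ.slope (F i.castSucc) (F i.succ) *
          ((finrank (𝓞 K) N : ℝ) - finrank (𝓞 K) (F i.castSucc)) =
          Λ.slope (F i.castSucc) (F i.succ) * ((finrank (𝓞 K) N : ℝ) - finrank (𝓞 K) M) +
          Λ.slope (F i.castSucc) (F i.succ) *
            ((finrank (𝓞 K) M : ℝ) - finrank (𝓞 K) (F i.castSucc)) := by ring
      linarith
    rcases le_total k j with hk | hk
    · exact key k hk
    · refine (key j le_rfl).trans (hF.tangent_mono hk ?_)
      exact_mod_cast Submodule.finrank_mono hNF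

theorem IsCanonicalFiltration.degAt_le_tangent (hF : Λ.IsCanonicalFiltration F)
    {N : Submodule (𝓞 K) P} (hN : IsSaturated N) (k : Fin n) :
    Λ.degAt N ≤ Λ.tangent F k (finrank (𝓞 K) N) :=
  hF.degAt_le_tangent_of_le (Fin.last n) hN (by rw [hF.last]; exact le_top) k

theorem polygon_of_mem (hF : IsSaturatedFiltration F) {s : ℝ} {k : Fin n}
    (hs : s ∈ Set.Icc (finrank (𝓞 K) (F k.castSucc) : ℝ) (finrank (𝓞 K) (F k.succ))) :
    Λ.polygon F s = Λ.tangent F k s - s * (Λ.deg / finrank (𝓞 K) P) := by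
  rw [polygon, interpolate_of_mem hF.strictMono_finrank _ k hs, tangent, slope]
  simp only [degAt]
  have h := (sub_pos.2 (hF.strictMono_finrank (Fin.castSucc_lt_succ (i := k)))).ne'
  simp only at h
  field_simp
  ring

theorem polygon_finrank (hF : IsSaturatedFiltration F) (i : Fin (n + 1)) :
    Λ.polygon F (finrank (𝓞 K) (F i)) =
      Λ.degAt (F i) - finrank (𝓞 K) (F i) * (Λ.deg / finrank (𝓞 K) P) :=
  interpolate_apply hF.strictMono_finrank _ i

theorem polygon_last (hF : IsSaturatedFiltration F) (hr : 0 < finrank (𝓞 K) P) :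
    Λ.polygon F (finrank (𝓞 K) P) = 0 := by
  have h := polygon_finrank (Λ := Λ) hF (Fin.last n)
  rw [hF.finrank_last, hF.last, degAt_top, mul_div_cancel₀ _ (by positivity)] at h
  rw [h, sub_self]

/-- The canonical polygon dominates the polygons of all filtrations. -/
theorem IsCanonicalFiltration.polygon_le_polygon (hF : Λ.IsCanonicalFiltration F) {m : ℕ}
    (hr : 0 < finrank (𝓞 K) P)
    {G : Fin (m + 1) → Submodule (𝓞 K) P} (hG : IsSaturatedFiltration G) {s : ℝ}
    (hs : s ∈ Set.Icc (0 : ℝ) (finrank (𝓞 K) P)) : Λ.polygon G s ≤ Λ.polygon F s := by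
  have hF' := hF.isSaturatedFiltration
  have hs' := hs
  rw [← hF'.finrank_zero, ← hF'.finrank_last] at hs'
  -- At the right end both polygons vanish. Elsewhere the canonical polygon coincides with one of
  -- its lines, and all vertices of the other polygon lie below that line.
  rcases exists_mem_Icc_succ (x := fun i => (finrank (𝓞 K) (F i) : ℝ)) hs' with h | ⟨k, hk⟩
  · rw [hF'.finrank_last] at h
    rw [h, polygon_last hG hr, polygon_last hF' hr]
  · rw [polygon_of_mem hF' hk]
    set μ := Λ.deg / finrank (𝓞 K) P with hμ
    set a := Λ.slope (F k.castSucc) (F k.succ) with ha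
    rw [← hG.finrank_zero, ← hG.finrank_last] at hs
    have h1 := interpolate_le_of_forall_le hG.strictMono_finrank
      (y := fun i => Λ.degAt (G i) - finrank (𝓞 K) (G i) * μ) (a := a - μ)
      (b := Λ.degAt (F k.castSucc) - a * finrank (𝓞 K) (F k.castSucc)) (fun i => ?_) hs
    · refine h1.trans (le_of_eq ?_)
      rw [tangent]
      ring
    · have h2 := hF.degAt_le_tangent (hG.saturated i) k
      rw [tangent] at h2
      linarith

variable (Λ) in
/-- The canonical polygon lies below `p` if and only if all polygons of filtrations do. -/
theorem exists_canonical_polygon_le_iff (hr : 0 < finrank (𝓞 K) P) (p : ℝ → ℝ) :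
    (∃ (n : ℕ) (F : Fin (n + 1) → Submodule (𝓞 K) P), Λ.IsCanonicalFiltration F ∧
      ∀ s ∈ Set.Icc (0 : ℝ) (finrank (𝓞 K) P), Λ.polygon F s ≤ p s) ↔
    ∀ (n : ℕ) (F : Fin (n + 1) → Submodule (𝓞 K) P), IsSaturatedFiltration F →
      ∀ s ∈ Set.Icc (0 : ℝ) (finrank (𝓞 K) P), Λ.polygon F s ≤ p s := by
  constructor
  · rintro ⟨n, F, hF, h⟩ m G hG s hs
    exact (hF.polygon_le_polygon hr hG hs).trans (h s hs)
  · intro h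
    obtain ⟨n, F, hF⟩ := Λ.exists_isCanonicalFiltration
    exact ⟨n, F, hF, h n F hF.isSaturatedFiltration⟩

end OKLattice

end Canonical

end ArakelovLattice
end

noncomputable section
namespace ArakelovLattice

/-! ### Isometries, scaling and continuity -/

section Action

variable {K : Type*} [Field K] [NumberField K]
variable {P : Type*} [AddCommGroup P] [Module (𝓞 K) P]

theorem isSaturated_map (A : P ≃ₗ[𝓞 K] P) {N : Submodule (𝓞 K) P} (hN : IsSaturated N) :
    IsSaturated (N.map A.toLinearMap) := by
  rintro a x ha ⟨y, hy, hyx⟩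
  refine ⟨A.symm x, hN a _ ha ?_, A.apply_symm_apply x⟩
  rw [← map_smul, ← hyx]
  simpa using hy

theorem IsSaturatedFiltration.map (A : P ≃ₗ[𝓞 K] P) {n : ℕ} {F : Fin (n + 1) → Submodule (𝓞 K) P}
    (hF : IsSaturatedFiltration F) :
    IsSaturatedFiltration fun i => (F i).map A.toLinearMap where
  zero := by rw [hF.zero, Submodule.map_bot]
  last := by rw [hF.last, Submodule.map_top, LinearMap.range_eq_top]; exact A.surjective
  strictMono := fun i j hij => Submodule.map_strictMono_of_injective A.injective (hF.strictMono hij)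
  saturated i := isSaturated_map A (hF.saturated i)

namespace OKLattice

variable (Λ : OKLattice K P)

theorem innerInfty_act (A : P ≃ₗ[𝓞 K] P) (x y : P) :
    (Λ.act A).innerInfty x y = Λ.innerInfty (A.symm x) (A.symm y) := rfl

theorem innerInfty_scale {T : ℝ} (hT : 0 < T) (x y : P) :
    (Λ.scale T hT).innerInfty x y = T ^ 2 * Λ.innerInfty x y := by
  rw [innerInfty, innerInfty, Finset.mul_sum]
  refine Finset.sum_congr rfl fun v _ => ?_
  rw [innerAt_scale, map_mul, extensionEmbedding_realHom, Complex.re_ofReal_mul]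

theorem norm_toAmbient_act (A : P ≃ₗ[𝓞 K] P) (x : P) :
    ‖(Λ.act A).toAmbient (A x)‖ = ‖Λ.toAmbient x‖ := by
  rw [norm_eq_sqrt_real_inner, norm_eq_sqrt_real_inner, inner_toAmbient, inner_toAmbient,
    innerInfty_act, A.symm_apply_apply]

theorem continuous_innerAt (v : InfinitePlace K) (u w : LocalSpace K P v) :
    Continuous fun Λ : OKLattice K P => Λ.innerAt v u w :=
  continuous_pi_iff.1 (continuous_pi_iff.1 (continuous_pi_iff.1 continuous_induced_dom v) u) w

theorem continuous_innerInfty (x y : P) : Continuous fun Λ : OKLattice K P => Λ.innerInfty x y :=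
  continuous_finsetSum _ fun v _ => Complex.continuous_re.comp
    ((Completion.isometry_extensionEmbedding v).continuous.comp (continuous_innerAt v _ _))

theorem continuous_norm_toAmbient (x : P) :
    Continuous fun Λ : OKLattice K P => ‖Λ.toAmbient x‖ := by
  simp_rw [norm_eq_sqrt_real_inner, inner_toAmbient]
  exact Real.continuous_sqrt.comp (continuous_innerInfty x x)

variable [Module.Finite (𝓞 K) P] [Module.IsTorsionFree (𝓞 K) P]

theorem covol_eq_sqrt {N : Submodule (𝓞 K) P} {ι : Type*} [Fintype ι] [DecidableEq ι]
    (b : Basis ι ℤ N) :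
    Λ.covol N = √(Matrix.of fun i j => Λ.innerInfty (b i : P) (b j)).det := by
  rw [← Real.sqrt_sq (Λ.covol_pos N).le, covol_sq _ b]
  rfl

theorem covol_act_map (A : P ≃ₗ[𝓞 K] P) (N : Submodule (𝓞 K) P) :
    (Λ.act A).covol (N.map A.toLinearMap) = Λ.covol N := by
  have := finite_int K N
  have := free_int K N
  let b := Module.finBasis ℤ N
  let e : N ≃ₗ[ℤ] N.map A.toLinearMap := (A.submoduleMap N).restrictScalars ℤ
  rw [covol_eq_sqrt _ b, covol_eq_sqrt _ (b.map e)]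
  congr 2
  ext i j
  have h (i) : A.symm ((b.map e i : N.map A.toLinearMap) : P) = b i :=
    A.symm_apply_apply (b i : P)
  rw [Matrix.of_apply, Matrix.of_apply, innerInfty_act, h, h]

theorem covol_scale {T : ℝ} (hT : 0 < T) (N : Submodule (𝓞 K) P) :
    (Λ.scale T hT).covol N = T ^ (finrank ℚ K * finrank (𝓞 K) N) * Λ.covol N := by
  have := finite_int K N
  have := free_int K N
  let b := Module.finBasis ℤ N
  rw [covol_eq_sqrt _ b, covol_eq_sqrt _ b]
  have h : (Matrix.of fun i j => (Λ.scale T hT).innerInfty (b i : P) (b j)) =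
      (T ^ 2) • (Matrix.of fun i j => Λ.innerInfty (b i : P) (b j)) := by
    ext i j
    simp [innerInfty_scale]
  rw [h, Matrix.det_smul, Fintype.card_fin, ← finrank_int_eq K N, Real.sqrt_mul (by positivity),
    ← pow_mul, mul_comm 2, pow_mul, Real.sqrt_sq (by positivity)]

/-- For a fixed `ℤ`-basis of `N` the covolume is the square root of a determinant whose entries are
values of the forms. -/
theorem continuous_degAt (N : Submodule (𝓞 K) P) :
    Continuous fun Λ : OKLattice K P => Λ.degAt N := by
  have := finite_int K N
  have := free_int K N
  let b := Module.finBasis ℤ N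
  have h : Continuous fun Λ : OKLattice K P => Λ.covol N := by
    simp_rw [fun Λ : OKLattice K P => Λ.covol_eq_sqrt b]
    refine Real.continuous_sqrt.comp (Continuous.matrix_det ?_)
    exact continuous_matrix fun i j => continuous_innerInfty _ _
  simp_rw [degAt, deg_restrict]
  exact continuous_const.sub (h.log fun Λ => (Λ.covol_pos N).ne')

theorem continuous_deg : Continuous fun Λ : OKLattice K P => Λ.deg := by
  simp_rw [← degAt_top]
  exact continuous_degAt ⊤

theorem continuous_polygon {n : ℕ} (F : Fin (n + 1) → Submodule (𝓞 K) P) (s : ℝ) :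
    Continuous fun Λ : OKLattice K P => Λ.polygon F s := by
  have h (i) : Continuous fun Λ : OKLattice K P => (Λ.restrict (F i)).deg -
      finrank (𝓞 K) (F i) * (Λ.deg / finrank (𝓞 K) P) :=
    (continuous_degAt (F i)).sub (continuous_const.mul (continuous_deg.div_const _))
  unfold polygon interpolate
  exact (h 0).add (continuous_finsetSum _ fun i _ =>
    ((((h _).sub (h _)).div_const _).mul continuous_const))

theorem degAt_act_map (A : P ≃ₗ[𝓞 K] P) (N : Submodule (𝓞 K) P) :
    (Λ.act A).degAt (N.map A.toLinearMap) = Λ.degAt N := by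
  rw [degAt, degAt, deg_restrict, deg_restrict, covol_act_map,
    (A.submoduleMap N).symm.finrank_eq]

theorem deg_act (A : P ≃ₗ[𝓞 K] P) : (Λ.act A).deg = Λ.deg := by
  rw [← degAt_top, ← degAt_top, ← degAt_act_map Λ A, Submodule.map_top,
    LinearMap.range_eq_top.2 A.surjective]

theorem degAt_scale {T : ℝ} (hT : 0 < T) (N : Submodule (𝓞 K) P) :
    (Λ.scale T hT).degAt N =
      Λ.degAt N - finrank ℚ K * finrank (𝓞 K) N * Real.log T := by
  rw [degAt, degAt, deg_restrict, deg_restrict, covol_scale,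
    Real.log_mul (by positivity) (Λ.covol_pos _).ne', Real.log_pow]
  push_cast
  ring

theorem deg_scale {T : ℝ} (hT : 0 < T) :
    (Λ.scale T hT).deg = Λ.deg - finrank ℚ K * finrank (𝓞 K) P * Real.log T := by
  rw [← degAt_top, ← degAt_top, degAt_scale, finrank_top]

theorem polygon_act_map (A : P ≃ₗ[𝓞 K] P) {n : ℕ} (F : Fin (n + 1) → Submodule (𝓞 K) P) :
    (Λ.act A).polygon (fun i => (F i).map A.toLinearMap) = Λ.polygon F := by
  unfold polygon
  simp_rw [deg_act, ← (A.submoduleMap _).finrank_eq]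
  congr 1
  ext i
  exact congrArg (· - _) (Λ.degAt_act_map A (F i))

/-- Scaling shifts each degree by a constant times the rank, which the normalization by the mean
slope removes. -/
theorem polygon_scale {T : ℝ} (hT : 0 < T) (hr : 0 < finrank (𝓞 K) P) {n : ℕ}
    (F : Fin (n + 1) → Submodule (𝓞 K) P) :
    (Λ.scale T hT).polygon F = Λ.polygon F := by
  unfold polygon
  congr 1
  ext i
  have h := Λ.degAt_scale hT (F i)
  rw [degAt, degAt] at h
  rw [deg_scale, h]
  field_simp
  ring

/-- All polygons of filtrations by saturated submodules lie below `p`. -/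
def PolygonsLE (Λ : OKLattice K P) (p : ℝ → ℝ) : Prop :=
  ∀ (n : ℕ) (F : Fin (n + 1) → Submodule (𝓞 K) P), IsSaturatedFiltration F →
    ∀ s ∈ Set.Icc (0 : ℝ) (finrank (𝓞 K) P), Λ.polygon F s ≤ p s

theorem isClosed_polygonsLE (p : ℝ → ℝ) : IsClosed {Λ : OKLattice K P | Λ.PolygonsLE p} := by
  simp only [PolygonsLE, Set.ofPred_forall]
  exact isClosed_iInter fun n => isClosed_iInter fun F => isClosed_iInter fun _ =>
    isClosed_iInter fun s => isClosed_iInter fun _ =>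
      isClosed_le (continuous_polygon F s) continuous_const

variable {Λ}

theorem PolygonsLE.act {p : ℝ → ℝ} (h : Λ.PolygonsLE p) (A : P ≃ₗ[𝓞 K] P) :
    (Λ.act A).PolygonsLE p := by
  intro n F hF s hs
  have h1 := h n _ (hF.map A.symm) s hs
  rw [← polygon_act_map _ A] at h1
  convert h1 using 2
  funext i
  ext x
  simp

theorem PolygonsLE.scale {p : ℝ → ℝ} (h : Λ.PolygonsLE p) {T : ℝ} (hT : 0 < T)
    (hr : 0 < finrank (𝓞 K) P) : (Λ.scale T hT).PolygonsLE p := by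
  intro n F hF s hs
  rw [polygon_scale _ hT hr]
  exact h n F hF s hs

end OKLattice

end Action

/-! ### Bounded families and indices -/

section Index

variable {K : Type*} [Field K] [NumberField K]
variable {P : Type*} [AddCommGroup P] [Module (𝓞 K) P]

variable (K) in
/-- A bound for the index of the span of `r` independent vectors of norm at most `R` in a lattice
of covolume at least `δ`. -/
def indexBound (r : ℕ) (R δ : ℝ) : ℕ :=
  ⌈√((Fintype.card (Free.ChooseBasisIndex ℤ (𝓞 K) × Fin r)).factorial *
    ((basisBound K * R) ^ 2) ^ Fintype.card (Free.ChooseBasisIndex ℤ (𝓞 K) × Fin r)) / δ⌉₊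

namespace OKLattice

variable (Λ : OKLattice K P) [Module.Finite (𝓞 K) P] [Module.IsTorsionFree (𝓞 K) P]

open Classical in
theorem covol_span_sq {r : ℕ} {x : Fin r → P} (hx : LinearIndependent (𝓞 K) x) :
    Λ.covol (Submodule.span (𝓞 K) (Set.range x)) ^ 2 =
      (Matrix.gram ℝ fun q : Free.ChooseBasisIndex ℤ (𝓞 K) × Fin r =>
        Λ.toAmbient (RingOfIntegers.basis K q.1 • x q.2)).det := by
  rw [covol_sq Λ ((RingOfIntegers.basis K).smulTower (Basis.span hx))]
  congr 2
  ext q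
  rw [Basis.smulTower_apply, Submodule.coe_smul, Basis.span_apply]

/-- The index is the ratio of the covolume of the span, bounded through the lengths of the vectors,
to that of the whole lattice, bounded below by `δ`. -/
theorem exists_smul_mem_span {r : ℕ} (hr : finrank (𝓞 K) P = r) {x : Fin r → P}
    (hx : LinearIndependent (𝓞 K) x) {R δ : ℝ} (hR : ∀ j, ‖Λ.toAmbient (x j)‖ ≤ R) (hδ : 0 < δ)
    (hcov : δ ≤ Λ.covol ⊤) :
    ∃ m : ℕ, 0 < m ∧ m ≤ indexBound K r R δ ∧
      ∀ p : P, m • p ∈ Submodule.span (𝓞 K) (Set.range x) := by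
  classical
  obtain ⟨m, hm, h1, h2⟩ := Λ.exists_covol_eq_mul
    (le_top : Submodule.span (𝓞 K) (Set.range x) ≤ ⊤)
    (by rw [finrank_span_eq_card hx, finrank_top, hr, Fintype.card_fin])
  refine ⟨m, hm, ?_, fun p => h2 p trivial⟩
  have h3 := det_gram_le_of_norm_le
    (b := fun q : Free.ChooseBasisIndex ℤ (𝓞 K) × Fin r =>
        Λ.toAmbient (RingOfIntegers.basis K q.1 • x q.2)) (B := basisBound K * R) fun q =>
      (Λ.norm_toAmbient_basis_smul_le q.1 (x q.2)).trans
        (mul_le_mul_of_nonneg_left (hR _) (basisBound_nonneg K))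
  rw [← covol_span_sq Λ hx] at h3
  have h4 := Real.le_sqrt_of_sq_le h3
  rw [h1] at h4
  refine Nat.cast_le.1 (le_trans ?_ (Nat.le_ceil _) : (m : ℝ) ≤ (indexBound K r R δ : ℕ))
  rw [le_div_iff₀ hδ]
  exact (mul_le_mul_of_nonneg_left hcov (by positivity)).trans h4

theorem covol_top_le_covol (N : Submodule (𝓞 K) P) (h : finrank (𝓞 K) N = finrank (𝓞 K) P) :
    Λ.covol ⊤ ≤ Λ.covol N :=
  Λ.covol_le_of_le le_top (by rw [h, finrank_top])

/-- Converts a bound on degrees into one on covolumes; the term with `n` absorbs the discriminant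
contribution of the difference of ranks. -/
theorem covol_le_exp_mul_covol {V W : Submodule (𝓞 K) P} {M : ℝ} {n : ℕ}
    (hn : finrank (𝓞 K) P ≤ n)
    (h : Λ.degAt W - Λ.degAt V ≤ M) :
    Λ.covol V ≤ Real.exp (M + n * |Real.log |(discr K : ℝ)| / 2 - nrComplexPlaces K * Real.log 2|)
      * Λ.covol W := by
  rw [← Real.log_le_log_iff (Λ.covol_pos V) (mul_pos (Real.exp_pos _) (Λ.covol_pos W)),
    Real.log_mul (Real.exp_pos _).ne' (Λ.covol_pos W).ne', Real.log_exp]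
  rw [degAt, degAt, deg_restrict, deg_restrict] at h
  set e := Real.log |(discr K : ℝ)| / 2 - nrComplexPlaces K * Real.log 2
  have h1 : ((finrank (𝓞 K) V : ℝ) - finrank (𝓞 K) W) * e ≤ n * |e| := by
    refine (le_abs_self _).trans ?_
    rw [abs_mul]
    refine mul_le_mul_of_nonneg_right ?_ (abs_nonneg _)
    have h2 : (finrank (𝓞 K) V : ℝ) ≤ n := by
      exact_mod_cast (Submodule.finrank_le V).trans hn
    have h3 : (finrank (𝓞 K) W : ℝ) ≤ n := by
      exact_mod_cast (Submodule.finrank_le W).trans hn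
    rw [abs_le]
    constructor <;> linarith [Nat.cast_nonneg (α := ℝ) (finrank (𝓞 K) V),
      Nat.cast_nonneg (α := ℝ) (finrank (𝓞 K) W)]
  linarith

end OKLattice

end Index

end ArakelovLattice
end

noncomputable section
namespace ArakelovLattice

/-! ### Finiteness of families up to automorphisms -/

section Representatives

variable {K : Type*} [Field K] [NumberField K]
variable {P : Type*} [AddCommGroup P] [Module (𝓞 K) P]

-- Such submodules correspond to submodules of the finite module `(𝓞 K / M) ^ r`.
variable (K) in
theorem finite_submodules_containing_multiples (r : ℕ) {M : ℕ} (hM : M ≠ 0) :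
    {Q : Submodule (𝓞 K) (Fin r → 𝓞 K) | ∀ a, M • a ∈ Q}.Finite := by
  set N : Submodule (𝓞 K) (Fin r → 𝓞 K) :=
    LinearMap.range (LinearMap.lsmul (𝓞 K) (Fin r → 𝓞 K) (M : 𝓞 K)) with hN
  have hfin : Finite ((Fin r → 𝓞 K) ⧸ N) := by
    have : Module.Finite ℤ ((Fin r → 𝓞 K) ⧸ N) := finite_int K _
    refine Module.finite_of_fg_torsion _ fun {y} => ?_
    obtain ⟨x, rfl⟩ := Submodule.Quotient.mk_surjective _ y
    refine ⟨⟨(M : ℤ), by simpa using hM⟩, ?_⟩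
    change (M : ℤ) • (Submodule.Quotient.mk x : (Fin r → 𝓞 K) ⧸ N) = 0
    rw [natCast_zsmul, ← Submodule.Quotient.mk_smul, Submodule.Quotient.mk_eq_zero]
    exact ⟨x, by simp [Nat.cast_smul_eq_nsmul]⟩
  have : Finite (Submodule (𝓞 K) ((Fin r → 𝓞 K) ⧸ N)) :=
    Finite.of_injective (SetLike.coe : Submodule (𝓞 K) ((Fin r → 𝓞 K) ⧸ N) → Set _)
      SetLike.coe_injective
  have : Finite (Set.Ici N) := Finite.of_equiv _ (Submodule.comapMkQRelIso N).toEquiv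
  refine (Set.toFinite (Set.Ici N)).subset fun Q hQ => ?_
  rintro _ ⟨x, rfl⟩
  simpa [Nat.cast_smul_eq_nsmul] using hQ x

variable [Module.IsTorsionFree (𝓞 K) P]

/-- The coordinates of the multiples `M • p` in a family `x` spanning all these multiples. -/
def multipleCoords {r : ℕ} {x : Fin r → P} (hx : LinearIndependent (𝓞 K) x) {M : ℕ}
    (h : ∀ p, M • p ∈ Submodule.span (𝓞 K) (Set.range x)) : P →ₗ[𝓞 K] (Fin r → 𝓞 K) :=
  (Basis.span hx).equivFun.toLinearMap ∘ₗ
    (LinearMap.lsmul (𝓞 K) P (M : 𝓞 K)).codRestrict (Submodule.span (𝓞 K) (Set.range x))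
      fun p => by simpa [Nat.cast_smul_eq_nsmul] using h p

theorem multipleCoords_injective {r : ℕ} {x : Fin r → P} (hx : LinearIndependent (𝓞 K) x) {M : ℕ}
    (hM : M ≠ 0) (h : ∀ p, M • p ∈ Submodule.span (𝓞 K) (Set.range x)) :
    Function.Injective (multipleCoords hx h) := by
  intro p q hpq
  have h1 : (M : 𝓞 K) • p = (M : 𝓞 K) • q :=
    congrArg Subtype.val ((Basis.span hx).equivFun.injective hpq)
  exact smul_right_injective P (Nat.cast_ne_zero.2 hM : (M : 𝓞 K) ≠ 0) h1

theorem multipleCoords_apply {r : ℕ} {x : Fin r → P} (hx : LinearIndependent (𝓞 K) x) {M : ℕ}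
    (h : ∀ p, M • p ∈ Submodule.span (𝓞 K) (Set.range x)) (j : Fin r) :
    multipleCoords hx h (x j) = M • Pi.single j 1 := by
  have h1 : (LinearMap.lsmul (𝓞 K) P (M : 𝓞 K)).codRestrict
      (Submodule.span (𝓞 K) (Set.range x))
      (fun p => by simpa [Nat.cast_smul_eq_nsmul] using h p) (x j) = M • Basis.span hx j := by
    ext
    simp [Basis.span_apply, Nat.cast_smul_eq_nsmul]
  change (Basis.span hx).equivFun _ = _
  erw [h1]
  rw [map_nsmul]
  congr 1
  ext i
  rw [Basis.equivFun_self, Pi.single_apply]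
  simp [eq_comm]

/-- The map `multipleCoords` embeds `P` in `𝓞 K ^ r` and sends the family to `M` times the standard
basis, so the image determines the pair of module and family up to isomorphism. -/
theorem exists_equiv_of_range_eq {r : ℕ} {x y : Fin r → P} (hx : LinearIndependent (𝓞 K) x)
    (hy : LinearIndependent (𝓞 K) y) {M : ℕ} (hM : M ≠ 0)
    (h : ∀ p, M • p ∈ Submodule.span (𝓞 K) (Set.range x))
    (h' : ∀ p, M • p ∈ Submodule.span (𝓞 K) (Set.range y))
    (heq : LinearMap.range (multipleCoords hx h) = LinearMap.range (multipleCoords hy h')) :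
    ∃ A : P ≃ₗ[𝓞 K] P, ∀ j, A (x j) = y j := by
  refine ⟨(LinearEquiv.ofInjective _ (multipleCoords_injective hx hM h)).trans
    ((LinearEquiv.ofEq _ _ heq).trans
      (LinearEquiv.ofInjective _ (multipleCoords_injective hy hM h')).symm), fun j => ?_⟩
  rw [LinearEquiv.trans_apply, LinearEquiv.trans_apply, LinearEquiv.symm_apply_eq]
  ext1
  rw [LinearEquiv.coe_ofEq_apply, LinearEquiv.ofInjective_apply, LinearEquiv.ofInjective_apply,
    multipleCoords_apply, multipleCoords_apply]

variable (K P) in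
/-- Up to automorphisms there are finitely many independent families whose span contains `M • P`. -/
theorem exists_finite_representatives (r : ℕ) {M : ℕ} (hM : M ≠ 0) :
    ∃ S : Set (Fin r → P), S.Finite ∧ (∀ y ∈ S, LinearIndependent (𝓞 K) y ∧
        ∀ p, M • p ∈ Submodule.span (𝓞 K) (Set.range y)) ∧
      ∀ x : Fin r → P, LinearIndependent (𝓞 K) x →
        (∀ p, M • p ∈ Submodule.span (𝓞 K) (Set.range x)) →
        ∃ A : P ≃ₗ[𝓞 K] P, (fun j => A (x j)) ∈ S := by
  let X := {x : Fin r → P // LinearIndependent (𝓞 K) x ∧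
    ∀ p, M • p ∈ Submodule.span (𝓞 K) (Set.range x)}
  let f : X → Submodule (𝓞 K) (Fin r → 𝓞 K) := fun x =>
    LinearMap.range (multipleCoords x.2.1 x.2.2)
  have hf : (Set.range f).Finite := by
    refine (finite_submodules_containing_multiples K r hM).subset ?_
    rintro _ ⟨x, rfl⟩ a
    refine ⟨∑ j, a j • x.1 j, ?_⟩
    rw [map_sum]
    simp_rw [map_smul, multipleCoords_apply, smul_comm _ M, ← Finset.smul_sum]
    congr 1
    ext i
    simp [Finset.sum_apply, Pi.single_apply]
  have := hf.to_subtype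
  -- One family is chosen for each of the finitely many images that occur.
  refine ⟨Set.range fun q => (Set.rangeSplitting f q).1, Set.finite_range _, ?_, ?_⟩
  · rintro _ ⟨q, rfl⟩
    exact (Set.rangeSplitting f q).2
  · intro x hx h
    obtain ⟨A, hA⟩ := exists_equiv_of_range_eq hx
      (Set.rangeSplitting f ⟨f ⟨x, hx, h⟩, _, rfl⟩).2.1 hM h
      (Set.rangeSplitting f ⟨f ⟨x, hx, h⟩, _, rfl⟩).2.2
      (Set.apply_rangeSplitting f ⟨f ⟨x, hx, h⟩, _, rfl⟩).symm
    exact ⟨A, ⟨⟨f ⟨x, hx, h⟩, _, rfl⟩, (funext hA).symm⟩⟩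

end Representatives

/-! ### Compact sets of lattices -/

section Compact

variable {K : Type*} [Field K] [NumberField K]
variable {P : Type*} [AddCommGroup P] [Module (𝓞 K) P]

theorem isCompact_closedBall_completion (v : InfinitePlace K) (R : ℝ) :
    IsCompact (Metric.closedBall (0 : v.Completion) R) := by
  have h : Topology.IsClosedEmbedding (Completion.extensionEmbedding v) :=
    (Completion.isometry_extensionEmbedding v).isClosedEmbedding
  have h1 := h.isCompact_preimage (isCompact_closedBall (0 : ℂ) R)
  convert h1 using 1
  ext x
  simp [norm_extensionEmbedding]

namespace OKLattice

/-- The lattice with given values of its inner products. -/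
theorem exists_innerAt_eq
    (f : ∀ v : InfinitePlace K, LocalSpace K P v → LocalSpace K P v → v.Completion)
    (h1 : ∀ v u w, conjHom v (f v w u) = f v u w)
    (h2 : ∀ v u w z, f v (u + w) z = f v u z + f v w z)
    (h3 : ∀ v c u w, f v (c • u) w = conjHom v c * f v u w)
    (h4 : ∀ v u, u ≠ 0 → 0 < (Completion.extensionEmbedding v (f v u u)).re) :
    ∃ Λ : OKLattice K P, ∀ v u w, Λ.innerAt v u w = f v u w := by
  have h0 (v w) : f v 0 w = 0 := by
    have := h3 v 0 0 w
    rwa [zero_smul, show conjHom v 0 = 0 from extensionEmbedding_injective v (by simp),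
      zero_mul] at this
  refine ⟨fun v =>
    letI := completionRCLike v
    { inner := f v
      conj_inner_symm := fun u w => h1 v u w
      re_inner_nonneg := fun u => ?_
      add_left := fun u w z => h2 v u w z
      smul_left := fun u w c => h3 v c u w
      definite := fun u hu => ?_ }, fun v u w => rfl⟩
  · by_cases hu : u = 0
    · subst hu
      change 0 ≤ (Completion.extensionEmbedding v (f v 0 0)).re
      rw [h0, map_zero, Complex.zero_re]
    · exact (h4 v u hu).le
  · by_contra h
    have h5 := h4 v u h
    have h6 : f v u u = 0 := hu
    rw [h6, map_zero, Complex.zero_re] at h5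
    exact lt_irrefl _ h5

theorem continuous_conjHom (v : InfinitePlace K) : Continuous (conjHom v) := by
  rw [(Completion.isometry_extensionEmbedding v).isEmbedding.continuous_iff]
  have : (Completion.extensionEmbedding v) ∘ conjHom v =
      fun x => (starRingEnd ℂ) (Completion.extensionEmbedding v x) := by
    ext x
    simp
  rw [this]
  exact Complex.continuous_conj.comp (Completion.isometry_extensionEmbedding v).continuous

/-- A set of lattices whose inner products are bounded above and bounded away from `0` is
relatively compact. -/
theorem isCompact_box (B : ∀ v : InfinitePlace K, LocalSpace K P v → LocalSpace K P v → ℝ)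
    (c : ∀ v : InfinitePlace K, LocalSpace K P v → ℝ) (hc : ∀ v u, u ≠ 0 → 0 < c v u) :
    IsCompact {Λ : OKLattice K P | (∀ v u w, ‖Λ.innerAt v u w‖ ≤ B v u w) ∧
      ∀ v u, c v u ≤ (Completion.extensionEmbedding v (Λ.innerAt v u u)).re} := by
  let j : OKLattice K P → (∀ v : InfinitePlace K, LocalSpace K P v → LocalSpace K P v →
    v.Completion) := fun Λ v u w => Λ.innerAt v u w
  have hj : Topology.IsInducing j := ⟨rfl⟩
  rw [hj.isCompact_iff]
  set T : Set (∀ v : InfinitePlace K, LocalSpace K P v → LocalSpace K P v → v.Completion) :=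
    (⋂ v, ⋂ u, ⋂ w, {f | conjHom v (f v w u) = f v u w}) ∩
    (⋂ v, ⋂ u, ⋂ w, ⋂ z, {f | f v (u + w) z = f v u z + f v w z}) ∩
    (⋂ v, ⋂ a : v.Completion, ⋂ u, ⋂ w, {f | f v (a • u) w = conjHom v a * f v u w}) ∩
    (⋂ v, ⋂ u, {f | c v u ≤ (Completion.extensionEmbedding v (f v u u)).re}) with hT
  set D : Set (∀ v : InfinitePlace K, LocalSpace K P v → LocalSpace K P v → v.Completion) :=
    Set.pi Set.univ fun v => Set.pi Set.univ fun u => Set.pi Set.univ fun w =>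
      Metric.closedBall 0 (B v u w) with hD
  -- Tychonoff's theorem applies because the topology is that of pointwise convergence. Being a
  -- Hermitian form is a closed condition, and the lower bounds `c` keep limits definite.
  have hDc : IsCompact D := isCompact_univ_pi fun v => isCompact_univ_pi fun u =>
    isCompact_univ_pi fun w => isCompact_closedBall_completion v _
  have hev (v : InfinitePlace K) (u w : LocalSpace K P v) :
      Continuous fun f : (∀ v : InfinitePlace K, LocalSpace K P v → LocalSpace K P v →
        v.Completion) => f v u w :=
    (continuous_apply w).comp ((continuous_apply u).comp (continuous_apply v))
  have hTc : IsClosed T := by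
    refine ((IsClosed.inter ?_ ?_).inter ?_).inter ?_
    · exact isClosed_iInter fun v => isClosed_iInter fun u => isClosed_iInter fun w =>
        isClosed_eq ((continuous_conjHom v).comp (hev v w u)) (hev v u w)
    · exact isClosed_iInter fun v => isClosed_iInter fun u => isClosed_iInter fun w =>
        isClosed_iInter fun z => isClosed_eq (hev _ _ _) ((hev _ _ _).add (hev _ _ _))
    · exact isClosed_iInter fun v => isClosed_iInter fun a => isClosed_iInter fun u =>
        isClosed_iInter fun w => isClosed_eq (hev _ _ _) (continuous_const.mul (hev _ _ _))
    · exact isClosed_iInter fun v => isClosed_iInter fun u =>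
        isClosed_le continuous_const (Complex.continuous_re.comp
          ((Completion.isometry_extensionEmbedding v).continuous.comp (hev v u u)))
  have himg : j '' {Λ : OKLattice K P | (∀ v u w, ‖Λ.innerAt v u w‖ ≤ B v u w) ∧
      ∀ v u, c v u ≤ (Completion.extensionEmbedding v (Λ.innerAt v u u)).re} = D ∩ T := by
    ext f
    constructor
    · rintro ⟨Λ, ⟨hB, hc'⟩, rfl⟩
      refine ⟨fun v _ u _ w _ => by simpa using hB v u w, ?_⟩
      simp only [hT, Set.mem_inter_iff, Set.mem_iInter, Set.mem_ofPred_eq]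
      exact ⟨⟨⟨fun v u w => Λ.conj_innerAt v u w, fun v u w z => Λ.innerAt_add_left v u w z⟩,
        fun v a u w => Λ.innerAt_smul_left v a u w⟩, fun v u => hc' v u⟩
    · rintro ⟨hfD, hfT⟩
      simp only [hT, Set.mem_inter_iff, Set.mem_iInter, Set.mem_ofPred_eq] at hfT
      obtain ⟨⟨⟨h1, h2⟩, h3⟩, h4⟩ := hfT
      obtain ⟨Λ, hΛ⟩ := exists_innerAt_eq f h1 h2 h3
        fun v u hu => (hc v u hu).trans_le (h4 v u)
      refine ⟨Λ, ⟨fun v u w => ?_, fun v u => ?_⟩, ?_⟩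
      · rw [hΛ]
        simpa using hfD v trivial u trivial w trivial
      · rw [hΛ]
        exact h4 v u
      · funext v u w
        exact hΛ v u w
  rw [himg]
  exact hDc.inter_right hTc

end OKLattice

end Compact

end ArakelovLattice
end

noncomputable section
namespace ArakelovLattice

/-! ### Compactness of sets of lattices of bounded polygon -/

section LatticeCompact

variable {K : Type*} [Field K] [NumberField K]
variable {P : Type*} [AddCommGroup P] [Module (𝓞 K) P]

namespace OKLattice

variable (Λ : OKLattice K P)

theorem norm_innerAt_le (v : InfinitePlace K) (u w : LocalSpace K P v) :
    ‖Λ.innerAt v u w‖ ≤ √(Completion.extensionEmbedding v (Λ.innerAt v u u)).re *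
      √(Completion.extensionEmbedding v (Λ.innerAt v w w)).re := by
  let := completionRCLike v
  let : NormedAddCommGroup (LocalSpace K P v) := (Λ v).toNormedAddCommGroup
  let : InnerProductSpace v.Completion (LocalSpace K P v) := InnerProductSpace.ofCore (Λ v).toCore
  have h := norm_inner_le_norm (𝕜 := v.Completion) u w
  rw [norm_eq_sqrt_re_inner (𝕜 := v.Completion) u, norm_eq_sqrt_re_inner (𝕜 := v.Completion) w] at h
  exact h

theorem re_innerAt_add_le (v : InfinitePlace K) (u w : LocalSpace K P v) :
    (Completion.extensionEmbedding v (Λ.innerAt v (u + w) (u + w))).re ≤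
      2 * (Completion.extensionEmbedding v (Λ.innerAt v u u)).re +
        2 * (Completion.extensionEmbedding v (Λ.innerAt v w w)).re := by
  have h := Λ.re_innerAt_self_nonneg v (u + (-1 : v.Completion) • w)
  rw [innerAt_add_left, innerAt_add_right, innerAt_add_right] at h
  rw [innerAt_add_left, innerAt_add_right, innerAt_add_right]
  simp only [innerAt_smul_left, innerAt_smul_right, map_add, map_mul, extensionEmbedding_conjHom,
    map_neg, map_one, Complex.add_re, neg_mul, one_mul, Complex.neg_re] at h ⊢
  linarith

variable [Module.Finite (𝓞 K) P] [Module.IsTorsionFree (𝓞 K) P]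

theorem covol_top_eq_exp : Λ.covol ⊤ = Real.exp (finrank (𝓞 K) P *
    (Real.log |(discr K : ℝ)| / 2 - nrComplexPlaces K * Real.log 2) - Λ.deg) := by
  rw [← degAt_top, degAt, deg_restrict, finrank_top, sub_sub_cancel, Real.exp_log (Λ.covol_pos _)]

/-- The inner products of the lattices for which the members of a basis have bounded norm are
bounded. -/
theorem exists_re_innerAt_le {r : ℕ} (hr : finrank (𝓞 K) P = r) {y : Fin r → P}
    (hy : LinearIndependent (𝓞 K) y) (R : ℝ) (v : InfinitePlace K) (u : LocalSpace K P v) :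
    ∃ b : ℝ, ∀ Λ : OKLattice K P, (∀ j, ‖Λ.toAmbient (y j)‖ ≤ R) →
      (Completion.extensionEmbedding v (Λ.innerAt v u u)).re ≤ b := by
  let S : Submodule v.Completion (LocalSpace K P v) :=
    { carrier := {u | ∃ b : ℝ, ∀ Λ : OKLattice K P, (∀ j, ‖Λ.toAmbient (y j)‖ ≤ R) →
        (Completion.extensionEmbedding v (Λ.innerAt v u u)).re ≤ b}
      zero_mem' := by
        refine ⟨0, fun Λ _ => ?_⟩
        have h := Λ.re_innerAt_smul v 0 0
        rw [zero_smul, norm_zero] at h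
        rw [h]
        simp
      add_mem' := by
        rintro u w ⟨b, hb⟩ ⟨c, hc⟩
        refine ⟨2 * b + 2 * c, fun Λ hΛ => (Λ.re_innerAt_add_le v u w).trans ?_⟩
        linarith [hb Λ hΛ, hc Λ hΛ]
      smul_mem' := by
        rintro a u ⟨b, hb⟩
        refine ⟨‖a‖ ^ 2 * b, fun Λ hΛ => ?_⟩
        rw [re_innerAt_smul]
        exact mul_le_mul_of_nonneg_left (hb Λ hΛ) (by positivity) }
  have h1 (j : Fin r) : (1 : v.Completion) ⊗ₜ[𝓞 K] y j ∈ S := by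
    refine ⟨R ^ 2, fun Λ hΛ => ?_⟩
    refine le_trans ?_ (pow_le_pow_left₀ (norm_nonneg _) (hΛ j) 2)
    rw [norm_sq_ambient]
    exact Finset.single_le_sum (f := fun v => (Completion.extensionEmbedding v
      (Λ.innerAt v (Λ.toAmbient (y j) v) (Λ.toAmbient (y j) v))).re)
      (fun v _ => Λ.re_innerAt_self_nonneg v _) (Finset.mem_univ v)
  have h2 (x : P) : (1 : v.Completion) ⊗ₜ[𝓞 K] x ∈ S := by
    have hx : x ∈ saturation (Submodule.span (𝓞 K) (Set.range y)) := by
      rw [saturation_span_eq_top hr hy]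
      trivial
    obtain ⟨a, ha, hax⟩ := hx
    obtain ⟨c, hc⟩ := (Submodule.mem_span_range_iff_exists_fun _).1 hax
    have ha' : algebraMap (𝓞 K) v.Completion a ≠ 0 := by
      rw [IsScalarTower.algebraMap_apply (𝓞 K) K v.Completion]
      exact (map_ne_zero _).2 (by simpa using ha)
    rw [← S.smul_mem_iff ha', algebraMap_smul, ← TensorProduct.tmul_smul, ← hc,
      TensorProduct.tmul_sum]
    refine S.sum_mem fun j _ => ?_
    rw [TensorProduct.tmul_smul, ← algebraMap_smul v.Completion]
    exact S.smul_mem _ (h1 j)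
  have h3 : u ∈ S := by
    induction u using TensorProduct.induction_on with
    | zero => exact S.zero_mem
    | tmul a x =>
      rw [← mul_one a, ← smul_eq_mul, ← TensorProduct.smul_tmul']
      exact S.smul_mem a (h2 x)
    | add u w hu hw => exact S.add_mem hu hw
  exact h3

open Classical in
/-- An element of `V_v`, viewed in `∏ v, V_v`. -/
def ambientSingle (v : InfinitePlace K) (u : LocalSpace K P v) : Λ.Ambient :=
  (Pi.single v u : ∀ v, LocalSpace K P v)

theorem norm_sq_ambientSingle (v : InfinitePlace K) (u : LocalSpace K P v) :
    ‖Λ.ambientSingle v u‖ ^ 2 = (Completion.extensionEmbedding v (Λ.innerAt v u u)).re := by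
  rw [norm_sq_ambient, Finset.sum_eq_single v]
  · rw [show Λ.ambientSingle v u v = u by classical exact Pi.single_eq_same _ _]
  · intro w _ hw
    rw [show Λ.ambientSingle v u w = 0 by classical exact Pi.single_eq_of_ne hw _]
    have h := Λ.re_innerAt_smul w 0 0
    rw [zero_smul, norm_zero] at h
    rw [h]
    simp
  · simp

/-- The inner products of the lattices of given degree for which the members of a basis have
bounded norm are bounded away from `0`. -/
theorem exists_le_re_innerAt {r : ℕ} (hr : finrank (𝓞 K) P = r) {y : Fin r → P}
    (hy : LinearIndependent (𝓞 K) y) (R d : ℝ) (v : InfinitePlace K) {u : LocalSpace K P v}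
    (hu : u ≠ 0) :
    ∃ c : ℝ, 0 < c ∧ ∀ Λ : OKLattice K P, Λ.deg = d → (∀ j, ‖Λ.toAmbient (y j)‖ ≤ R) →
      c ≤ (Completion.extensionEmbedding v (Λ.innerAt v u u)).re := by
  classical
  by_cases hne : Nonempty (OKLattice K P)
  swap
  · exact ⟨1, one_pos, fun Λ => (hne ⟨Λ⟩).elim⟩
  obtain ⟨Λ₀⟩ := hne
  set δ := Real.exp (finrank (𝓞 K) P *
    (Real.log |(discr K : ℝ)| / 2 - nrComplexPlaces K * Real.log 2) - d) with hδ
  obtain ⟨C, hC, h⟩ := exists_abs_coeff_le (Free.ChooseBasisIndex ℤ (𝓞 K) × Fin r)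
    (basisBound K * R) (δ ^ 2) (by positivity)
  have hspan : Λ₀.ambientSingle v u ∈ Submodule.span ℝ
      (Set.range fun q : Free.ChooseBasisIndex ℤ (𝓞 K) × Fin r =>
        Λ₀.toAmbient (RingOfIntegers.basis K q.1 • y q.2)) := by
    refine Λ₀.realSpan_le_span_smul (W := ⊤) hy (fun _ => trivial) (by rw [finrank_top, hr]) ?_
    have h1 : Λ₀.realSpan ⊤ = ⊤ := by
      rw [eq_top_iff, ← Λ₀.span_range_toAmbient, Submodule.span_le]
      rintro _ ⟨x, rfl⟩
      exact Λ₀.toAmbient_mem_realSpan trivial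
    rw [h1]
    trivial
  -- The real coordinates `t` of `u` do not depend on the forms, so those found with the auxiliary
  -- lattice `Λ₀` serve every `Λ`.
  obtain ⟨t, ht⟩ := (Submodule.mem_span_range_iff_exists_fun ℝ).1 hspan
  have htne : ∃ q, t q ≠ 0 := by
    by_contra hall
    push Not at hall
    rw [Finset.sum_eq_zero fun q _ => by rw [hall q, zero_smul]] at ht
    have h2 := Λ₀.norm_sq_ambientSingle v u
    rw [← ht, norm_zero, zero_pow two_ne_zero] at h2
    exact hu (Λ₀.eq_zero_of_re_innerAt_self v u h2.symm)
  obtain ⟨q, hq⟩ := htne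
  refine ⟨(|t q| / C) ^ 2, by positivity, fun Λ hd hR => ?_⟩
  have h1 := h (fun q : Free.ChooseBasisIndex ℤ (𝓞 K) × Fin r =>
        Λ.toAmbient (RingOfIntegers.basis K q.1 • y q.2)) (fun q =>
      (Λ.norm_toAmbient_basis_smul_le q.1 (y q.2)).trans
        (mul_le_mul_of_nonneg_left (hR _) (basisBound_nonneg K))) (by
      -- The Gram determinant of the `ω_i y_j` is the squared covolume of their span, at least that
      -- of the whole lattice, which the degree fixes.
      have h2 := Λ.covol_span_sq hy
      refine le_trans ?_ (h2.le.trans_eq (by congr!))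
      refine pow_le_pow_left₀ (by positivity) ?_ 2
      rw [hδ, ← hd, ← covol_top_eq_exp]
      exact Λ.covol_top_le_covol _ (by rw [finrank_span_eq_card hy, Fintype.card_fin, hr])) t q
  have h3 : ∑ q : Free.ChooseBasisIndex ℤ (𝓞 K) × Fin r,
      t q • Λ.toAmbient (RingOfIntegers.basis K q.1 • y q.2) = Λ.ambientSingle v u := ht
  rw [h3] at h1
  rw [← norm_sq_ambientSingle]
  refine pow_le_pow_left₀ (by positivity) ?_ 2
  rw [div_le_iff₀' hC]
  exact h1

/-- The lattices of given degree for which the members of a basis have bounded norm form a compact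
set. -/
theorem isCompact_setOf_norm_le {r : ℕ} (hr : finrank (𝓞 K) P = r) {y : Fin r → P}
    (hy : LinearIndependent (𝓞 K) y) (R d : ℝ) :
    IsCompact {Λ : OKLattice K P | Λ.deg = d ∧ ∀ j, ‖Λ.toAmbient (y j)‖ ≤ R} := by
  classical
  choose b hb using fun v u => exists_re_innerAt_le hr hy R v u
  choose c hc0 hc using fun v (u : {u : LocalSpace K P v // u ≠ 0}) =>
    exists_le_re_innerAt hr hy R d v u.2
  refine (isCompact_box (fun v u w => √(b v u) * √(b v w))
    (fun v u => if h : u ≠ 0 then c v ⟨u, h⟩ else 0) fun v u hu => ?_).of_isClosed_subset ?_ ?_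
  · rw [dif_pos hu]
    exact hc0 v ⟨u, hu⟩
  · simp only [Set.ofPred_and, Set.ofPred_forall]
    exact (isClosed_eq continuous_deg continuous_const).inter
      (isClosed_iInter fun j => isClosed_le (continuous_norm_toAmbient _) continuous_const)
  · rintro Λ ⟨hd, hR⟩
    refine ⟨fun v u w => (Λ.norm_innerAt_le v u w).trans ?_, fun v u => ?_⟩
    · exact mul_le_mul (Real.sqrt_le_sqrt (hb v u Λ hR)) (Real.sqrt_le_sqrt (hb v w Λ hR))
        (Real.sqrt_nonneg _) (Real.sqrt_nonneg _)
    · split_ifs with h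
      · exact hc v ⟨u, h⟩ Λ hd hR
      · exact Λ.re_innerAt_self_nonneg v u

/-- Makes the degree of each saturated submodule visible as a vertex of some polygon, so that
polygon bounds become degree bounds. -/
theorem exists_isSaturatedFiltration (hr : 0 < finrank (𝓞 K) P) {W : Submodule (𝓞 K) P}
    (hW : IsSaturated W) : ∃ (n : ℕ) (F : Fin (n + 1) → Submodule (𝓞 K) P) (i : Fin (n + 1)),
      IsSaturatedFiltration F ∧ F i = W := by
  have hne : (⊥ : Submodule (𝓞 K) P) < ⊤ := by
    refine bot_lt_iff_ne_bot.2 fun h => hr.ne' ?_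
    rw [← finrank_top (𝓞 K) P, h, finrank_bot]
  have h0 : IsSaturatedFiltration (n := 1) (![⊥, ⊤] : Fin 2 → Submodule (𝓞 K) P) :=
    ⟨rfl, rfl, Fin.strictMono_iff_lt_succ.2 fun i => by fin_cases i; exact hne, fun i => by
      fin_cases i
      · exact isSaturated_bot
      · exact isSaturated_top⟩
  by_cases h1 : W = ⊥
  · exact ⟨1, _, 0, h0, h1.symm⟩
  by_cases h2 : W = ⊤
  · exact ⟨1, _, 1, h0, h2.symm⟩
  refine ⟨2, ![⊥, W, ⊤], 1, ⟨rfl, rfl, Fin.strictMono_iff_lt_succ.2 fun i => ?_, fun i => ?_⟩, rfl⟩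
  · fin_cases i
    · exact bot_lt_iff_ne_bot.2 h1
    · exact lt_top_iff_ne_top.2 h2
  · fin_cases i
    · exact isSaturated_bot
    · exact hW
    · exact isSaturated_top

theorem PolygonsLE.degAt_le {Λ : OKLattice K P} {p : ℝ → ℝ} (h : Λ.PolygonsLE p)
    (hr : 0 < finrank (𝓞 K) P) {W : Submodule (𝓞 K) P} (hW : IsSaturated W) :
    Λ.degAt W - finrank (𝓞 K) W * (Λ.deg / finrank (𝓞 K) P) ≤ p (finrank (𝓞 K) W) := by
  obtain ⟨n, F, i, hF, rfl⟩ := exists_isSaturatedFiltration hr hW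
  rw [← polygon_finrank hF]
  exact h n F hF _ ⟨by positivity, by exact_mod_cast Submodule.finrank_le _⟩

end OKLattice

/-- A bound for the values of `p` at the integers in `[0, r]`. -/
def integralBound (p : ℝ → ℝ) (r : ℕ) : ℝ := ∑ k ∈ Finset.range (r + 1), |p k|

theorem abs_le_integralBound (p : ℝ → ℝ) {r k : ℕ} (hk : k ≤ r) : |p k| ≤ integralBound p r :=
  Finset.single_le_sum (f := fun k : ℕ => |p k|) (fun _ _ => abs_nonneg _)
    (Finset.mem_range.2 (Nat.lt_succ_of_le hk))

namespace OKLattice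

variable [Module.Finite (𝓞 K) P] [Module.IsTorsionFree (𝓞 K) P]

variable (K) in
/-- The constant comparing the covolumes of submodules whose degrees differ by at most `M`. -/
def covolBound (r : ℕ) (M : ℝ) : ℝ :=
  Real.exp (M + r * |Real.log |(discr K : ℝ)| / 2 - nrComplexPlaces K * Real.log 2|)

/-- With degree zero, the polygon bound says that every saturated `W` of rank `k` has degree at most
`p k`; this bounds `covol ⊤ / covol W`, so the whole module can be used at every step of the
construction. -/
theorem PolygonsLE.exists_bounded_family {Λ : OKLattice K P} {p : ℝ → ℝ} (h : Λ.PolygonsLE p)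
    {r : ℕ} (hr0 : 0 < r) (hr : finrank (𝓞 K) P = r) (hd : Λ.deg = 0) :
    ∃ x : Fin r → P, LinearIndependent (𝓞 K) x ∧ ∀ j, ‖Λ.toAmbient (x j)‖ ≤
      familyBound K r (covolBound K r (integralBound p r)) r := by
  have H : ∀ k < r, ∀ x : Fin k → P, LinearIndependent (𝓞 K) x → (∀ j : Fin k, x j ∈ (⊤ : Submodule (𝓞 K) P)) →
      saturation (Submodule.span (𝓞 K) (Set.range x)) < ⊤ ∧ Λ.covol ⊤ ≤
        covolBound K r (integralBound p r) *
          Λ.covol (saturation (Submodule.span (𝓞 K) (Set.range x))) := by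
    intro k hk x hx _
    have hrk := finrank_saturation_span hx
    set W := saturation (Submodule.span (𝓞 K) (Set.range x)) with hW
    refine ⟨lt_top_iff_ne_top.2 fun hWt => ?_, Λ.covol_le_exp_mul_covol hr.le ?_⟩
    · rw [hWt, finrank_top, hr] at hrk
      exact hk.ne' hrk
    · have h1 := h.degAt_le (by omega) (isSaturated_saturation _ : IsSaturated W)
      rw [hd, zero_div, mul_zero, sub_zero, hrk] at h1
      rw [degAt_top, hd, sub_zero]
      exact h1.trans ((le_abs_self _).trans (abs_le_integralBound p hk.le))
  obtain ⟨x, hx, -, hR⟩ := Λ.exists_adapted_family hr.le (fun _ => ⊤) H r le_rfl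
  exact ⟨x, hx, hR⟩

/-- The set is the image of a compact one: the closed condition intersected with a finite union of
compact sets, one for each representative family. Scaling normalizes the degree, and an automorphism
carries a short family to a representative. -/
theorem isCompact_polygonsLE {r : ℕ} (hr0 : 0 < r) (hr : finrank (𝓞 K) P = r) (p : ℝ → ℝ) :
    IsCompact (toSpace '' {Λ : OKLattice K P | Λ.PolygonsLE p}) := by
  set R := familyBound K r (covolBound K r (integralBound p r)) r with hR
  set δ := Real.exp (finrank (𝓞 K) P *
    (Real.log |(discr K : ℝ)| / 2 - nrComplexPlaces K * Real.log 2) - 0) with hδ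
  have hM : (indexBound K r R δ).factorial ≠ 0 := Nat.factorial_ne_zero _
  obtain ⟨S, hSfin, hS, hSx⟩ := exists_finite_representatives K P r hM
  have hcomp : IsCompact ((⋃ y ∈ S, {Λ : OKLattice K P | Λ.deg = 0 ∧
      ∀ j, ‖Λ.toAmbient (y j)‖ ≤ R}) ∩ {Λ : OKLattice K P | Λ.PolygonsLE p}) :=
    (hSfin.isCompact_biUnion fun y hy => isCompact_setOf_norm_le hr (hS y hy).1 R 0).inter_right
      (isClosed_polygonsLE p)
  have hcont : Continuous (toSpace : OKLattice K P → LatticeSpace K P) := continuous_quotient_mk'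
  convert hcomp.image hcont using 1
  refine Set.Subset.antisymm ?_ (Set.image_mono Set.inter_subset_right)
  rintro _ ⟨Λ, hΛ, rfl⟩
  have hn : 0 < finrank ℚ K := finrank_pos
  -- Scaling by `T` lowers the degree by `[K : ℚ] * r * log T`, so this value makes it zero.
  set T := Real.exp (Λ.deg / (finrank ℚ K * r)) with hT
  have hT0 : 0 < T := Real.exp_pos _
  have hd : (Λ.scale T hT0).deg = 0 := by
    rw [deg_scale, hT, Real.log_exp, hr]
    field_simp
    ring
  have hΛ1 : (Λ.scale T hT0).PolygonsLE p := PolygonsLE.scale hΛ hT0 (by omega)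
  obtain ⟨x, hx, hxR⟩ := hΛ1.exists_bounded_family hr0 hr hd
  obtain ⟨m, hm0, hm, hspan⟩ := (Λ.scale T hT0).exists_smul_mem_span hr hx hxR
    (Real.exp_pos _) (le_of_eq (by rw [covol_top_eq_exp, hd]) : δ ≤ _)
  -- The index `m` varies with the lattice, but it divides the factorial of its bound, a multiplier
  -- common to all.
  obtain ⟨A, hA⟩ := hSx x hx fun q => by
    obtain ⟨c, hc⟩ := Nat.dvd_factorial hm0 hm
    rw [hc, mul_comm, mul_smul]
    exact Submodule.smul_of_tower_mem _ c (hspan q)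
  refine ⟨(Λ.scale T hT0).act A, ⟨Set.mem_biUnion hA ⟨?_, fun j => ?_⟩, hΛ1.act A⟩, ?_⟩
  · rw [deg_act, hd]
  · rw [norm_toAmbient_act]
    exact hxR j
  · exact (Quotient.sound (s := latticeSetoid K P)
      ⟨A, T, hT0, OKLattice.ext fun v u w => rfl⟩ : toSpace Λ = _).symm

theorem isCompact_canonical {r : ℕ} (hr0 : 0 < r) (hr : finrank (𝓞 K) P = r) (p : ℝ → ℝ) :
    IsCompact {x : LatticeSpace K P | ∃ Λ : OKLattice K P, Λ.toSpace = x ∧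
      ∃ (n : ℕ) (F : Fin (n + 1) → Submodule (𝓞 K) P), Λ.IsCanonicalFiltration F ∧
        ∀ s ∈ Set.Icc (0 : ℝ) r, Λ.polygon F s ≤ p s} := by
  convert isCompact_polygonsLE hr0 hr p using 1
  ext x
  constructor
  · rintro ⟨Λ, rfl, h⟩
    rw [← hr] at h
    exact ⟨Λ, (Λ.exists_canonical_polygon_le_iff (by omega) p).1 h, rfl⟩
  · rintro ⟨Λ, h, rfl⟩
    refine ⟨Λ, rfl, ?_⟩
    rw [← hr]
    exact (Λ.exists_canonical_polygon_le_iff (by omega) p).2 h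

end OKLattice

end LatticeCompact

end ArakelovLattice
end

noncomputable section
namespace ArakelovLattice

/-! ### Local and adelic compactness -/

section FinitePlaces

variable {K : Type*} [Field K] [NumberField K]

theorem valued_algebraMap (v : HeightOneSpectrum (𝓞 K)) (x : K) :
    Valued.v (algebraMap K (v.adicCompletion K) x) = v.valuation K x :=
  v.valuedAdicCompletion_eq_valuation' x

theorem algebraMap_mem_integers_iff (v : HeightOneSpectrum (𝓞 K)) (x : K) :
    algebraMap K (v.adicCompletion K) x ∈ v.adicCompletionIntegers K ↔ v.valuation K x ≤ 1 := by
  rw [HeightOneSpectrum.mem_adicCompletionIntegers, valued_algebraMap]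

theorem isOpen_adicCompletionIntegers (v : HeightOneSpectrum (𝓞 K)) :
    IsOpen (v.adicCompletionIntegers K : Set (v.adicCompletion K)) :=
  Valued.isOpen_valuationSubring _

theorem exists_sub_valued_lt_one (v : HeightOneSpectrum (𝓞 K)) (y : v.adicCompletion K) :
    ∃ c : K, Valued.v (y - algebraMap K (v.adicCompletion K) c) < 1 := by
  have hopen : IsOpen {z : v.adicCompletion K | Valued.v (y - z) < 1} :=
    by
      have h := (Valued.isOpen_ball (v.adicCompletion K) 1).preimage
        (continuous_const.sub continuous_id : Continuous fun z => y - z)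
      simpa [Valuation.restrict_lt_one_iff] using h
  obtain ⟨c, hc⟩ := (HeightOneSpectrum.denseRange_algebraMap (K := K) v).exists_mem_open hopen
    ⟨y, by simp⟩
  exact ⟨c, hc⟩

/-- Density of `K` makes the finite ring `𝓞 K / v` surject onto the residue field of the completion.
-/
theorem finite_residueField (v : HeightOneSpectrum (𝓞 K)) :
    Finite (IsLocalRing.ResidueField (v.adicCompletionIntegers K)) := by
  let f : 𝓞 K →+* IsLocalRing.ResidueField (v.adicCompletionIntegers K) :=
    (IsLocalRing.residue _).comp (algebraMap (𝓞 K) (v.adicCompletionIntegers K))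
  have hlt (x : v.adicCompletionIntegers K) (hx : Valued.v (x : v.adicCompletion K) < 1) :
      IsLocalRing.residue _ x = 0 := by
    rw [IsLocalRing.residue_eq_zero_iff, IsLocalRing.mem_maximalIdeal, mem_nonunits_iff,
      HeightOneSpectrum.adicCompletionIntegers.isUnit_iff_valued_eq_one]
    exact hx.ne
  have hker (a : 𝓞 K) (ha : a ∈ v.asIdeal) : f a = 0 := by
    refine hlt _ ?_
    change Valued.v (algebraMap K (v.adicCompletion K) (algebraMap (𝓞 K) K a)) < 1
    rw [valued_algebraMap]
    exact (v.valuation_lt_one_iff_mem a).2 ha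
  have hfin : Finite (𝓞 K ⧸ v.asIdeal) := Ideal.finiteQuotientOfFreeOfNeBot _ v.ne_bot
  refine Finite.of_surjective (Ideal.Quotient.lift v.asIdeal f hker) fun y => ?_
  obtain ⟨x, rfl⟩ := IsLocalRing.residue_surjective y
  obtain ⟨c, hc⟩ := exists_sub_valued_lt_one v (x : v.adicCompletion K)
  have hc1 : v.valuation K c ≤ 1 := by
    rw [← valued_algebraMap]
    have h := Valuation.map_sub Valued.v (x : v.adicCompletion K)
      ((x : v.adicCompletion K) - algebraMap K (v.adicCompletion K) c)
    rw [sub_sub_cancel] at h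
    exact h.trans (max_le x.2 hc.le)
  obtain ⟨a, ha⟩ := HeightOneSpectrum.exists_valuation_sub_lt_of_integer v hc1 1
  refine ⟨Ideal.Quotient.mk _ a, ?_⟩
  rw [Ideal.Quotient.lift_mk]
  refine sub_eq_zero.1 ?_
  change IsLocalRing.residue _ (algebraMap (𝓞 K) (v.adicCompletionIntegers K) a) -
    IsLocalRing.residue _ x = 0
  rw [← map_sub]
  refine hlt _ ?_
  change Valued.v (algebraMap K (v.adicCompletion K) (algebraMap (𝓞 K) K a) - x) < 1
  have h : algebraMap K (v.adicCompletion K) (algebraMap (𝓞 K) K a) - (x : v.adicCompletion K) =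
      algebraMap K (v.adicCompletion K) (algebraMap (𝓞 K) K a - c) -
        ((x : v.adicCompletion K) - algebraMap K (v.adicCompletion K) c) := by
    rw [map_sub]; ring
  rw [h]
  refine (Valuation.map_sub Valued.v _ _).trans_lt (max_lt ?_ hc)
  rw [valued_algebraMap]
  exact_mod_cast ha

theorem isCompact_adicCompletionIntegers (v : HeightOneSpectrum (𝓞 K)) :
    IsCompact (v.adicCompletionIntegers K : Set (v.adicCompletion K)) := by
  rw [isCompact_iff_compactSpace]
  have hclosed : IsClosed (v.adicCompletionIntegers K : Set (v.adicCompletion K)) :=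
    Valued.isClosed_valuationSubring _
  have h1 : CompleteSpace (Valued.integer (v.adicCompletion K)) :=
    hclosed.completeSpace_coe
  have h2 : IsDiscreteValuationRing (Valued.integer (v.adicCompletion K)) :=
    inferInstanceAs (IsDiscreteValuationRing (v.adicCompletionIntegers K))
  have h3 : Finite (IsLocalRing.ResidueField (Valued.integer (v.adicCompletion K))) :=
    finite_residueField v
  exact Valued.integer.compactSpace_iff_completeSpace_and_isDiscreteValuationRing_and_finite_residueField.2
    ⟨h1, h2, h3⟩

theorem isCompact_integralAdeles :
    IsCompact {a : FiniteAdeleRing (𝓞 K) K | ∀ v, a v ∈ v.adicCompletionIntegers K} := by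
  have : ∀ v : HeightOneSpectrum (𝓞 K), CompactSpace (v.adicCompletionIntegers K) := fun v =>
    isCompact_iff_compactSpace.1 (isCompact_adicCompletionIntegers v)
  have h := isCompact_range (RestrictedProduct.isEmbedding_structureMap
    (R := fun v : HeightOneSpectrum (𝓞 K) => v.adicCompletion K)
    (A := fun v : HeightOneSpectrum (𝓞 K) => (v.adicCompletionIntegers K : Set (v.adicCompletion K)))
    (𝓕 := Filter.cofinite)).continuous
  rw [RestrictedProduct.range_structureMap] at h
  exact h

theorem isOpen_integralAdeles :
    IsOpen {a : FiniteAdeleRing (𝓞 K) K | ∀ v, a v ∈ v.adicCompletionIntegers K} :=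
  RestrictedProduct.isOpen_forall_mem fun v => isOpen_adicCompletionIntegers v

instance : T2Space (FiniteAdeleRing (𝓞 K) K) :=
  inferInstanceAs (T2Space (RestrictedProduct
    (fun v : HeightOneSpectrum (𝓞 K) => v.adicCompletion K)
    (fun v => (v.adicCompletionIntegers K : Set (v.adicCompletion K))) Filter.cofinite))

instance : T2Space (InfiniteAdeleRing K) :=
  inferInstanceAs (T2Space (∀ v : InfinitePlace K, v.Completion))

instance : T2Space (AdeleRing (𝓞 K) K) :=
  inferInstanceAs (T2Space (InfiniteAdeleRing K × FiniteAdeleRing (𝓞 K) K))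

theorem continuous_infiniteComponent (v : InfinitePlace K) :
    Continuous (infiniteComponent v : AdeleRing (𝓞 K) K → v.Completion) :=
  (continuous_apply v).comp continuous_fst

theorem isCompact_adeleBox (B : ℝ) {M : ℕ} (hM : M ≠ 0) :
    IsCompact {a : AdeleRing (𝓞 K) K | (∀ v, ‖infiniteComponent v a‖ ≤ B) ∧
      ∀ v, (M : v.adicCompletion K) * finiteComponent v a ∈ v.adicCompletionIntegers K} := by
  have h1 : IsCompact {a : InfiniteAdeleRing K | ∀ v, ‖a v‖ ≤ B} := by
    have h := isCompact_univ_pi fun v : InfinitePlace K => isCompact_closedBall_completion v B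
    refine h.of_isClosed_subset ?_ fun a ha v _ => by simpa using ha v
    simp only [Set.ofPred_forall]
    exact isClosed_iInter fun v => isClosed_le
      (continuous_norm.comp (continuous_apply (A := fun v : InfinitePlace K => v.Completion) v))
      continuous_const
  have hM' : (M : K) ≠ 0 := by exact_mod_cast hM
  let u : (FiniteAdeleRing (𝓞 K) K)ˣ := FiniteAdeleRing.unitEmbedding (𝓞 K) K (Units.mk0 (M : K) hM')
  have hu (a : FiniteAdeleRing (𝓞 K) K) (v : HeightOneSpectrum (𝓞 K)) :
      ((u : FiniteAdeleRing (𝓞 K) K) * a) v = (M : v.adicCompletion K) * a v := by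
    rw [← map_natCast (algebraMap K (v.adicCompletion K))]
    rfl
  have h2 : IsCompact {a : FiniteAdeleRing (𝓞 K) K |
      ∀ v, (M : v.adicCompletion K) * a v ∈ v.adicCompletionIntegers K} := by
    -- Since `M` is invertible in the finite adeles, the set is a homothetic image of the integral
    -- adeles.
    have h := (isCompact_integralAdeles (K := K)).image
      (continuous_const_mul (↑u⁻¹ : FiniteAdeleRing (𝓞 K) K))
    convert h using 1
    ext a
    constructor
    · intro ha
      exact ⟨u * a, fun v => by rw [hu]; exact ha v, by simp⟩
    · rintro ⟨b, hb, rfl⟩ v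
      have h1 : (u : FiniteAdeleRing (𝓞 K) K) * (↑u⁻¹ * b) = b := by simp
      have h2 := hb v
      rw [← h1, hu] at h2
      exact h2
  exact h1.prod h2

end FinitePlaces

end ArakelovLattice
end

noncomputable section
namespace ArakelovLattice

/-! ### Compact sets in the general linear group of a topological ring -/

section MatrixCompact

/-- The unit group carries the topology of the closed embedding `g ↦ (g, g⁻¹)`, so both the matrix
and its inverse have to be confined. -/
theorem isCompact_units_matrix {R : Type*} [CommRing R] [TopologicalSpace R] [IsTopologicalRing R]
    [T2Space R] {r : ℕ} {S : Set R} (hS : IsCompact S) :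
    IsCompact {g : GL (Fin r) R | ∀ i j, g.val i j ∈ S ∧ (g⁻¹).val i j ∈ S} := by
  have h1 : IsCompact {m : Matrix (Fin r) (Fin r) R | ∀ i j, m i j ∈ S} := by
    have h := isCompact_univ_pi fun _ : Fin r => isCompact_univ_pi fun _ : Fin r => hS
    have heq : {m : Matrix (Fin r) (Fin r) R | ∀ i j, m i j ∈ S} =
        (Set.pi Set.univ fun _ : Fin r => Set.pi Set.univ fun _ : Fin r => S) :=
      Set.ext fun m => ⟨fun h i _ j _ => h i j, fun h i j => h i trivial j trivial⟩
    rw [heq]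
    exact h
  have h2 := (Units.isClosedEmbedding_embedProduct (α := Matrix (Fin r) (Fin r) R)).isCompact_preimage
    (h1.prod (MulOpposite.opHomeomorph.symm.isCompact_preimage.2 h1))
  convert h2 using 1
  ext g
  exact ⟨fun h => ⟨fun i j => (h i j).1, fun i j => (h i j).2⟩, fun h i j => ⟨h.1 i j, h.2 i j⟩⟩

end MatrixCompact

/-! ### Approximation and common denominators at the finite places -/

section Approximation

variable {K : Type*} [Field K] [NumberField K]

/-- For `i ∈ I` outside `v`, the product `c * i` is a multiple of `b`; so `c / b` has the
denominator `i`, a unit at `v`. -/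
theorem exists_div_valuation_le_one {a b c : 𝓞 K} {J I : Ideal (𝓞 K)} (hb : b ≠ 0)
    (hJI : J * I = Ideal.span {b}) (hc : c ∈ J) {v : HeightOneSpectrum (𝓞 K)}
    (hI : ¬ I ≤ v.asIdeal) :
    v.valuation K (algebraMap (𝓞 K) K a * algebraMap (𝓞 K) K c / algebraMap (𝓞 K) K b) ≤ 1 := by
  obtain ⟨i, hi, hiv⟩ := SetLike.not_le_iff_exists.1 hI
  have h1 : c * i ∈ Ideal.span {b} := hJI ▸ Ideal.mul_mem_mul hc hi
  obtain ⟨q, hq⟩ := Ideal.mem_span_singleton'.1 h1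
  have hi0 : i ≠ 0 := fun h => hiv (h ▸ zero_mem _)
  have hb' : algebraMap (𝓞 K) K b ≠ 0 := by simpa using hb
  have hi' : algebraMap (𝓞 K) K i ≠ 0 := by simpa using hi0
  have h2 : algebraMap (𝓞 K) K a * algebraMap (𝓞 K) K c / algebraMap (𝓞 K) K b =
      algebraMap (𝓞 K) K (a * q) / algebraMap (𝓞 K) K i := by
    rw [div_eq_div_iff hb' hi', ← map_mul, ← map_mul, ← map_mul, mul_assoc, ← hq]
    congr 1
    ring
  rw [h2, map_div₀, v.valuation_eq_one_iff_notMem.2 hiv, div_one]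
  exact v.valuation_le_one _

/-- An element of `K_v` is congruent modulo the integers to an element of `K` that is integral at
all other places. -/
theorem exists_sub_mem_integers (v : HeightOneSpectrum (𝓞 K)) (y : v.adicCompletion K) :
    ∃ c : K, y - algebraMap K (v.adicCompletion K) c ∈ v.adicCompletionIntegers K ∧
      ∀ w : HeightOneSpectrum (𝓞 K), w ≠ v → w.valuation K c ≤ 1 := by
  obtain ⟨c, hc⟩ := exists_sub_valued_lt_one v y
  obtain ⟨a, b, hb, rfl⟩ := IsFractionRing.div_surjective (A := 𝓞 K) c
  have hb0 : b ≠ 0 := nonZeroDivisors.ne_zero hb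
  have hspan : Ideal.span {b} ≠ (⊥ : Ideal (𝓞 K)) := by simpa using hb0
  obtain ⟨J, hbJ, hJ⟩ := (FiniteMultiplicity.of_prime_left (a := v.asIdeal) v.prime hspan).exists_eq_pow_mul_and_not_dvd
  set n := multiplicity v.asIdeal (Ideal.span {b})
  have hJv : ¬ J ≤ v.asIdeal := fun h => hJ (Ideal.dvd_iff_le.2 h)
  have hsup : v.asIdeal ^ n ⊔ J = ⊤ := by
    have h1 : IsCoprime v.asIdeal J := by
      rw [Ideal.isCoprime_iff_sup_eq]
      exact v.isMaximal.1.2 _ (lt_of_le_of_ne le_sup_left fun h => hJv (h ▸ le_sup_right))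
    exact Ideal.isCoprime_iff_sup_eq.1 h1.pow_left
  -- Partial fractions: `a / b = a s / b + a t / b`, where the first summand is integral at `v` and
  -- the second at all other places. The second is the required element.
  obtain ⟨s, hs, t, ht, hst⟩ := Submodule.mem_sup.1 (hsup ▸ Submodule.mem_top : (1 : 𝓞 K) ∈ _)
  refine ⟨algebraMap (𝓞 K) K a * algebraMap (𝓞 K) K t / algebraMap (𝓞 K) K b, ?_,
    fun w hw => ?_⟩
  · have h1 := exists_div_valuation_le_one (a := a) hb0 hbJ.symm hs hJv
    have h2 : y - algebraMap K (v.adicCompletion K)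
        (algebraMap (𝓞 K) K a * algebraMap (𝓞 K) K t / algebraMap (𝓞 K) K b) =
        (y - algebraMap K (v.adicCompletion K) (algebraMap (𝓞 K) K a / algebraMap (𝓞 K) K b)) +
          algebraMap K (v.adicCompletion K)
            (algebraMap (𝓞 K) K a * algebraMap (𝓞 K) K s / algebraMap (𝓞 K) K b) := by
      have h3 : algebraMap (𝓞 K) K s = 1 - algebraMap (𝓞 K) K t := by
        rw [← map_one (algebraMap (𝓞 K) K), ← hst, map_add, add_sub_cancel_right]
      rw [sub_add, ← map_sub, h3]
      congr 2
      ring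
    rw [h2]
    exact add_mem hc.le ((algebraMap_mem_integers_iff v _).2 h1)
  · refine exists_div_valuation_le_one hb0 (by rw [mul_comm]; exact hbJ.symm) ht fun h => ?_
    exact hw (HeightOneSpectrum.ext (v.isMaximal.eq_of_le w.isPrime.ne_top
      (w.isPrime.le_of_pow_le h)).symm)

theorem exists_mul_mem_integers (a : FiniteAdeleRing (𝓞 K) K) :
    ∃ N : 𝓞 K, N ≠ 0 ∧ ∀ v : HeightOneSpectrum (𝓞 K),
      algebraMap K (v.adicCompletion K) (algebraMap (𝓞 K) K N) * a v ∈
        v.adicCompletionIntegers K := by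
  have hfin : {v : HeightOneSpectrum (𝓞 K) | a v ∉ v.adicCompletionIntegers K}.Finite := a.2
  choose b hb0 hb using fun v : HeightOneSpectrum (𝓞 K) =>
    HeightOneSpectrum.adicCompletion.mul_nonZeroDivisor_mem_adicCompletionIntegers v (a v)
  refine ⟨∏ v ∈ hfin.toFinset, b v, Finset.prod_ne_zero_iff.2 fun v _ =>
    nonZeroDivisors.ne_zero (hb0 v), fun v => ?_⟩
  by_cases hv : a v ∈ v.adicCompletionIntegers K
  · exact mul_mem (HeightOneSpectrum.coe_algebraMap_mem _ _ v _) hv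
  · obtain ⟨c, hc⟩ := Finset.dvd_prod_of_mem b (hfin.mem_toFinset.2 hv)
    rw [hc, map_mul, map_mul, mul_assoc, mul_left_comm]
    refine mul_mem (HeightOneSpectrum.coe_algebraMap_mem _ _ v _) ?_
    rw [mul_comm]
    exact hb v

theorem exists_forall_mul_mem_integers {ι : Type*} [Fintype ι] (a : ι → FiniteAdeleRing (𝓞 K) K) :
    ∃ N : 𝓞 K, N ≠ 0 ∧ ∀ (i : ι) (v : HeightOneSpectrum (𝓞 K)),
      algebraMap K (v.adicCompletion K) (algebraMap (𝓞 K) K N) * a i v ∈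
        v.adicCompletionIntegers K := by
  choose b hb0 hb using fun i => exists_mul_mem_integers (a i)
  refine ⟨∏ i, b i, Finset.prod_ne_zero_iff.2 fun i _ => hb0 i, fun i v => ?_⟩
  obtain ⟨c, hc⟩ := Finset.dvd_prod_of_mem b (Finset.mem_univ i)
  rw [hc, map_mul, map_mul, mul_comm (algebraMap K _ _), mul_assoc]
  exact mul_mem (HeightOneSpectrum.coe_algebraMap_mem _ _ v _) (hb i v)

theorem exists_algebraMap_eq {x : K}
    (h : ∀ v : HeightOneSpectrum (𝓞 K), algebraMap K (v.adicCompletion K) x ∈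
      v.adicCompletionIntegers K) : ∃ a : 𝓞 K, algebraMap (𝓞 K) K a = x :=
  HeightOneSpectrum.mem_integers_of_valuation_le_one K x
    fun v => (algebraMap_mem_integers_iff v x).1 (h v)

end Approximation

end ArakelovLattice
end

noncomputable section
namespace ArakelovLattice

/-! ### The lattices `E_g` -/

section AdelicLattice

variable {K : Type*} [Field K] [NumberField K] {r : ℕ}
variable (g : GL (Fin r) (AdeleRing (𝓞 K) K))

/-- The embedding of `GL_r(K)` in `GL_r(𝔸)`. -/
def diagonal : GL (Fin r) K →* GL (Fin r) (AdeleRing (𝓞 K) K) :=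
  Matrix.GeneralLinearGroup.map (algebraMap K (AdeleRing (𝓞 K) K))

theorem mem_adelicModule_iff (x : Fin r → K) : x ∈ adelicModule g ↔
    ∀ (v : HeightOneSpectrum (𝓞 K)) (i : Fin r), ∑ j, finiteComponent v ((g⁻¹).val i j) *
      algebraMap K (v.adicCompletion K) (x j) ∈ v.adicCompletionIntegers K :=
  Iff.rfl

theorem exists_smul_mem_adelicModule (x : Fin r → K) :
    ∃ a : 𝓞 K, a ≠ 0 ∧ a • x ∈ adelicModule g := by
  obtain ⟨N, hN0, hN⟩ := exists_forall_mul_mem_integers fun i : Fin r =>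
    (∑ j, (g⁻¹).val i j * algebraMap K (AdeleRing (𝓞 K) K) (x j)).2
  refine ⟨N, hN0, (mem_adelicModule_iff g _).2 fun v i => ?_⟩
  have h : ∑ j, finiteComponent v ((g⁻¹).val i j) *
      algebraMap K (v.adicCompletion K) ((N • x) j) =
      algebraMap K (v.adicCompletion K) (algebraMap (𝓞 K) K N) *
        finiteComponent v (∑ j, (g⁻¹).val i j * algebraMap K (AdeleRing (𝓞 K) K) (x j)) := by
    rw [map_sum, Finset.mul_sum]
    refine Finset.sum_congr rfl fun j _ => ?_
    rw [Pi.smul_apply, Algebra.smul_def, map_mul, map_mul, mul_left_comm]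
    rfl
  rw [h]
  exact hN i v

/-- A common denominator of the entries of `g` carries `E_g` into `𝓞 K ^ r`, which gives finite
generation. -/
theorem exists_smul_adelicModule_integral :
    ∃ N : 𝓞 K, N ≠ 0 ∧ ∀ x ∈ adelicModule g, ∀ i, ∃ a : 𝓞 K, algebraMap (𝓞 K) K a = N • x i := by
  obtain ⟨N, hN0, hN⟩ := exists_forall_mul_mem_integers fun q : Fin r × Fin r =>
    (g.val q.1 q.2).2
  refine ⟨N, hN0, fun x hx i => exists_algebraMap_eq fun v => ?_⟩
  set y : Fin r → v.adicCompletion K := fun j => ∑ k, finiteComponent v ((g⁻¹).val j k) *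
      algebraMap K (v.adicCompletion K) (x k) with hy
  have h : algebraMap K (v.adicCompletion K) (x i) = ∑ j, finiteComponent v (g.val i j) * y j := by
    have h1 : ((g.val.map (finiteComponent v)) * ((g⁻¹).val.map (finiteComponent v))) = 1 := by
      rw [← Matrix.map_mul, ← Units.val_mul, mul_inv_cancel, Units.val_one,
        Matrix.map_one _ (map_zero _) (map_one _)]
    have h2 := congrFun (congrArg (fun m => Matrix.mulVec m
      fun j => algebraMap K (v.adicCompletion K) (x j)) h1) i
    simp only [Matrix.one_mulVec, ← Matrix.mulVec_mulVec] at h2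
    exact h2.symm
  rw [Algebra.smul_def, map_mul, h, Finset.mul_sum]
  refine sum_mem fun j _ => ?_
  rw [← mul_assoc]
  exact mul_mem (hN (i, j) v) (hx v j)

instance : Module.Finite (𝓞 K) (adelicModule g) := by
  obtain ⟨N, hN0, hN⟩ := exists_smul_adelicModule_integral g
  let L : Submodule (𝓞 K) (Fin r → K) :=
    LinearMap.range ((Algebra.linearMap (𝓞 K) K).compLeft (Fin r))
  have hmem (x : adelicModule g) : N • (x : Fin r → K) ∈ L := by
    choose a ha using hN x x.2
    exact ⟨a, funext ha⟩
  let f : adelicModule g →ₗ[𝓞 K] L :=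
    (LinearMap.lsmul (𝓞 K) (Fin r → K) N ∘ₗ (adelicModule g).subtype).codRestrict L hmem
  refine Module.Finite.of_injective f fun x y hxy => Subtype.ext ?_
  exact smul_right_injective (Fin r → K) hN0 (congrArg Subtype.val hxy)

/-- The submodule `W ∩ E_g` of `E_g`. -/
def adelicInter (W : Submodule K (Fin r → K)) : Submodule (𝓞 K) (adelicModule g) :=
  (W.restrictScalars (𝓞 K)).submoduleOf (adelicModule g)

theorem isSaturated_adelicInter (W : Submodule K (Fin r → K)) :
    IsSaturated (adelicInter g W) := by
  intro a x ha hx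
  have h : (algebraMap (𝓞 K) K a) • (x : Fin r → K) ∈ W := by
    rw [algebraMap_smul]; exact hx
  exact (W.smul_mem_iff (by simpa using ha)).1 h

theorem adelicInter_top : adelicInter g ⊤ = ⊤ := by
  ext x
  exact ⟨fun _ => trivial, fun _ => trivial⟩

/-- Every vector of `W` has a nonzero integral multiple in `E_g`, so `W` is the localization of `W ∩
E_g`. -/
theorem finrank_adelicInter (W : Submodule K (Fin r → K)) :
    finrank (𝓞 K) (adelicInter g W) = finrank K W := by
  let f : adelicInter g W →ₗ[𝓞 K] W :=
    { toFun := fun x => ⟨(x : adelicModule g), x.2⟩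
      map_add' := fun _ _ => rfl
      map_smul' := fun _ _ => rfl }
  have : IsLocalizedModule (nonZeroDivisors (𝓞 K)) f :=
    { map_units := fun a => by
        have ha : algebraMap (𝓞 K) K a ≠ 0 := by simp
        rw [Module.End.isUnit_iff]
        refine ⟨fun x y hxy => ?_, fun y => ⟨(algebraMap (𝓞 K) K a)⁻¹ • y, ?_⟩⟩
        · exact smul_right_injective W (nonZeroDivisors.ne_zero a.2) hxy
        · rw [Module.algebraMap_end_apply, ← algebraMap_smul K, smul_smul, mul_inv_cancel₀ ha,
            one_smul]
      surj := fun y => by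
        obtain ⟨a, ha, hay⟩ := exists_smul_mem_adelicModule g (y : Fin r → K)
        refine ⟨⟨⟨⟨a • (y : Fin r → K), hay⟩, ?_⟩, ⟨a, mem_nonZeroDivisors_of_ne_zero ha⟩⟩, rfl⟩
        change a • (y : Fin r → K) ∈ W
        rw [← algebraMap_smul K]
        exact W.smul_mem _ y.2
      exists_of_eq := fun {x y} hxy => ⟨1, by
        rw [one_smul, one_smul]
        exact Subtype.ext (Subtype.ext (congrArg (fun w : W => (w : Fin r → K)) hxy))⟩ }
  have h : finrank (𝓞 K) W = finrank (𝓞 K) (adelicInter g W) :=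
    IsLocalizedModule.finrank_eq (R := 𝓞 K) (M := adelicInter g W) (N := W)
      (nonZeroDivisors (𝓞 K)) f le_rfl
  rw [← h]
  exact (IsFractionRing.finrank_right_eq (𝓞 K) K W).symm

theorem finrank_adelicModule : finrank (𝓞 K) (adelicModule g) = r := by
  rw [← finrank_top, ← adelicInter_top, finrank_adelicInter, finrank_top, finrank_fin_fun]

/-- The vector `g_v⁻¹ x`. -/
def adelicVec (v : InfinitePlace K) (x : Fin r → K) : Fin r → v.Completion :=
  ((g⁻¹).val.map (infiniteComponent v)).mulVec fun j => algebraMap K v.Completion (x j)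

/-- The inner product of `E_g` at infinity. -/
def adelicInner (x y : Fin r → K) : ℝ :=
  ∑ v : InfinitePlace K, (Completion.extensionEmbedding v
    (∑ i, conjHom v (adelicVec g v x i) * adelicVec g v y i)).re

theorem localEmbedding_one_tmul (N : Submodule (𝓞 K) (Fin r → K)) (v : InfinitePlace K) (x : N) :
    localEmbedding N v (1 ⊗ₜ x) = fun j => algebraMap K v.Completion (x.1 j) :=
  funext fun i => by rw [localEmbedding_tmul, one_mul]

theorem innerInfty_adelicLattice (x y : adelicModule g) :
    (adelicLattice g).innerInfty x y = adelicInner g x y := by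
  refine Finset.sum_congr rfl fun v _ => ?_
  congr 2
  change ∑ i, conjHom v (((g⁻¹).val.map (infiniteComponent v)).mulVec
    (localEmbedding (adelicModule g) v (1 ⊗ₜ x)) i) * ((g⁻¹).val.map (infiniteComponent v)).mulVec
    (localEmbedding (adelicModule g) v (1 ⊗ₜ y)) i = _
  rw [localEmbedding_one_tmul, localEmbedding_one_tmul]
  rfl

/-- The degree of the sublattice `W ∩ E_g`. -/
def adelicDegAt (W : Submodule K (Fin r → K)) : ℝ := (adelicLattice g).degAt (adelicInter g W)

theorem adelicDegAt_top : adelicDegAt g ⊤ = adelicDeg g := by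
  rw [adelicDegAt, adelicInter_top, OKLattice.degAt_top, adelicDeg]

/-- The isomorphism of the two descriptions of `W ∩ E_g`. -/
def adelicInterEquiv (W : Submodule K (Fin r → K)) :
    adelicInter g W ≃ₗ[𝓞 K] ↥(W.restrictScalars (𝓞 K) ⊓ adelicModule g) where
  toFun x := ⟨(x : adelicModule g), x.2, (x : adelicModule g).2⟩
  map_add' _ _ := rfl
  map_smul' _ _ := rfl
  invFun x := ⟨⟨x, x.2.2⟩, x.2.1⟩
  left_inv _ := rfl
  right_inv _ := rfl

theorem covol_adelicInter (W : Submodule K (Fin r → K)) {ι : Type*} [Fintype ι] [DecidableEq ι]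
    (b : Basis ι ℤ ↥(W.restrictScalars (𝓞 K) ⊓ adelicModule g)) :
    (adelicLattice g).covol (adelicInter g W) =
      √(Matrix.of fun i j => adelicInner g (b i) (b j)).det := by
  -- Working with submodules of `K ^ r` lets one basis `b` be used for all `g` with the same `E_g`,
  -- which the continuity argument needs.
  rw [OKLattice.covol_eq_sqrt _ (b.map ((adelicInterEquiv g W).symm.restrictScalars ℤ))]
  simp_rw [innerInfty_adelicLattice]
  rfl

theorem adelicDegAt_eq (W : Submodule K (Fin r → K)) {ι : Type*} [Fintype ι] [DecidableEq ι]
    (b : Basis ι ℤ ↥(W.restrictScalars (𝓞 K) ⊓ adelicModule g)) :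
    adelicDegAt g W = finrank K W *
      (Real.log |(discr K : ℝ)| / 2 - nrComplexPlaces K * Real.log 2) -
        Real.log √(Matrix.of fun i j => adelicInner g (b i) (b j)).det := by
  rw [adelicDegAt, OKLattice.degAt, OKLattice.deg_restrict, finrank_adelicInter,
    covol_adelicInter g W b]

theorem sqrt_det_adelicInner_pos (W : Submodule K (Fin r → K)) {ι : Type*} [Fintype ι]
    [DecidableEq ι] (b : Basis ι ℤ ↥(W.restrictScalars (𝓞 K) ⊓ adelicModule g)) :
    0 < √(Matrix.of fun i j => adelicInner g (b i) (b j)).det := by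
  rw [← covol_adelicInter]
  exact (adelicLattice g).covol_pos _

theorem exists_basis_inter (W : Submodule K (Fin r → K)) :
    ∃ n : ℕ, Nonempty (Basis (Fin n) ℤ ↥(W.restrictScalars (𝓞 K) ⊓ adelicModule g)) := by
  have : Module.Finite (𝓞 K) ↥(W.restrictScalars (𝓞 K) ⊓ adelicModule g) :=
    Module.Finite.of_injective (Submodule.inclusion inf_le_right)
      (Submodule.inclusion_injective (inf_le_right : W.restrictScalars (𝓞 K) ⊓ adelicModule g ≤ _))
  have := finite_int K ↥(W.restrictScalars (𝓞 K) ⊓ adelicModule g)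
  have := free_int K ↥(W.restrictScalars (𝓞 K) ⊓ adelicModule g)
  exact ⟨_, ⟨Module.finBasis ℤ _⟩⟩

theorem flagPolygon_eq (V : SubspaceFlag K r) : flagPolygon V g =
    interpolate (fun i => (finrank K (V.space i) : ℝ))
      (fun i => adelicDegAt g (V.space i) - finrank K (V.space i) * (adelicDeg g / r)) := by
  unfold flagPolygon OKLattice.polygon
  have h (i) : finrank (𝓞 K) (V.filtration g i) = finrank K (V.space i) :=
    finrank_adelicInter g _
  simp_rw [h, finrank_adelicModule]
  rfl

/-! ### Equivariance -/

/-- This is `(γ g)⁻¹ γ = g⁻¹`, read at one place. It shows that `γ` is an isometry from `E_g` to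
`E_{γ g}`. -/
theorem map_diagonal_mul_inv_mulVec {L : Type*} [Field L] [Algebra K L]
    (f : AdeleRing (𝓞 K) K →+* L) (hf : f.comp (algebraMap K (AdeleRing (𝓞 K) K)) = algebraMap K L)
    (γ : GL (Fin r) K) (x : Fin r → K) :
    (((diagonal γ * g)⁻¹).val.map f).mulVec (fun j => algebraMap K L (γ.val.mulVec x j)) =
      ((g⁻¹).val.map f).mulVec fun j => algebraMap K L (x j) := by
  have h1 : (fun j => algebraMap K L (γ.val.mulVec x j)) =
      (γ.val.map (algebraMap K L)).mulVec fun j => algebraMap K L (x j) := by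
    funext j
    exact RingHom.map_mulVec (algebraMap K L) γ.val x j
  have h2 : γ.val.map (algebraMap K L) = (diagonal γ).val.map f := by
    rw [← hf]
    rfl
  rw [h1, h2, Matrix.mulVec_mulVec, ← Matrix.map_mul, ← Units.val_mul, mul_inv_rev, mul_assoc,
    inv_mul_cancel, mul_one]

theorem mulVec_mem_adelicModule_iff (γ : GL (Fin r) K) (x : Fin r → K) :
    γ.val.mulVec x ∈ adelicModule (diagonal γ * g) ↔ x ∈ adelicModule g := by
  refine forall_congr' fun v => forall_congr' fun i => ?_
  have h := map_diagonal_mul_inv_mulVec g (finiteComponent v) rfl γ x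
  have h1 := congrFun h i
  exact Eq.to_iff (congrArg (· ∈ v.adicCompletionIntegers K) h1)

theorem adelicInner_diagonal_mul (γ : GL (Fin r) K) (x y : Fin r → K) :
    adelicInner (diagonal γ * g) (γ.val.mulVec x) (γ.val.mulVec y) = adelicInner g x y := by
  unfold adelicInner adelicVec
  refine Finset.sum_congr rfl fun v _ => ?_
  rw [map_diagonal_mul_inv_mulVec g (infiniteComponent v) rfl,
    map_diagonal_mul_inv_mulVec g (infiniteComponent v) rfl]

/-- The action of `γ` on `K ^ r`. -/
def mulVecEquiv (γ : GL (Fin r) K) : (Fin r → K) ≃ₗ[K] (Fin r → K) :=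
  LinearEquiv.ofLinearMap γ.val.mulVecLin (γ⁻¹).val.mulVecLin
    (by simp [← Matrix.mulVecLin_mul])
    (by simp [← Matrix.mulVecLin_mul])

theorem mulVecEquiv_apply (γ : GL (Fin r) K) (x : Fin r → K) :
    mulVecEquiv γ x = γ.val.mulVec x := rfl

theorem adelicDegAt_diagonal_mul (γ : GL (Fin r) K) (W : Submodule K (Fin r → K)) :
    adelicDegAt (diagonal γ * g) (W.map (mulVecEquiv γ).toLinearMap) = adelicDegAt g W := by
  obtain ⟨n, ⟨b⟩⟩ := exists_basis_inter g W
  let e : ↥(W.restrictScalars (𝓞 K) ⊓ adelicModule g) ≃ₗ[𝓞 K]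
      ↥((W.map (mulVecEquiv γ).toLinearMap).restrictScalars (𝓞 K) ⊓
        adelicModule (diagonal γ * g)) :=
    LinearEquiv.ofBijective
      ((((mulVecEquiv γ).toLinearMap.restrictScalars (𝓞 K)).comp
        (W.restrictScalars (𝓞 K) ⊓ adelicModule g).subtype).codRestrict
          ((W.map (mulVecEquiv γ).toLinearMap).restrictScalars (𝓞 K) ⊓
            adelicModule (diagonal γ * g)) fun x => Submodule.mem_inf.2
          ⟨Submodule.mem_map_of_mem (f := (mulVecEquiv γ).toLinearMap) x.2.1,
            (mulVec_mem_adelicModule_iff g γ x).2 x.2.2⟩)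
      ⟨fun x y hxy => Subtype.ext ((mulVecEquiv γ).injective (congrArg Subtype.val hxy)), by
        rintro ⟨_, ⟨x, hx, rfl⟩, hx2⟩
        exact ⟨⟨x, hx, (mulVec_mem_adelicModule_iff g γ x).1 hx2⟩, rfl⟩⟩
  rw [adelicDegAt_eq g W b, adelicDegAt_eq _ _ (b.map (e.restrictScalars ℤ)),
    LinearEquiv.finrank_map_eq]
  congr 5
  ext i j
  exact adelicInner_diagonal_mul g γ _ _

theorem adelicDeg_diagonal_mul (γ : GL (Fin r) K) : adelicDeg (diagonal γ * g) = adelicDeg g := by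
  rw [← adelicDegAt_top, ← adelicDegAt_top, ← adelicDegAt_diagonal_mul g γ, Submodule.map_top,
    LinearMap.range_eq_top.2 (mulVecEquiv γ).surjective]

/-- The translate `γ V` of a flag. -/
def SubspaceFlag.translate (γ : GL (Fin r) K) (V : SubspaceFlag K r) : SubspaceFlag K r where
  length := V.length
  space i := (V.space i).map (mulVecEquiv γ).toLinearMap
  zero := by rw [V.zero, Submodule.map_bot]
  last := by rw [V.last, Submodule.map_top, LinearMap.range_eq_top.2 (mulVecEquiv γ).surjective]
  strictMono := fun i j hij => Submodule.map_strictMono_of_injective (mulVecEquiv γ).injective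
    (V.strictMono hij)

theorem flagPolygon_translate (γ : GL (Fin r) K) (V : SubspaceFlag K r) :
    flagPolygon (V.translate γ) (diagonal γ * g) = flagPolygon V g := by
  rw [flagPolygon_eq, flagPolygon_eq, adelicDeg_diagonal_mul]
  congr 1
  · funext i
    exact congrArg Nat.cast (LinearEquiv.finrank_map_eq (mulVecEquiv γ) (V.space i))
  · funext i
    exact congrArg₂ (fun a b => a - b * (adelicDeg g / r)) (adelicDegAt_diagonal_mul g γ _)
      (congrArg Nat.cast (LinearEquiv.finrank_map_eq (mulVecEquiv γ) (V.space i)))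

end AdelicLattice

end ArakelovLattice
end

noncomputable section
namespace ArakelovLattice

/-! ### Continuity of the degrees -/

section Continuity

variable {K : Type*} [Field K] [NumberField K] {r : ℕ}

theorem adelicModule_le_of_forall_mem {g h : GL (Fin r) (AdeleRing (𝓞 K) K)}
    (H : ∀ i j v, finiteComponent v ((h⁻¹ * g).val i j) ∈ v.adicCompletionIntegers K) :
    adelicModule g ≤ adelicModule h := by
  intro x hx v i
  have h1 : (h⁻¹).val.map (finiteComponent v) =
      (h⁻¹ * g).val.map (finiteComponent v) * (g⁻¹).val.map (finiteComponent v) := by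
    rw [← Matrix.map_mul, ← Units.val_mul, mul_assoc, mul_inv_cancel, mul_one]
  have h2 := congrFun (congrArg (fun m => Matrix.mulVec m
    fun j => algebraMap K (v.adicCompletion K) (x j)) h1) i
  simp only [← Matrix.mulVec_mulVec] at h2
  have h3 : ((h⁻¹).val.map (finiteComponent v)).mulVec
      (fun j => algebraMap K (v.adicCompletion K) (x j)) i ∈ v.adicCompletionIntegers K := by
    rw [h2]
    exact sum_mem fun j _ => mul_mem (H i j v) (hx v j)
  exact h3

theorem eventually_entries_mem {A : Type*} [CommRing A] [TopologicalSpace A] [IsTopologicalRing A]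
    {U : Set A} (hU : IsOpen U) (h0 : 0 ∈ U) (h1 : 1 ∈ U) (g : GL (Fin r) A) :
    ∀ᶠ h in nhds g, ∀ i j, (h⁻¹ * g).val i j ∈ U ∧ (g⁻¹ * h).val i j ∈ U := by
  have hone (i j : Fin r) : (1 : GL (Fin r) A).val i j ∈ U := by
    rw [Units.val_one, Matrix.one_apply]
    split_ifs
    · exact h1
    · exact h0
  have key (f : GL (Fin r) A → GL (Fin r) A) (hf : Continuous f) (hfg : f g = 1) (i j : Fin r) :
      ∀ᶠ h in nhds g, (f h).val i j ∈ U := by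
    have hc : Continuous fun h => (f h).val i j := (Units.continuous_val.comp hf).matrix_elem i j
    refine (hU.preimage hc).mem_nhds ?_
    rw [Set.mem_preimage, hfg]
    exact hone i j
  refine Filter.eventually_all.2 fun i => Filter.eventually_all.2 fun j => ?_
  exact (key (fun h => h⁻¹ * g) (by fun_prop) (inv_mul_cancel g) i j).and
    (key (fun h => g⁻¹ * h) (by fun_prop) (inv_mul_cancel g) i j)

theorem continuous_inv_entry {A : Type*} [CommRing A] [TopologicalSpace A] [IsTopologicalRing A]
    (i j : Fin r) : Continuous fun g : GL (Fin r) A => (g⁻¹).val i j :=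
  (Units.continuous_val.comp continuous_inv).matrix_elem i j

/-- Near `g` both `h⁻¹ g` and `g⁻¹ h` have integral entries at all finite places, because the
integral adeles are open. -/
theorem eventually_adelicModule_eq (g : GL (Fin r) (AdeleRing (𝓞 K) K)) :
    ∀ᶠ h in nhds g, adelicModule h = adelicModule g := by
  have hopen : IsOpen {a : AdeleRing (𝓞 K) K |
      ∀ v, finiteComponent v a ∈ v.adicCompletionIntegers K} :=
    isOpen_integralAdeles.preimage continuous_snd
  have h0 : (0 : AdeleRing (𝓞 K) K) ∈ {a : AdeleRing (𝓞 K) K |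
      ∀ v, finiteComponent v a ∈ v.adicCompletionIntegers K} := fun v => by
    rw [map_zero]; exact zero_mem _
  have h1 : (1 : AdeleRing (𝓞 K) K) ∈ {a : AdeleRing (𝓞 K) K |
      ∀ v, finiteComponent v a ∈ v.adicCompletionIntegers K} := fun v => by
    rw [map_one]; exact one_mem _
  filter_upwards [eventually_entries_mem hopen h0 h1 g] with h hh
  exact le_antisymm (adelicModule_le_of_forall_mem fun i j => (hh i j).2)
    (adelicModule_le_of_forall_mem fun i j => (hh i j).1)

theorem continuous_adelicInner (x y : Fin r → K) :
    Continuous fun g : GL (Fin r) (AdeleRing (𝓞 K) K) => adelicInner g x y := by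
  have hvec (v : InfinitePlace K) (x : Fin r → K) (i : Fin r) :
      Continuous fun g : GL (Fin r) (AdeleRing (𝓞 K) K) => adelicVec g v x i := by
    change Continuous fun g : GL (Fin r) (AdeleRing (𝓞 K) K) =>
      ∑ j, infiniteComponent v ((g⁻¹).val i j) * algebraMap K v.Completion (x j)
    refine continuous_finsetSum _ fun j _ => Continuous.mul ?_ continuous_const
    exact (continuous_infiniteComponent v).comp (continuous_inv_entry i j)
  have hemb (v : InfinitePlace K) : Continuous (Completion.extensionEmbedding v) :=
    (Completion.isometry_extensionEmbedding v).continuous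
  unfold adelicInner
  simp only [map_sum, map_mul, extensionEmbedding_conjHom]
  refine continuous_finsetSum _ fun v _ => Complex.continuous_re.comp ?_
  exact continuous_finsetSum _ fun i _ =>
    (Complex.continuous_conj.comp ((hemb v).comp (hvec v x i))).mul ((hemb v).comp (hvec v y i))

theorem adelicDegAt_eq_of_adelicModule_eq {g : GL (Fin r) (AdeleRing (𝓞 K) K)}
    {E : Submodule (𝓞 K) (Fin r → K)} (hE : adelicModule g = E) (W : Submodule K (Fin r → K))
    {ι : Type*} [Fintype ι] [DecidableEq ι] (b : Basis ι ℤ ↥(W.restrictScalars (𝓞 K) ⊓ E)) :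
    adelicDegAt g W = finrank K W *
      (Real.log |(discr K : ℝ)| / 2 - nrComplexPlaces K * Real.log 2) -
        Real.log √(Matrix.of fun i j => adelicInner g (b i) (b j)).det := by
  subst hE
  exact adelicDegAt_eq g W b

/-- Locally `E_g` is constant, so the degree is computed with a fixed basis and only the archimedean
inner products vary. -/
theorem continuous_adelicDegAt (W : Submodule K (Fin r → K)) :
    Continuous fun g : GL (Fin r) (AdeleRing (𝓞 K) K) => adelicDegAt g W := by
  refine continuous_iff_continuousAt.2 fun g => ?_
  obtain ⟨n, ⟨b⟩⟩ := exists_basis_inter g W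
  have heq : (fun h => adelicDegAt h W) =ᶠ[nhds g] fun h => finrank K W *
      (Real.log |(discr K : ℝ)| / 2 - nrComplexPlaces K * Real.log 2) -
        Real.log √(Matrix.of fun i j => adelicInner h (b i) (b j)).det := by
    filter_upwards [eventually_adelicModule_eq g] with h hh
    exact adelicDegAt_eq_of_adelicModule_eq hh W b
  refine ContinuousAt.congr ?_ heq.symm
  have hpos := sqrt_det_adelicInner_pos g W b
  have hcont : Continuous fun h : GL (Fin r) (AdeleRing (𝓞 K) K) =>
      √(Matrix.of fun i j => adelicInner h (b i : Fin r → K) (b j)).det :=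
    Real.continuous_sqrt.comp
      (Continuous.matrix_det (continuous_matrix fun i j => continuous_adelicInner _ _))
  exact continuousAt_const.sub (hcont.continuousAt.log hpos.ne')

theorem continuous_adelicDeg :
    Continuous fun g : GL (Fin r) (AdeleRing (𝓞 K) K) => adelicDeg g := by
  simp_rw [← adelicDegAt_top]
  exact continuous_adelicDegAt ⊤

theorem continuous_flagPolygon (V : SubspaceFlag K r) (s : ℝ) :
    Continuous fun g : GL (Fin r) (AdeleRing (𝓞 K) K) => flagPolygon V g s := by
  simp_rw [flagPolygon_eq, interpolate]
  have h (i) : Continuous fun g : GL (Fin r) (AdeleRing (𝓞 K) K) =>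
      adelicDegAt g (V.space i) - finrank K (V.space i) * (adelicDeg g / r) :=
    (continuous_adelicDegAt _).sub (continuous_const.mul (continuous_adelicDeg.div_const _))
  exact (h 0).add (continuous_finsetSum _ fun i _ =>
    (((h i.succ).sub (h i.castSucc)).div_const _).mul continuous_const)

end Continuity

/-! ### Flags -/

section Flags

variable {K : Type*} [Field K] [NumberField K] {r : ℕ}

theorem SubspaceFlag.strictMono_finrank (V : SubspaceFlag K r) :
    StrictMono fun i => (finrank K (V.space i) : ℝ) := fun _ _ h => by
  exact Nat.cast_lt.2 (Submodule.finrank_lt_finrank_of_lt (V.strictMono h))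

theorem flagPolygon_finrank (g : GL (Fin r) (AdeleRing (𝓞 K) K)) (V : SubspaceFlag K r) (i) :
    flagPolygon V g (finrank K (V.space i)) =
      adelicDegAt g (V.space i) - finrank K (V.space i) * (adelicDeg g / r) := by
  rw [flagPolygon_eq]
  exact interpolate_apply V.strictMono_finrank _ i

theorem exists_adelicDegAt_le (g : GL (Fin r) (AdeleRing (𝓞 K) K)) :
    ∃ B : ℝ, ∀ W : Submodule K (Fin r → K), adelicDegAt g W ≤ B := by
  obtain ⟨δ, hδ, h⟩ := (adelicLattice g).exists_le_covol
  set e := Real.log |(discr K : ℝ)| / 2 - nrComplexPlaces K * Real.log 2 with he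
  refine ⟨r * |e| - Real.log δ, fun W => ?_⟩
  rw [adelicDegAt, OKLattice.degAt, OKLattice.deg_restrict, finrank_adelicInter, ← he]
  have h1 : (finrank K W : ℝ) ≤ r := by
    exact_mod_cast (Submodule.finrank_le _).trans (finrank_fin_fun K).le
  have h2 : finrank K W * e ≤ r * |e| :=
    (mul_le_mul_of_nonneg_left (le_abs_self e) (Nat.cast_nonneg _)).trans
      (mul_le_mul_of_nonneg_right h1 (abs_nonneg _))
  have h3 := Real.log_le_log hδ (h (adelicInter g W))
  linarith

/-- Needed for the supremum in `maxPolygon` to be genuine: a real supremum over an unbounded set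
takes a default value. The bound comes from the lower bound for covolumes of sublattices of `E_g`.
-/
theorem bddAbove_flagPolygon (g : GL (Fin r) (AdeleRing (𝓞 K) K)) {s : ℝ}
    (hs : s ∈ Set.Icc (0 : ℝ) r) : BddAbove (Set.range fun V : SubspaceFlag K r => flagPolygon V g s) := by
  obtain ⟨B, hB⟩ := exists_adelicDegAt_le g
  refine ⟨B + r * |adelicDeg g / r|, ?_⟩
  rintro _ ⟨V, rfl⟩
  change flagPolygon V g s ≤ _
  have h0 : finrank K (V.space 0) = 0 := by rw [V.zero, finrank_bot]
  have h1 : finrank K (V.space (Fin.last _)) = r := by rw [V.last, finrank_top, finrank_fin_fun]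
  have h := interpolate_le_of_forall_le (a := 0) (b := B + r * |adelicDeg g / r|)
    V.strictMono_finrank (y := fun i =>
      adelicDegAt g (V.space i) - finrank K (V.space i) * (adelicDeg g / r)) (s := s) (fun i => ?_)
      (by simpa [h0, h1] using hs)
  · rw [flagPolygon_eq]
    simpa using h
  · have h2 : (finrank K (V.space i) : ℝ) ≤ r := by
      exact_mod_cast (Submodule.finrank_le _).trans (finrank_fin_fun K).le
    have h3 : -(finrank K (V.space i) * (adelicDeg g / r)) ≤ r * |adelicDeg g / r| := by
      rw [← mul_neg]
      exact (mul_le_mul_of_nonneg_left (neg_le_abs _) (Nat.cast_nonneg _)).trans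
        (mul_le_mul_of_nonneg_right h2 (abs_nonneg _))
    have := hB (V.space i)
    linarith

theorem maxPolygon_le_iff {P : Subgroup (GL (Fin r) K)} {V₀ : SubspaceFlag K r}
    (hV₀ : V₀.parabolic ≤ P) (g : GL (Fin r) (AdeleRing (𝓞 K) K)) {s a : ℝ}
    (hs : s ∈ Set.Icc (0 : ℝ) r) :
    maxPolygon P g s ≤ a ↔ ∀ V : SubspaceFlag K r, V.parabolic ≤ P → flagPolygon V g s ≤ a := by
  have : Nonempty {V : SubspaceFlag K r // V.parabolic ≤ P} := ⟨⟨V₀, hV₀⟩⟩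
  have hb : BddAbove (Set.range fun V : {V : SubspaceFlag K r // V.parabolic ≤ P} =>
      flagPolygon V.1 g s) :=
    (bddAbove_flagPolygon g hs).mono (by rintro _ ⟨V, rfl⟩; exact ⟨V.1, rfl⟩)
  exact (ciSup_le_iff hb).trans Subtype.forall

theorem mem_parabolic_translate {γ δ : GL (Fin r) K} {V : SubspaceFlag K r} :
    δ ∈ (V.translate γ).parabolic ↔ γ⁻¹ * δ * γ ∈ V.parabolic := by
  have hinv (x : Fin r → K) : γ⁻¹.val.mulVec (γ.val.mulVec x) = x := by
    rw [Matrix.mulVec_mulVec, ← Units.val_mul, inv_mul_cancel, Units.val_one, Matrix.one_mulVec]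
  have hinv' (x : Fin r → K) : γ.val.mulVec (γ⁻¹.val.mulVec x) = x := by
    rw [Matrix.mulVec_mulVec, ← Units.val_mul, mul_inv_cancel, Units.val_one, Matrix.one_mulVec]
  have hmul (x : Fin r → K) :
      (γ⁻¹ * δ * γ).val.mulVec x = γ⁻¹.val.mulVec (δ.val.mulVec (γ.val.mulVec x)) := by
    rw [Matrix.mulVec_mulVec, Matrix.mulVec_mulVec, ← Units.val_mul, ← Units.val_mul, mul_assoc]
  have hmem (i : Fin (V.length + 1)) (x : Fin r → K) :
      x ∈ (V.translate γ).space i ↔ γ⁻¹.val.mulVec x ∈ V.space i := by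
    refine ⟨?_, fun h => ⟨_, h, hinv' x⟩⟩
    rintro ⟨y, hy, rfl⟩
    rw [LinearEquiv.coe_coe, mulVecEquiv_apply, hinv]
    exact hy
  have hiff (i : Fin (V.length + 1)) : (∀ x, δ.val.mulVec x ∈ (V.translate γ).space i ↔
      x ∈ (V.translate γ).space i) ↔
      ∀ x, (γ⁻¹ * δ * γ).val.mulVec x ∈ V.space i ↔ x ∈ V.space i := by
    refine ⟨fun h x => ?_, fun h x => ?_⟩
    · rw [hmul, ← hmem, h, hmem, hinv]
    · rw [hmem, hmem, ← h (γ⁻¹.val.mulVec x), hmul, hinv']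
  exact forall_congr' hiff

theorem translate_eq_self {γ : GL (Fin r) K} {V : SubspaceFlag K r} (hγ : γ ∈ V.parabolic) :
    V.translate γ = V := by
  have h : (V.translate γ).space = V.space := by
    funext i
    refine le_antisymm ?_ fun x hx => ⟨γ⁻¹.val.mulVec x, ?_, ?_⟩
    · rintro _ ⟨y, hy, rfl⟩
      exact (hγ i y).2 hy
    · exact (V.parabolic.inv_mem hγ i x).2 hx
    · rw [LinearEquiv.coe_coe, mulVecEquiv_apply, Matrix.mulVec_mulVec, ← Units.val_mul,
        mul_inv_cancel, Units.val_one, Matrix.one_mulVec]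
  cases V
  simp only [SubspaceFlag.translate] at h ⊢
  congr 1

/-- The matrices `g` of degree `d` such that `p_Q^g ≤ p` for all `Q` contained in the stabilizer
`P` of `V`, and `p_P^g ≥ -p`. -/
def boundedSet (V : SubspaceFlag K r) (d : ℝ) (p : ℝ → ℝ) : Set (GL (Fin r) (AdeleRing (𝓞 K) K)) :=
  {g | adelicDeg g = d ∧ ∀ s ∈ Set.Icc (0 : ℝ) r,
    (∀ W : SubspaceFlag K r, W.parabolic ≤ V.parabolic → flagPolygon W g s ≤ p s) ∧
      -p s ≤ flagPolygon V g s}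

theorem isClosed_boundedSet (V : SubspaceFlag K r) (d : ℝ) (p : ℝ → ℝ) :
    IsClosed (boundedSet V d p) := by
  have h : boundedSet V d p = {g | adelicDeg g = d} ∩ ⋂ s ∈ Set.Icc (0 : ℝ) r,
      ((⋂ W : {W : SubspaceFlag K r // W.parabolic ≤ V.parabolic}, {g | flagPolygon W.1 g s ≤ p s}) ∩
        {g | -p s ≤ flagPolygon V g s}) := by
    ext g
    simp [boundedSet]
  rw [h]
  refine (isClosed_eq continuous_adelicDeg continuous_const).inter
    (isClosed_biInter fun s _ => IsClosed.inter (isClosed_iInter fun W => ?_) ?_)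
  · exact isClosed_le (continuous_flagPolygon _ _) continuous_const
  · exact isClosed_le continuous_const (continuous_flagPolygon _ _)

/-- An element of the stabilizer fixes `V` and permutes the flags whose stabilizers are contained in
that of `V`. -/
theorem diagonal_mul_mem_boundedSet {V : SubspaceFlag K r} {d : ℝ} {p : ℝ → ℝ} {γ : GL (Fin r) K}
    (hγ : γ ∈ V.parabolic) {g : GL (Fin r) (AdeleRing (𝓞 K) K)} (hg : g ∈ boundedSet V d p) :
    diagonal γ * g ∈ boundedSet V d p := by
  refine ⟨(adelicDeg_diagonal_mul g γ).trans hg.1, fun s hs => ⟨fun W hW => ?_, ?_⟩⟩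
  · have h1 := (hg.2 s hs).1 (W.translate γ⁻¹) fun δ hδ => by
      have h2 := hW (mem_parabolic_translate.1 hδ)
      rw [inv_inv] at h2
      simpa [mul_assoc] using V.parabolic.mul_mem (V.parabolic.mul_mem (V.parabolic.inv_mem hγ) h2) hγ
    rw [← flagPolygon_translate (diagonal γ * g) γ⁻¹ W]
    rwa [map_inv, inv_mul_cancel_left]
  · have h := flagPolygon_translate g γ V
    rw [translate_eq_self hγ] at h
    rw [h]
    exact (hg.2 s hs).2

end Flags

end ArakelovLattice
end

noncomputable section
namespace ArakelovLattice

/-! ### Matrices `g` such that `E_g` contains the standard basis -/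

section StandardBasis

variable {K : Type*} [Field K] [NumberField K] {r : ℕ} {h : GL (Fin r) (AdeleRing (𝓞 K) K)}

theorem single_mem_adelicModule_iff : (∀ j, (Pi.single j 1 : Fin r → K) ∈ adelicModule h) ↔
    ∀ v i j, finiteComponent v ((h⁻¹).val i j) ∈ v.adicCompletionIntegers K := by
  have key (j v i) : ∑ j', finiteComponent v ((h⁻¹).val i j') *
      algebraMap K (v.adicCompletion K) ((Pi.single j 1 : Fin r → K) j') =
      finiteComponent v ((h⁻¹).val i j) := by
    rw [Finset.sum_eq_single j (fun j' _ hj => by rw [Pi.single_eq_of_ne hj, map_zero, mul_zero])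
      (by simp), Pi.single_eq_same, map_one, mul_one]
  simp_rw [mem_adelicModule_iff, key]
  exact ⟨fun H v i j => H j v i, fun H j v i => H v i j⟩

/-- A column of `h_v` is congruent modulo integers to a vector `c` of `K ^ r` integral at the other
places. As `h⁻¹` is integral everywhere, `c` lies in `E_h`, so `M c` is integral, and with it `M`
times the column. -/
theorem mul_entry_mem_integers (he : ∀ j, (Pi.single j 1 : Fin r → K) ∈ adelicModule h) {M : ℕ}
    (hM : ∀ x ∈ adelicModule h, ∀ i, ∃ a : 𝓞 K, algebraMap (𝓞 K) K a = M * x i)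
    (v : HeightOneSpectrum (𝓞 K)) (i j : Fin r) :
    (M : v.adicCompletion K) * finiteComponent v (h.val i j) ∈ v.adicCompletionIntegers K := by
  rw [single_mem_adelicModule_iff] at he
  choose c hc hcw using fun i => exists_sub_mem_integers v (finiteComponent v (h.val i j))
  have hmem : c ∈ adelicModule h := by
    refine (mem_adelicModule_iff h c).2 fun w i => ?_
    by_cases hw : w = v
    · subst hw
      have h1 : ∑ k, finiteComponent w ((h⁻¹).val i k) * finiteComponent w (h.val k j) ∈
          w.adicCompletionIntegers K := by
        have h2 : ∑ k, finiteComponent w ((h⁻¹).val i k) * finiteComponent w (h.val k j) =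
            finiteComponent w ((1 : Matrix (Fin r) (Fin r) (AdeleRing (𝓞 K) K)) i j) := by
          rw [← Units.val_one, ← inv_mul_cancel h, Units.val_mul, Matrix.mul_apply, map_sum]
          simp_rw [map_mul]
        rw [h2, Matrix.one_apply]
        split_ifs
        · rw [map_one]; exact one_mem _
        · rw [map_zero]; exact zero_mem _
      have h3 : ∑ k, finiteComponent w ((h⁻¹).val i k) * algebraMap K (w.adicCompletion K) (c k) =
          ∑ k, finiteComponent w ((h⁻¹).val i k) * finiteComponent w (h.val k j) -
            ∑ k, finiteComponent w ((h⁻¹).val i k) *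
              (finiteComponent w (h.val k j) - algebraMap K (w.adicCompletion K) (c k)) := by
        rw [← Finset.sum_sub_distrib]
        exact Finset.sum_congr rfl fun k _ => by ring
      rw [h3]
      exact sub_mem h1 (sum_mem fun k _ => mul_mem (he w i k) (hc k))
    · exact sum_mem fun k _ => mul_mem (he w i k) ((algebraMap_mem_integers_iff w _).2 (hcw k w hw))
  obtain ⟨a, ha⟩ := hM c hmem i
  have h4 : (M : v.adicCompletion K) * finiteComponent v (h.val i j) =
      (M : v.adicCompletion K) *
        (finiteComponent v (h.val i j) - algebraMap K (v.adicCompletion K) (c i)) +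
      algebraMap K (v.adicCompletion K) (algebraMap (𝓞 K) K a) := by
    rw [ha, map_mul, map_natCast]
    ring
  rw [h4]
  exact add_mem (mul_mem (natCast_mem _ M) (hc i)) (HeightOneSpectrum.coe_algebraMap_mem _ _ v a)

theorem adelicInner_self (x : Fin r → K) :
    adelicInner h x x = ∑ v : InfinitePlace K, ∑ i, ‖adelicVec h v x i‖ ^ 2 := by
  refine Finset.sum_congr rfl fun v _ => ?_
  rw [map_sum, Complex.re_sum]
  refine Finset.sum_congr rfl fun i _ => ?_
  rw [map_mul, extensionEmbedding_conjHom, ← Complex.normSq_eq_conj_mul_self, Complex.ofReal_re,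
    Complex.normSq_eq_norm_sq, norm_extensionEmbedding]

theorem adelicVec_single (v : InfinitePlace K) (i j : Fin r) :
    adelicVec h v (Pi.single j 1) i = infiniteComponent v ((h⁻¹).val i j) := by
  change ∑ j', infiniteComponent v ((h⁻¹).val i j') *
    algebraMap K v.Completion ((Pi.single j 1 : Fin r → K) j') = _
  rw [Finset.sum_eq_single j (fun j' _ hj => by rw [Pi.single_eq_of_ne hj, map_zero, mul_zero])
      (by simp), Pi.single_eq_same, map_one, mul_one]

/-- At each infinite place the `j`-th column of `h⁻¹` has the length of the `j`-th standard basis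
vector for the inner product of `E_h`. -/
theorem norm_inv_entry_le {R : ℝ} (hR0 : 0 ≤ R) {j : Fin r}
    (hR : adelicInner h (Pi.single j 1) (Pi.single j 1) ≤ R ^ 2) (v : InfinitePlace K) (i : Fin r) :
    ‖infiniteComponent v ((h⁻¹).val i j)‖ ≤ R := by
  refine le_of_sq_le_sq (le_trans ?_ hR) hR0
  rw [adelicInner_self, ← adelicVec_single]
  exact (Finset.single_le_sum (f := fun i => ‖adelicVec h v (Pi.single j 1) i‖ ^ 2)
    (fun _ _ => sq_nonneg _) (Finset.mem_univ i)).trans (Finset.single_le_sum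
      (f := fun v => ∑ i, ‖adelicVec h v (Pi.single j 1) i‖ ^ 2)
      (fun _ _ => Finset.sum_nonneg fun _ _ => sq_nonneg _) (Finset.mem_univ v))

/-- The standard basis of `K ^ r` in `E_h`. -/
def stdFamily (he : ∀ j, (Pi.single j 1 : Fin r → K) ∈ adelicModule h) (j : Fin r) :
    adelicModule h := ⟨Pi.single j 1, he j⟩

theorem linearIndependent_stdFamily (he : ∀ j, (Pi.single j 1 : Fin r → K) ∈ adelicModule h) :
    LinearIndependent (𝓞 K) (stdFamily he) := by
  have h1 : LinearIndependent K fun j : Fin r => (Pi.single j 1 : Fin r → K) := by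
    have := (Pi.basisFun K (Fin r)).linearIndependent
    convert this using 2 with j
    simp
  have h2 := h1.restrict_scalars' (𝓞 K)
  exact LinearIndependent.of_comp (adelicModule h).subtype h2

theorem norm_toAmbient_sq (x : adelicModule h) :
    ‖(adelicLattice h).toAmbient x‖ ^ 2 = adelicInner h x x := by
  rw [← innerInfty_adelicLattice, ← OKLattice.inner_toAmbient, real_inner_self_eq_norm_sq]

/-- The covolume of `E_h` for `h` of degree `d`. -/
def adelicCovol (K : Type*) [Field K] [NumberField K] (r : ℕ) (d : ℝ) : ℝ :=
  Real.exp (r * (Real.log |(discr K : ℝ)| / 2 - nrComplexPlaces K * Real.log 2) - d)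

theorem covol_top_adelicLattice :
    (adelicLattice h).covol ⊤ = adelicCovol K r (adelicDeg h) := by
  rw [OKLattice.covol_top_eq_exp, finrank_adelicModule]
  rfl

theorem exists_factorial_mul_eq (he : ∀ j, (Pi.single j 1 : Fin r → K) ∈ adelicModule h) {R d : ℝ}
    (hR0 : 0 ≤ R) (hR : ∀ j, adelicInner h (Pi.single j 1) (Pi.single j 1) ≤ R ^ 2)
    (hd : adelicDeg h = d) (x) (hx : x ∈ adelicModule h) (i : Fin r) :
    ∃ a : 𝓞 K, algebraMap (𝓞 K) K a =
      ((indexBound K r R (adelicCovol K r d)).factorial : ℕ) * x i := by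
  obtain ⟨m, hm0, hm, hspan⟩ := (adelicLattice h).exists_smul_mem_span (finrank_adelicModule h)
    (linearIndependent_stdFamily he) (R := R) (δ := adelicCovol K r d)
    (fun j => le_of_sq_le_sq ((norm_toAmbient_sq _).trans_le (hR j)) hR0) (Real.exp_pos _)
    (by rw [covol_top_adelicLattice, hd])
  obtain ⟨c, hc⟩ := Nat.dvd_factorial hm0 hm
  obtain ⟨a, ha⟩ := (Submodule.mem_span_range_iff_exists_fun (𝓞 K)).1 (hspan ⟨x, hx⟩)
  have h1 := congrFun (congrArg Subtype.val ha) i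
  have h2 : (∑ j, a j • (Pi.single j 1 : Fin r → K)) i = (m • x) i := by
    refine Eq.trans ?_ h1
    simp [stdFamily]
  refine ⟨c * a i, ?_⟩
  have h3 : algebraMap (𝓞 K) K (a i) = m * x i := by
    rw [Pi.smul_apply, nsmul_eq_mul] at h2
    rw [← h2, Finset.sum_apply, Finset.sum_eq_single i]
    · rw [Pi.smul_apply, Pi.single_eq_same, Algebra.smul_def, mul_one]
    · intro j _ hj
      rw [Pi.smul_apply, Pi.single_eq_of_ne hj.symm, smul_zero]
    · simp
  rw [map_mul, map_natCast, h3, hc]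
  push_cast
  ring

theorem localEmbedding_sum_single (he : ∀ j, (Pi.single j 1 : Fin r → K) ∈ adelicModule h)
    (v : InfinitePlace K) (z : Fin r → v.Completion) :
    localEmbedding (adelicModule h) v (∑ i, z i ⊗ₜ stdFamily he i) = z := by
  funext k
  rw [map_sum, Finset.sum_apply, Finset.sum_eq_single k]
  · have h1 : (stdFamily he k).1 k = 1 := Pi.single_eq_same _ _
    rw [localEmbedding_tmul, h1, map_one, mul_one]
  · intro i _ hi
    have h1 : (stdFamily he i).1 k = 0 := Pi.single_eq_of_ne hi.symm _
    rw [localEmbedding_tmul, h1, map_zero, mul_zero]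
  · simp

/-- The columns of `h_v` are orthonormal for the inner product at `v`, since `h⁻¹` takes them to the
standard basis. -/
theorem innerAt_sum_single (he : ∀ j, (Pi.single j 1 : Fin r → K) ∈ adelicModule h)
    (v : InfinitePlace K) (k : Fin r) :
    (adelicLattice h).innerAt v (∑ i, infiniteComponent v (h.val i k) ⊗ₜ stdFamily he i)
      (∑ i, infiniteComponent v (h.val i k) ⊗ₜ stdFamily he i) = 1 := by
  change ∑ i, conjHom v (((h⁻¹).val.map (infiniteComponent v)).mulVec
    (localEmbedding (adelicModule h) v _) i) * ((h⁻¹).val.map (infiniteComponent v)).mulVec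
    (localEmbedding (adelicModule h) v _) i = _
  rw [localEmbedding_sum_single]
  have h1 (i : Fin r) : ((h⁻¹).val.map (infiniteComponent v)).mulVec
      (fun i => infiniteComponent v (h.val i k)) i = if i = k then 1 else 0 := by
    change ∑ j, infiniteComponent v ((h⁻¹).val i j) * infiniteComponent v (h.val j k) = _
    simp_rw [← map_mul]
    rw [← map_sum, ← Matrix.mul_apply, ← Units.val_mul, inv_mul_cancel, Units.val_one,
      Matrix.one_apply, apply_ite (infiniteComponent v), map_one, map_zero]
  simp_rw [h1]
  rw [Finset.sum_eq_single k (fun i _ hi => by rw [if_neg hi, mul_zero]) (by simp), if_pos rfl,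
    mul_one]
  exact extensionEmbedding_injective v (by simp)

-- A column of `h_v` is a unit vector of the lattice space. Its real coordinates in the `ω_i e_j`
-- are bounded by `exists_abs_coeff_le`, as these vectors are short and the fixed degree bounds
-- their Gram determinant from below.
variable (K r) in
theorem exists_norm_entry_le (R d : ℝ) : ∃ B : ℝ, ∀ h : GL (Fin r) (AdeleRing (𝓞 K) K),
    adelicDeg h = d → (∀ j, (Pi.single j 1 : Fin r → K) ∈ adelicModule h) →
      (∀ j, adelicInner h (Pi.single j 1) (Pi.single j 1) ≤ R ^ 2) →
        ∀ v i k, ‖infiniteComponent v (h.val i k)‖ ≤ B := by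
  classical
  obtain ⟨C, hC, H⟩ := exists_abs_coeff_le (Free.ChooseBasisIndex ℤ (𝓞 K) × Fin r)
    (basisBound K * |R|) (adelicCovol K r d ^ 2) (pow_pos (Real.exp_pos _) 2)
  refine ⟨∑ _q : Free.ChooseBasisIndex ℤ (𝓞 K), C * basisBound K, fun h hd he hR v i k => ?_⟩
  have hy := linearIndependent_stdFamily he
  set Λ := adelicLattice h
  set u : LocalSpace K (adelicModule h) v :=
    ∑ i, infiniteComponent v (h.val i k) ⊗ₜ stdFamily he i with hu
  choose t ht using fun i => exists_real_coeff
    (Pi.single v (infiniteComponent v (h.val i k)) : ∀ w : InfinitePlace K, w.Completion)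
  have hsum : ∑ q : Free.ChooseBasisIndex ℤ (𝓞 K) × Fin r,
      t q.2 q.1 • Λ.toAmbient (RingOfIntegers.basis K q.1 • stdFamily he q.2) =
        Λ.ambientSingle v u := by
    refine funext fun w => ?_
    refine (OKLattice.Ambient.sum_apply _ _ _ _).trans ?_
    have h1 (q : Free.ChooseBasisIndex ℤ (𝓞 K) × Fin r) :
        (t q.2 q.1 • Λ.toAmbient (RingOfIntegers.basis K q.1 • stdFamily he q.2)) w =
          (realHom w (t q.2 q.1) * algebraMap (𝓞 K) w.Completion (RingOfIntegers.basis K q.1)) ⊗ₜ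
            stdFamily he q.2 := by
      change realHom w (t q.2 q.1) • ((1 : w.Completion) ⊗ₜ[𝓞 K]
        (RingOfIntegers.basis K q.1 • stdFamily he q.2)) = _
      rw [TensorProduct.smul_tmul', ← TensorProduct.smul_tmul, smul_eq_mul, mul_one,
        Algebra.smul_def, mul_comm]
    refine (Finset.sum_congr rfl fun q _ => h1 q).trans ?_
    rw [Fintype.sum_prod_type_right]
    simp_rw [← TensorProduct.sum_tmul, ← ht]
    by_cases hw : w = v
    · subst hw
      simp_rw [Pi.single_eq_same]
      exact (Pi.single_eq_same (M := fun w : InfinitePlace K => LocalSpace K (adelicModule h) w)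
        w u).symm
    · simp_rw [Pi.single_eq_of_ne hw, TensorProduct.zero_tmul, Finset.sum_const_zero]
      exact (Pi.single_eq_of_ne (M := fun w : InfinitePlace K => LocalSpace K (adelicModule h) w)
        hw u).symm
  have hnorm : ‖Λ.ambientSingle v u‖ = 1 := by
    have h1 := Λ.norm_sq_ambientSingle v u
    rw [hu, innerAt_sum_single he v k, map_one, Complex.one_re] at h1
    exact (pow_eq_one_iff_of_nonneg (norm_nonneg _) two_ne_zero).1 h1
  have hcoeff (q : Free.ChooseBasisIndex ℤ (𝓞 K) × Fin r) : |t q.2 q.1| ≤ C := by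
    have h1 := H (fun q : Free.ChooseBasisIndex ℤ (𝓞 K) × Fin r =>
        Λ.toAmbient (RingOfIntegers.basis K q.1 • stdFamily he q.2)) (fun q =>
      (Λ.norm_toAmbient_basis_smul_le q.1 (stdFamily he q.2)).trans
        (mul_le_mul_of_nonneg_left (le_of_sq_le_sq
          ((norm_toAmbient_sq _).trans_le ((hR q.2).trans_eq (sq_abs R).symm)) (abs_nonneg R))
            (basisBound_nonneg K))) (by
      have h2 := Λ.covol_span_sq hy
      refine le_trans ?_ (h2.le.trans_eq (by congr!))
      refine pow_le_pow_left₀ (Real.exp_pos _).le ?_ 2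
      change adelicCovol K r d ≤ _
      rw [← hd, ← covol_top_adelicLattice]
      exact Λ.covol_top_le_covol _ (by
        rw [finrank_span_eq_card hy, Fintype.card_fin, finrank_adelicModule]))
      (fun q => t q.2 q.1) q
    rw [hsum, hnorm, mul_one] at h1
    exact h1
  have h1 := ht i v
  rw [Pi.single_eq_same] at h1
  rw [h1]
  refine norm_sum_le_of_le _ fun q _ => (norm_realHom_mul_le v _ _).trans ?_
  refine mul_le_mul (hcoeff (q, i)) ?_ (norm_nonneg _) hC.le
  rw [← norm_extensionEmbedding]
  exact (congrArg norm (extensionEmbedding_algebraMap v _)).trans_le (norm_embedding_basis_le v q)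

variable (K r) in
/-- The set of all `h` of degree `d` such that `E_h` contains the standard basis and its members
have bounded norm is relatively compact. -/
theorem exists_isCompact_of_norm_single_le (R d : ℝ) (hR0 : 0 ≤ R) :
    ∃ C : Set (GL (Fin r) (AdeleRing (𝓞 K) K)), IsCompact C ∧
      ∀ h : GL (Fin r) (AdeleRing (𝓞 K) K), adelicDeg h = d →
        (∀ j, (Pi.single j 1 : Fin r → K) ∈ adelicModule h) →
          (∀ j, adelicInner h (Pi.single j 1) (Pi.single j 1) ≤ R ^ 2) → h ∈ C := by
  obtain ⟨B, hB⟩ := exists_norm_entry_le K r R d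
  -- One box serves `h` and `h⁻¹`: at infinity `B` bounds the entries of `h` and `R` those of `h⁻¹`;
  -- the factorial clears the denominators of `h`, and `h⁻¹` is already integral.
  refine ⟨_, isCompact_units_matrix (isCompact_adeleBox (max B R)
    (Nat.factorial_ne_zero (indexBound K r R (adelicCovol K r d)))), fun h hd he hR i j => ⟨⟨?_, ?_⟩, ?_, ?_⟩⟩
  · exact fun v => (hB h hd he hR v i j).trans (le_max_left _ _)
  · exact fun v => mul_entry_mem_integers he (exists_factorial_mul_eq he hR0 hR hd) v i j
  · exact fun v => (norm_inv_entry_le hR0 (hR j) v i).trans (le_max_right _ _)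
  · exact fun v => mul_mem (natCast_mem _ _) (single_mem_adelicModule_iff.1 he v i j)

end StandardBasis

end ArakelovLattice
end

noncomputable section
namespace ArakelovLattice

/-! ### Bases adapted to a standard flag -/

section Refinement

variable {K : Type*} [Field K] [NumberField K] {r : ℕ}

/-- The flag obtained by inserting a subspace. -/
def SubspaceFlag.insert (V : SubspaceFlag K r) (k : Fin V.length) (W : Submodule K (Fin r → K))
    (h1 : V.space k.castSucc < W) (h2 : W < V.space k.succ) : SubspaceFlag K r where
  length := V.length + 1
  space := Fin.insertNth (α := fun _ => Submodule K (Fin r → K)) k.succ.castSucc W V.space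
  zero := by
    have h := Fin.succAbove_ne_zero_zero (a := k.succ.castSucc)
      (by simp [Fin.ext_iff])
    rw [← h, Fin.insertNth_apply_succAbove, V.zero]
  last := by
    have h := Fin.succAbove_ne_last_last (a := k.succ.castSucc) (Fin.castSucc_lt_last _).ne
    rw [← h, Fin.insertNth_apply_succAbove, V.last]
  strictMono := by
    intro i j hij
    rcases Fin.eq_self_or_eq_succAbove k.succ.castSucc i with rfl | ⟨i, rfl⟩ <;>
      rcases Fin.eq_self_or_eq_succAbove k.succ.castSucc j with rfl | ⟨j, rfl⟩
    · exact absurd hij (lt_irrefl _)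
    · rw [Fin.insertNth_apply_same, Fin.insertNth_apply_succAbove]
      rw [Fin.lt_succAbove_iff_le_castSucc, Fin.castSucc_le_castSucc_iff] at hij
      exact h2.trans_le (V.strictMono.monotone hij)
    · rw [Fin.insertNth_apply_same, Fin.insertNth_apply_succAbove]
      rw [Fin.succAbove_lt_iff_castSucc_lt, Fin.castSucc_lt_castSucc_iff,
        ← Fin.le_castSucc_iff] at hij
      exact (V.strictMono.monotone hij).trans_lt h1
    · rw [Fin.insertNth_apply_succAbove, Fin.insertNth_apply_succAbove]
      exact V.strictMono (Fin.succAbove_lt_succAbove_iff.1 hij)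

theorem SubspaceFlag.exists_refinement (V : SubspaceFlag K r) (k : Fin V.length)
    {W : Submodule K (Fin r → K)} (h1 : V.space k.castSucc ≤ W) (h2 : W < V.space k.succ) :
    ∃ F : SubspaceFlag K r, F.parabolic ≤ V.parabolic ∧ ∃ i, F.space i = W := by
  rcases h1.eq_or_lt with h | h
  · exact ⟨V, le_rfl, _, h⟩
  · refine ⟨V.insert k W h h2, fun γ hγ i x => ?_, k.succ.castSucc,
      Fin.insertNth_apply_same (α := fun _ => Submodule K (Fin r → K)) _ _ _⟩
    have h3 : (V.insert k W h h2).space (k.succ.castSucc.succAbove i) = V.space i :=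
      Fin.insertNth_apply_succAbove (α := fun _ => Submodule K (Fin r → K)) _ _ _ _
    rw [← h3]
    exact hγ _ x

theorem finrank_standardFlag (I : Composition r) (j : Fin (I.length + 1)) :
    finrank K ((standardFlag K I).space j) = I.sizeUpTo j := by
  have hle := I.sizeUpTo_le j
  let e : (standardFlag K I).space j ≃ₗ[K] (Fin (I.sizeUpTo j) → K) :=
    { toFun := fun x i => x.1 (Fin.castLE hle i)
      map_add' := fun _ _ => rfl
      map_smul' := fun _ _ => rfl
      invFun := fun y => ⟨fun i => if h : (i : ℕ) < I.sizeUpTo j then y ⟨i, h⟩ else 0,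
        fun i hi => dif_neg (not_lt.2 hi)⟩
      left_inv := fun x => Subtype.ext (funext fun i => by
        by_cases h : (i : ℕ) < I.sizeUpTo j
        · exact dif_pos h
        · exact (dif_neg h).trans (x.2 i (not_lt.1 h)).symm)
      right_inv := fun y => funext fun i => dif_pos i.2 }
  rw [e.finrank_eq, finrank_fin_fun]

theorem linearIndependent_coe (g : GL (Fin r) (AdeleRing (𝓞 K) K)) {ι : Type*}
    {x : ι → adelicModule g} (hx : LinearIndependent (𝓞 K) x) :
    LinearIndependent K fun j => (x j : Fin r → K) :=
  LinearIndependent.iff_fractionRing (𝓞 K) K |>.1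
    (hx.map' (adelicModule g).subtype (Submodule.ker_subtype _))

/-- Links the intrinsic construction of short families with subspaces of `K ^ r`: both sides are
saturated, of the same rank, and one contains the other. -/
theorem saturation_span_eq (g : GL (Fin r) (AdeleRing (𝓞 K) K)) {k : ℕ}
    {x : Fin k → adelicModule g} (hx : LinearIndependent (𝓞 K) x) :
    saturation (Submodule.span (𝓞 K) (Set.range x)) =
      adelicInter g (Submodule.span K (Set.range fun j => (x j : Fin r → K))) := by
  refine eq_of_le_of_finrank_eq (isSaturated_saturation _)
    (saturation_le (isSaturated_adelicInter g _) ?_) ?_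
  · rw [Submodule.span_le]
    rintro _ ⟨j, rfl⟩
    exact Submodule.subset_span ⟨j, rfl⟩
  · rw [finrank_saturation_span hx, finrank_adelicInter,
      finrank_span_eq_card (linearIndependent_coe g hx), Fintype.card_fin]

theorem standardFlag_mono (I : Composition r) {i j : Fin (I.length + 1)} (h : i ≤ j) :
    (standardFlag K I).space i ≤ (standardFlag K I).space j :=
  (standardFlag K I).strictMono.monotone h

/-- A linearly independent family of `k` vectors compatible with the standard flag spans a subspace
between two successive members of the flag. -/
theorem span_mem_Ico_standardFlag (I : Composition r) {k : ℕ} (hk : k < r)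
    {x : Fin k → Fin r → K} (hx : LinearIndependent K x)
    (hV : ∀ j : Fin k, x j ∈ (standardFlag K I).space (I.index ⟨j, j.2.trans hk⟩).succ) :
    (standardFlag K I).space (I.index ⟨k, hk⟩).castSucc ≤ Submodule.span K (Set.range x) ∧
      Submodule.span K (Set.range x) < (standardFlag K I).space (I.index ⟨k, hk⟩).succ := by
  have h1 : I.sizeUpTo (I.index ⟨k, hk⟩) ≤ k := I.sizeUpTo_index_le ⟨k, hk⟩
  have h2 : k < I.sizeUpTo (I.index ⟨k, hk⟩ + 1) := I.lt_sizeUpTo_index_succ ⟨k, hk⟩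
  have hmono {i j : Fin r} (hij : i ≤ j) : I.index i ≤ I.index j := by
    by_contra hlt
    push Not at hlt
    have h3 : I.sizeUpTo (I.index j + 1) ≤ I.sizeUpTo (I.index i) :=
      I.monotone_sizeUpTo (Nat.succ_le_of_lt hlt)
    have h4 := I.sizeUpTo_index_le i
    have h5 : (j : ℕ) < I.sizeUpTo (I.index j + 1) := I.lt_sizeUpTo_index_succ j
    have h6 : (i : ℕ) ≤ j := hij
    omega
  constructor
  -- The first `t` vectors belong to earlier blocks, hence lie in the lower member of the flag,
  -- whose dimension is exactly `t`; so they already span it.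
  · set t := I.sizeUpTo (I.index ⟨k, hk⟩) with ht
    have h3 : LinearIndependent K (x ∘ Fin.castLE h1) :=
      hx.comp _ (Fin.castLE_injective h1)
    have h4 : Submodule.span K (Set.range (x ∘ Fin.castLE h1)) ≤
        (standardFlag K I).space (I.index ⟨k, hk⟩).castSucc := by
      rw [Submodule.span_le]
      rintro _ ⟨j, rfl⟩
      refine standardFlag_mono I ?_ (hV (Fin.castLE h1 j))
      rw [Fin.succ_le_castSucc_iff]
      by_contra hge
      have h5 : I.sizeUpTo (I.index ⟨k, hk⟩) ≤
          I.sizeUpTo (I.index ⟨(Fin.castLE h1 j : Fin k), (Fin.castLE h1 j).2.trans hk⟩) :=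
        I.monotone_sizeUpTo (not_lt.1 hge)
      have h6 := I.sizeUpTo_index_le ⟨(Fin.castLE h1 j : Fin k), (Fin.castLE h1 j).2.trans hk⟩
      have h7 : t ≤ j := h5.trans h6
      exact absurd j.2 (not_lt.2 h7)
    have h5 := Submodule.eq_of_le_of_finrank_eq h4 (by
      rw [finrank_span_eq_card h3, Fintype.card_fin, finrank_standardFlag, Fin.val_castSucc])
    rw [← h5]
    exact Submodule.span_mono (Set.range_comp_subset_range _ _)
  · refine lt_of_le_of_ne ?_ fun heq => ?_
    · rw [Submodule.span_le]
      rintro _ ⟨j, rfl⟩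
      exact standardFlag_mono I (Fin.succ_le_succ_iff.2 (hmono (Fin.le_def.2 j.2.le))) (hV j)
    · have h3 := congrArg (fun W : Submodule K (Fin r → K) => finrank K W) heq
      simp only [finrank_span_eq_card hx, Fintype.card_fin, finrank_standardFlag,
        Fin.val_succ] at h3
      omega

/-- `W` is a member of a flag refining `V`, so its degree is bounded above through `p`, while that
of the upper member is bounded below through `-p`. The term `|d|` absorbs the different
normalizations by rank. -/
theorem sub_le_of_mem_boundedSet (V : SubspaceFlag K r) {d : ℝ} {p : ℝ → ℝ}
    {g : GL (Fin r) (AdeleRing (𝓞 K) K)} (hg : g ∈ boundedSet V d p) (k : Fin V.length)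
    {W : Submodule K (Fin r → K)} (h1 : V.space k.castSucc ≤ W) (h2 : W < V.space k.succ) :
    adelicDegAt g W - adelicDegAt g (V.space k.succ) ≤ 2 * integralBound p r + |d| := by
  obtain ⟨F, hF, i, rfl⟩ := V.exists_refinement k h1 h2
  have hle (U : Submodule K (Fin r → K)) : finrank K U ≤ r :=
    (Submodule.finrank_le _).trans (finrank_fin_fun K).le
  have hIcc (U : Submodule K (Fin r → K)) : (finrank K U : ℝ) ∈ Set.Icc (0 : ℝ) r :=
    ⟨Nat.cast_nonneg _, Nat.cast_le.2 (hle U)⟩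
  have h3 := (hg.2 _ (hIcc (F.space i))).1 F hF
  have h4 := (hg.2 _ (hIcc (V.space k.succ))).2
  rw [flagPolygon_finrank, hg.1] at h3 h4
  have h5 := (le_abs_self _).trans (abs_le_integralBound p (hle (F.space i)))
  have h6 := (le_abs_self _).trans (abs_le_integralBound p (hle (V.space k.succ)))
  have h7 : ((finrank K (F.space i) : ℝ) - finrank K (V.space k.succ)) * (d / r) ≤ |d| := by
    refine (le_abs_self _).trans ?_
    rw [abs_mul, abs_div, Nat.abs_cast, ← mul_div_assoc]
    refine div_le_of_le_mul₀ (Nat.cast_nonneg _) (abs_nonneg _) ?_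
    rw [mul_comm |d|]
    refine mul_le_mul_of_nonneg_right ?_ (abs_nonneg d)
    have h8 := hIcc (F.space i)
    have h9 := hIcc (V.space k.succ)
    rw [abs_le]
    constructor <;> linarith [h8.1, h8.2, h9.1, h9.2]
  linarith

/-- A bound for the norms of the members of a basis adapted to a standard flag. -/
def adaptedBound (K : Type*) [Field K] [NumberField K] (r : ℕ) (d : ℝ) (p : ℝ → ℝ) : ℝ :=
  familyBound K r (OKLattice.covolBound K r (2 * integralBound p r + |d|)) r

/-- The `k`-th vector is sought in the member of the flag that ends the block of `k`. The span of
the previous vectors then lies between two consecutive members, where the covolumes are comparable.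
-/
theorem exists_adapted_basis (I : Composition r) {d : ℝ} {p : ℝ → ℝ}
    {g : GL (Fin r) (AdeleRing (𝓞 K) K)} (hg : g ∈ boundedSet (standardFlag K I) d p) :
    ∃ x : Fin r → Fin r → K, LinearIndependent K x ∧ (∀ j, x j ∈ adelicModule g) ∧
      (∀ j, x j ∈ (standardFlag K I).space (I.index j).succ) ∧
        ∀ j, adelicInner g (x j) (x j) ≤ adaptedBound K r d p ^ 2 := by
  set Λ := adelicLattice g
  -- The value `⊤` for `k ≥ r` is a filler and never enters.
  set V : ℕ → Submodule (𝓞 K) (adelicModule g) := fun k => if h : k < r then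
    adelicInter g ((standardFlag K I).space (I.index ⟨k, h⟩).succ) else ⊤ with hV
  have H : ∀ k < r, ∀ x : Fin k → adelicModule g, LinearIndependent (𝓞 K) x →
      (∀ j : Fin k, x j ∈ V j) →
        saturation (Submodule.span (𝓞 K) (Set.range x)) < V k ∧ Λ.covol (V k) ≤
          OKLattice.covolBound K r (2 * integralBound p r + |d|) *
            Λ.covol (saturation (Submodule.span (𝓞 K) (Set.range x))) := by
    intro k hk x hx hxV
    have hVk : V k = adelicInter g ((standardFlag K I).space (I.index ⟨k, hk⟩).succ) := dif_pos hk
    have hxK := linearIndependent_coe g hx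
    obtain ⟨h1, h2⟩ := span_mem_Ico_standardFlag I hk hxK fun j => by
      have h3 := hxV j
      rw [hV] at h3
      simp only [dif_pos (j.2.trans hk)] at h3
      exact h3
    rw [saturation_span_eq g hx, hVk]
    refine ⟨lt_of_le_of_ne (fun y hy => h2.le hy) fun heq => ?_,
      Λ.covol_le_exp_mul_covol (finrank_adelicModule g).le
        (sub_le_of_mem_boundedSet (standardFlag K I) hg _ h1 h2)⟩
    have h3 := congrArg (fun N : Submodule (𝓞 K) (adelicModule g) => finrank (𝓞 K) N) heq
    simp only [finrank_adelicInter] at h3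
    exact (Submodule.finrank_lt_finrank_of_lt h2).ne h3
  obtain ⟨x, hx, hxV, hxR⟩ := Λ.exists_adapted_family (finrank_adelicModule g).le V H r le_rfl
  refine ⟨fun j => x j, linearIndependent_coe g hx, fun j => (x j).2, fun j => ?_, fun j => ?_⟩
  · have h3 := hxV j
    rw [hV] at h3
    simp only [dif_pos j.2] at h3
    exact h3
  · rw [← norm_toAmbient_sq]
    exact pow_le_pow_left₀ (norm_nonneg _) (hxR j) 2

end Refinement

end ArakelovLattice
end

noncomputable section
namespace ArakelovLattice

/-! ### Compactness in the adelic quotients -/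

section AdelicCompact

variable {K : Type*} [Field K] [NumberField K] {r : ℕ}

/-- Every matrix in the bounded set is equivalent under the stabilizer of the standard flag to one
for which the standard basis vectors are short elements of the lattice. -/
theorem exists_diagonal_mul_single (I : Composition r) {d : ℝ} {p : ℝ → ℝ}
    {g : GL (Fin r) (AdeleRing (𝓞 K) K)} (hg : g ∈ boundedSet (standardFlag K I) d p) :
    ∃ γ ∈ (standardFlag K I).parabolic,
      (∀ j, (Pi.single j 1 : Fin r → K) ∈ adelicModule (diagonal γ * g)) ∧
      ∀ j, adelicInner (diagonal γ * g) (Pi.single j 1) (Pi.single j 1) ≤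
        adaptedBound K r d p ^ 2 := by
  obtain ⟨x, hx, hxE, hxV, hxR⟩ := exists_adapted_basis I hg
  -- The columns of `A` are the adapted basis. Adaptation to the flag means that `A` is block upper
  -- triangular, and its inverse moves the basis to the standard one.
  set A : Matrix (Fin r) (Fin r) K := Matrix.of fun i j => x j i with hA
  have hunit : IsUnit A := Matrix.linearIndependent_cols_iff_isUnit.1 hx
  obtain ⟨δ, hδ⟩ := hunit
  have hcol (j : Fin r) : δ.val.mulVec (Pi.single j 1) = x j := by
    rw [hδ, Matrix.mulVec_single_one]
    rfl
  have hmem : δ ∈ (standardFlag K I).parabolic := by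
    rw [mem_parabolic_standardFlag, hδ]
    intro i j hij
    exact hxV j i ((I.monotone_sizeUpTo (Nat.succ_le_of_lt hij)).trans (I.sizeUpTo_index_le i))
  have hmul : diagonal δ * (diagonal δ⁻¹ * g) = g := by
    rw [map_inv, mul_inv_cancel_left]
  refine ⟨δ⁻¹, Subgroup.inv_mem _ hmem, fun j => ?_, fun j => ?_⟩
  · rw [← mulVec_mem_adelicModule_iff _ δ, hcol, hmul]
    exact hxE j
  · rw [← adelicInner_diagonal_mul _ δ, hcol, hmul]
    exact hxR j

theorem AdelicQuotient.continuous_mk (H : Subgroup (GL (Fin r) K)) :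
    Continuous (AdelicQuotient.mk H) :=
  continuous_quotient_mk'

theorem AdelicQuotient.mk_diagonal_mul {H : Subgroup (GL (Fin r) K)} {γ : GL (Fin r) K}
    (hγ : γ ∈ H) (g : GL (Fin r) (AdeleRing (𝓞 K) K)) :
    AdelicQuotient.mk H (diagonal γ * g) = AdelicQuotient.mk H g := by
  refine Quotient.sound ?_
  rw [← Quotient.eq_iff_equiv, Quotient.eq, QuotientGroup.rightRel_apply, mul_inv_rev,
    mul_inv_cancel_left]
  exact Subgroup.inv_mem _ ⟨γ, hγ, rfl⟩

/-- Every class has a representative in the compact set `C`, and the bounded set is closed and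
invariant under the stabilizer. -/
theorem isCompact_image_boundedSet (I : Composition r) (d : ℝ) (p : ℝ → ℝ) :
    IsCompact (AdelicQuotient.mk (standardFlag K I).parabolic ''
      boundedSet (standardFlag K I) d p) := by
  obtain ⟨C, hC, H⟩ := exists_isCompact_of_norm_single_le K r (adaptedBound K r d p) d
    (familyBound_nonneg _ _ _)
  have h := ((hC.inter_right (isClosed_boundedSet (standardFlag K I) d p)).image
    (AdelicQuotient.continuous_mk (standardFlag K I).parabolic))
  have heq : AdelicQuotient.mk (standardFlag K I).parabolic '' boundedSet (standardFlag K I) d p =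
      AdelicQuotient.mk (standardFlag K I).parabolic ''
        (C ∩ boundedSet (standardFlag K I) d p) := by
    refine Set.Subset.antisymm ?_ (Set.image_mono Set.inter_subset_right)
    rintro _ ⟨g, hg, rfl⟩
    obtain ⟨γ, hγ, h1, h2⟩ := exists_diagonal_mul_single I hg
    exact ⟨diagonal γ * g, ⟨H _ ((adelicDeg_diagonal_mul g γ).trans hg.1) h1 h2,
      diagonal_mul_mem_boundedSet hγ hg⟩, AdelicQuotient.mk_diagonal_mul hγ g⟩
  rw [heq]
  exact h

theorem isCompact_parabolic (I : Composition r) (d : ℝ) (p : ℝ → ℝ) :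
    IsCompact {x : AdelicQuotient (standardFlag K I).parabolic |
      ∃ g, AdelicQuotient.mk (standardFlag K I).parabolic g = x ∧ adelicDeg g = d ∧
        ∀ s ∈ Set.Icc (0 : ℝ) r, maxPolygon (standardFlag K I).parabolic g s ≤ p s ∧
          -p s ≤ flagPolygon (standardFlag K I) g s} := by
  convert isCompact_image_boundedSet (K := K) I d p using 1
  ext x
  have key (g : GL (Fin r) (AdeleRing (𝓞 K) K)) : (adelicDeg g = d ∧
      ∀ s ∈ Set.Icc (0 : ℝ) r, maxPolygon (standardFlag K I).parabolic g s ≤ p s ∧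
        -p s ≤ flagPolygon (standardFlag K I) g s) ↔ g ∈ boundedSet (standardFlag K I) d p :=
    and_congr Iff.rfl (forall_congr' fun s => forall_congr' fun hs =>
      and_congr (maxPolygon_le_iff le_rfl g hs) Iff.rfl)
  exact exists_congr fun g => by rw [key, and_comm]

theorem parabolic_single (hr : 0 < r) :
    (standardFlag K (Composition.single r hr)).parabolic = ⊤ := by
  refine eq_top_iff.2 fun γ _ => (mem_parabolic_standardFlag _ γ).2 fun i j hij => ?_
  have h := Composition.single_length hr
  have h1 := ((Composition.single r hr).index i).2
  have h2 : ((Composition.single r hr).index j : ℕ) < (Composition.single r hr).index i := hij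
  omega

theorem adelicDegAt_bot (g : GL (Fin r) (AdeleRing (𝓞 K) K)) : adelicDegAt g ⊥ = 0 := by
  have : Subsingleton ↥((⊥ : Submodule K (Fin r → K)).restrictScalars (𝓞 K) ⊓ adelicModule g) :=
    ⟨fun x y => Subtype.ext (((Submodule.mem_bot K).1 x.2.1).trans
      ((Submodule.mem_bot K).1 y.2.1).symm)⟩
  rw [adelicDegAt_eq g ⊥ (Basis.empty (ι := Fin 0) _), finrank_bot, Matrix.det_fin_zero]
  simp

/-- The flag has only the two end members, and a normalized polygon vanishes at both ends. -/
theorem flagPolygon_single (hr : 0 < r) (g : GL (Fin r) (AdeleRing (𝓞 K) K)) (s : ℝ) :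
    flagPolygon (standardFlag K (Composition.single r hr)) g s = 0 := by
  set V := standardFlag K (Composition.single r hr) with hV
  have hlen : V.length = 1 := Composition.single_length hr
  have h (i : Fin (V.length + 1)) :
      adelicDegAt g (V.space i) - finrank K (V.space i) * (adelicDeg g / r) = 0 := by
    have hi : i = 0 ∨ i = Fin.last V.length := by
      rw [Fin.ext_iff, Fin.ext_iff, Fin.val_zero, Fin.val_last]
      omega
    rcases hi with rfl | rfl
    · rw [V.zero, adelicDegAt_bot, finrank_bot, Nat.cast_zero,
        zero_mul, sub_zero]
    · rw [V.last, adelicDegAt_top, finrank_top, finrank_fin_fun,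
        mul_div_cancel₀ _ (Nat.cast_ne_zero.2 hr.ne'), sub_self]
  rw [flagPolygon_eq]
  simp [interpolate, h]

theorem isCompact_top (hr : 0 < r) (d : ℝ) (p : ℝ → ℝ) :
    IsCompact {x : AdelicQuotient (⊤ : Subgroup (GL (Fin r) K)) |
      ∃ g, AdelicQuotient.mk ⊤ g = x ∧ adelicDeg g = d ∧
        ∀ s ∈ Set.Icc (0 : ℝ) r, maxPolygon ⊤ g s ≤ p s} := by
  have h := isCompact_parabolic (K := K) (Composition.single r hr) d p
  have h0 (g : GL (Fin r) (AdeleRing (𝓞 K) K)) {s : ℝ} (hs : s ∈ Set.Icc (0 : ℝ) r) :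
      maxPolygon ⊤ g s ≤ p s → -p s ≤ flagPolygon (standardFlag K (Composition.single r hr)) g s := by
    intro h1
    -- The trivial flag is among the competitors and has polygon zero, so `0 ≤ p s` and the lower
    -- bound of part 3 holds.
    have h2 := (maxPolygon_le_iff (V₀ := standardFlag K (Composition.single r hr)) le_top g hs).1 h1
      (standardFlag K (Composition.single r hr)) le_top
    rw [flagPolygon_single] at h2 ⊢
    linarith
  rw [parabolic_single hr] at h
  convert h using 6 with x g
  exact and_congr Iff.rfl (forall_congr' fun s => forall_congr' fun hs =>
    ⟨fun h1 => ⟨h1, h0 g hs h1⟩, And.left⟩)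

end AdelicCompact

end ArakelovLattice
end


theorem mainTheorem4 (K : Type*) [Field K] [NumberField K] (r : ℕ) (hr : 0 < r)
    (p : ℝ → ℝ) (hp : IsPolygon r p) :
    (∀ (P : Type*) [AddCommGroup P] [Module (𝓞 K) P] [Module.Finite (𝓞 K) P]
        [Module.Projective (𝓞 K) P], Module.finrank (𝓞 K) P = r →
      IsCompact {x : LatticeSpace K P | ∃ Λ : OKLattice K P, Λ.toSpace = x ∧
        ∃ (n : ℕ) (F : Fin (n + 1) → Submodule (𝓞 K) P), Λ.IsCanonicalFiltration F ∧
          ∀ s ∈ Set.Icc (0 : ℝ) r, Λ.polygon F s ≤ p s}) ∧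
    (∀ d : ℝ,
      IsCompact {x : AdelicQuotient (⊤ : Subgroup (GL (Fin r) K)) |
        ∃ g, AdelicQuotient.mk ⊤ g = x ∧ adelicDeg g = d ∧
          ∀ s ∈ Set.Icc (0 : ℝ) r, maxPolygon ⊤ g s ≤ p s}) ∧
    (∀ (d : ℝ) (I : Composition r),
      IsCompact {x : AdelicQuotient (standardFlag K I).parabolic |
        ∃ g, AdelicQuotient.mk (standardFlag K I).parabolic g = x ∧ adelicDeg g = d ∧
          ∀ s ∈ Set.Icc (0 : ℝ) r,
            maxPolygon (standardFlag K I).parabolic g s ≤ p s ∧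
              -p s ≤ flagPolygon (standardFlag K I) g s}) := by
  refine ⟨fun P _ _ _ _ hP => ?_, fun d => isCompact_top hr d p,
    fun d I => isCompact_parabolic I d p⟩
  have : Module.IsTorsionFree (𝓞 K) P := inferInstance
  exact OKLattice.isCompact_canonical hr hP p
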